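/- Let $F$ be a nonarchimedean local field with ring of integers $\mathfrak o_F$ and residue field of order $q$. Let $G=GL(2,F)$, let $Z\cong F^\times$ be its center, $K=GL(2,\mathfrak o_F)$, and let $B\subset G$ be the subgroup of upper-triangular matrices. The smooth Steinberg representation of $G$ is the quotient, by the constant functions, of the space of functions $f:G\to\mathbb C$ that satisfy $f(bg)=f(g)$ for all $b\in B$, $g\in G$ and are invariant under right translation by some open subgroup of $G$, with $G$ acting by right translation. By the (unitary) Steinberg representation we mean a unitary completion of it: a strongly continuous unitary representation $(\pi,\mathcal H)$ of $G$ on a complex Hilbert space, together with an injective $G$-equivariant linear map from the smooth Steinberg representation onto a dense subspace of $\mathcal H$. Such a completion exists. Normalize Haar measure on $G/Z$ so that $\operatorname{vol}(ZK/Z)=\frac{1}{2}(q-1)$. Then the formal dimension of the Steinberg representation is $d_{\mathrm{St}}=1$. That is, every unitary completion $(\pi,\mathcal H)$ as above is a discrete series representation (it is irreducible and its matrix coefficients are square-integrable modulo $Z$), and for all $u,v,u',v'\in\mathcal H$ the function $g\mapsto(\pi(g)u,v)\overline{(\pi(g)u',v')}$ descends to an integrable function on $G/Z$ with $$\int_{G/Z}(\pi(g)u,v)\,\overline{(\pi(g)u',v')}\,d\dot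 g=\frac{1}{d_{\mathrm{St}}}(u,u')\,\overline{(v,v')},\qquad d_{\mathrm{St}}=1.$$ -/

import Mathlib

open MeasureTheory ValuativeRel

universe u v

noncomputable section

/-! ### Smooth induction of the trivial character, and the smooth Steinberg representation -/

/-- Right translation of complex functions on a group: `(rightTranslation G g f) x = f (x * g)`. -/
def rightTranslation (G : Type*) [Group G] : Representation ℂ G (G → ℂ) where
  toFun g := LinearMap.funLeft ℂ ℂ (fun x : G => x * g)
  map_one' := by
    ext f x
    simp [LinearMap.funLeft_apply]
  map_mul' g h := by
    ext f x
    simp [LinearMap.funLeft_apply, mul_assoc]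

/-- The space of the smooth (unnormalized) induction to `G` of the trivial character of a
subgroup `B`: functions `f : G → ℂ` with `f (b * x) = f x` for `b ∈ B` which are invariant under
right translation by some open subgroup. -/
def smoothInd (G : Type*) [Group G] [TopologicalSpace G] (B : Subgroup G) :
    Submodule ℂ (G → ℂ) where
  carrier := {f | (∀ b ∈ B, ∀ x, f (b * x) = f x) ∧
    ∃ U : Subgroup G, IsOpen (U : Set G) ∧ ∀ u ∈ U, ∀ x, f (x * u) = f x}
  zero_mem' := ⟨fun _ _ _ => rfl, ⊤, by simp, fun _ _ _ => rfl⟩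
  add_mem' := by
    rintro f₁ f₂ ⟨h₁, U₁, hU₁, k₁⟩ ⟨h₂, U₂, hU₂, k₂⟩
    refine ⟨fun b hb x => by simp [h₁ b hb, h₂ b hb], U₁ ⊓ U₂, ?_, fun u hu x => ?_⟩
    · simpa using hU₁.inter hU₂
    · simp [k₁ u hu.1, k₂ u hu.2]
  smul_mem' := by
    rintro c f ⟨h, U, hU, k⟩
    exact ⟨fun b hb x => by simp [h b hb], U, hU, fun u hu x => by simp [k u hu]⟩

/-- The smooth induction of the trivial character of `B`: `G` acts by right translation. -/
def smoothIndRep (G : Type*) [Group G] [TopologicalSpace G] [ContinuousMul G] (B : Subgroup G) :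
    Representation ℂ G (smoothInd G B) :=
  (rightTranslation G).subrepresentation (smoothInd G B) (by
    rintro g f ⟨h, U, hU, k⟩
    refine ⟨fun b hb x => ?_, U.comap (MulAut.conj g⁻¹).toMonoidHom, ?_, fun u hu x => ?_⟩
    · simp [rightTranslation, LinearMap.funLeft_apply, mul_assoc, h b hb]
    · refine hU.preimage (?_ : Continuous fun x : G => g⁻¹ * x * (g⁻¹)⁻¹)
      fun_prop
    · have hu' : g⁻¹ * u * g ∈ U := by simpa using hu
      have := k _ hu' (x * g)
      simpa [rightTranslation, LinearMap.funLeft_apply, mul_assoc] using this)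

/-- The constant functions inside `smoothInd G B`. -/
def constFunctions (G : Type*) [Group G] [TopologicalSpace G] (B : Subgroup G) :
    Submodule ℂ (smoothInd G B) :=
  (Submodule.span ℂ {(fun _ => 1 : G → ℂ)}).comap (smoothInd G B).subtype

/-- The quotient of the smooth induction of the trivial character by the constant functions. -/
def smoothIndModConst (G : Type*) [Group G] [TopologicalSpace G] [ContinuousMul G]
    (B : Subgroup G) : Representation ℂ G (smoothInd G B ⧸ constFunctions G B) :=
  (smoothIndRep G B).quotient (constFunctions G B) (by
    rintro g ⟨f, hf⟩ h
    obtain ⟨c, rfl⟩ := Submodule.mem_span_singleton.1 h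
    exact Submodule.mem_span_singleton.2 ⟨c, rfl⟩)

/-- The subgroup of upper-triangular matrices in `GL(2,F)`. -/
def upperTriangularGL2 (F : Type*) [Field F] : Subgroup (GL (Fin 2) F) where
  carrier := {g | g 1 0 = 0}
  one_mem' := by simp
  mul_mem' := by
    intro a b (ha : a 1 0 = 0) (hb : b 1 0 = 0)
    simp [Matrix.mul_apply, Fin.sum_univ_two, ha, hb]
  inv_mem' := by
    intro a (ha : a 1 0 = 0)
    simp [Matrix.inv_def, Matrix.adjugate_fin_two, ha]

/-- The smooth Steinberg representation of `GL(2,F)`: the representation smoothly induced from the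
trivial character of the upper-triangular subgroup, modulo its one-dimensional subrepresentation
of constant functions. -/
abbrev smoothSteinberg (F : Type*) [Field F] [TopologicalSpace F] [IsTopologicalRing F] :
    Representation ℂ (GL (Fin 2) F)
      (smoothInd (GL (Fin 2) F) (upperTriangularGL2 F) ⧸
        constFunctions (GL (Fin 2) F) (upperTriangularGL2 F)) :=
  smoothIndModConst (GL (Fin 2) F) (upperTriangularGL2 F)

/-! ### Unitary representations, discrete series modulo the centre, formal dimension -/

/-- A (strongly continuous) unitary representation of `G` on the Hilbert space `H`. -/
structure UnitaryRep (G : Type*) [Group G] [TopologicalSpace G] (H : Type*)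
    [NormedAddCommGroup H] [InnerProductSpace ℂ H] [CompleteSpace H] where
  toHom : G →* unitary (H →L[ℂ] H)
  continuous_apply : ∀ v : H, Continuous fun g : G => (toHom g : H →L[ℂ] H) v

namespace UnitaryRep

variable {G : Type*} [Group G] [TopologicalSpace G] {H : Type*}
  [NormedAddCommGroup H] [InnerProductSpace ℂ H] [CompleteSpace H]

/-- The operator `π(g)`. -/
def op (π : UnitaryRep G H) (g : G) : H →L[ℂ] H := (π.toHom g : H →L[ℂ] H)

/-- The matrix coefficient `g ↦ (π(g) u, v)`, linear in `u` and conjugate-linear in `v`. -/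
def coeff (π : UnitaryRep G H) (u v : H) (g : G) : ℂ := inner ℂ v (π.op g u)

/-- `π` is (topologically) irreducible: `H ≠ 0` and the only closed invariant subspaces are `0`
and `H`. -/
def IsIrreducible (π : UnitaryRep G H) : Prop :=
  Nontrivial H ∧ ∀ W : Submodule ℂ H, IsClosed (W : Set H) →
    (∀ g : G, ∀ w ∈ W, π.op g w ∈ W) → W = ⊥ ∨ W = ⊤

/-- The Hilbert space representation `π` is a unitary completion of the representation `σ`: there
is an injective `G`-equivariant linear map from the space of `σ` onto a dense subspace of `H`. -/
def IsCompletionOf (π : UnitaryRep G H) {V : Type*} [AddCommGroup V] [Module ℂ V]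
    (σ : Representation ℂ G V) : Prop :=
  ∃ ι : V →ₗ[ℂ] H, Function.Injective ι ∧ DenseRange ι ∧ ∀ g v, ι (σ g v) = π.op g (ι v)

variable [MeasurableSpace (G ⧸ Subgroup.center G)]

/-- `π` is a discrete series representation (with respect to the measure `μ` on `G ⧸ Z`): it is
irreducible, and the absolute values of its matrix coefficients descend to square-integrable
functions on `G ⧸ Z`. -/
def IsDiscreteSeries (π : UnitaryRep G H) (μ : Measure (G ⧸ Subgroup.center G)) : Prop :=
  π.IsIrreducible ∧ ∀ u v : H, ∃ φ : G ⧸ Subgroup.center G → ℝ,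
    (∀ g : G, φ g = ‖π.coeff u v g‖) ∧ MemLp φ 2 μ

/-- `π` is a discrete series representation whose formal dimension with respect to `μ` is `d`:
`d > 0` and, for all `u, v, u', v'`, the function
`g ↦ (π(g) u, v) * conj (π(g) u', v')` descends to an integrable function on `G ⧸ Z`, with integral
`d⁻¹ * (u, u') * conj (v, v')`. -/
def HasFormalDimension (π : UnitaryRep G H) (μ : Measure (G ⧸ Subgroup.center G)) (d : ℝ) :
    Prop :=
  π.IsDiscreteSeries μ ∧ 0 < d ∧
    ∀ u v u' v' : H, ∃ φ : G ⧸ Subgroup.center G → ℂ,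
      (∀ g : G, φ g = π.coeff u v g * starRingEnd ℂ (π.coeff u' v' g)) ∧ Integrable φ μ ∧
      ∫ x, φ x ∂μ = 1 / (d : ℂ) * inner ℂ u' u * starRingEnd ℂ (inner ℂ v' v)

end UnitaryRep

/-! ### The maximal compact subgroup -/

/-- `K = GL(2, 𝒪)`, as a subgroup of `GL(2,F)`. -/
def integralGL2 (F : Type*) [Field F] [ValuativeRel F] : Subgroup (GL (Fin 2) F) :=
  (Matrix.GeneralLinearGroup.map (n := Fin 2)
    (algebraMap (valuation F).integer F)).range

/-- The image `ZK/Z` of `K = GL(2, 𝒪)` in `GL(2,F)/Z`. -/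
def integralGL2ModCenter (F : Type*) [Field F] [ValuativeRel F] :
    Subgroup (GL (Fin 2) F ⧸ Subgroup.center (GL (Fin 2) F)) :=
  (integralGL2 F).map (QuotientGroup.mk' (Subgroup.center (GL (Fin 2) F)))

/-- The order `q` of the residue field of `F`. -/
def residueCard (F : Type*) [Field F] [ValuativeRel F] : ℕ :=
  Nat.card (IsLocalRing.ResidueField (valuation F).integer)

end

/-! The space `B\G` is the projective line, with `g` represented by its bottom row `(c : d)`. Let
`w` be the class in the Steinberg representation of the indicator of the ball `|c| < |d|`. The
Iwahori subgroup `I` fixes `w`. The element `s = flip`, which normalizes `I` and is an involution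
modulo `Z`, exchanges the ball with its complement, so `s w = -w` modulo constants. The ball is the
disjoint union of `q ^ n` balls of radius smaller by a factor `q ^ n`. With `t = diag(1, ϖ)`, this
expresses `w` as a sum of `q ^ n` translates `k h w` with `k ∈ ZI`, for every `h ∈ I t^n I`
(`iwahoriVector_eq_sum_of_mem_level`), and up to sign for `h` multiplied by `s` on either side.

An `I`-invariant functional `l` therefore satisfies `|l(h w)| = q ^ (-n) |l(w)|`
(`norm_apply_smoothSteinberg`). This applies to `l = (·, w)` and gives the absolute value of the
matrix coefficient of `w` everywhere: with `T = ⋃ I t^n I`, the four sets `T`, `sT`, `Ts`, `sTs`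
cover `PGL2`, and they overlap only in `T ∩ sTs = I` and `sT ∩ Ts = sI`. Since `I t^n I` has volume
`q ^ n vol(I)`, the squared coefficient of the normalized vector has integral `4 vol(I) / (1 - 1/q)
- 2 vol(I) = 2 vol(I) (q + 1) / (q - 1)`. As `vol(K) = (q + 1) vol(I)`, this is `1` exactly when
`vol(K) = (q - 1) / 2` (`lintegral_eq_one_of_flipLevelP`).

The same sum formula replaces irreducibility in Schur orthogonality: an invariant sesquilinear form
on the span of the orbit of `w` is determined by its value at `(w, w)`
(`sesquilinear_proportional_of_invariant`, `schur_orthogonality`). Irreducibility is then a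
consequence of orthogonality. Both translations must preserve the measure; the modular character is
trivial because `PGL2` is generated by `K` and the involution `s`.

For existence, a function `f` is sent to `y ↦ ∫_I f(xy) - ∫_I f(xsy)` (`toFunctions`). This kills
constants, commutes with right translation, is square-integrable by the same decay, and is injective
modulo constants; the closure of the image in `L²(PGL2)` is a completion. -/

noncomputable section

/-! ### Schur orthogonality from a cyclic vector -/

/-- Two sesquilinear forms on a space containing a `P`-orbit `e`, invariant on the orbit, are
proportional on the span of the orbit as soon as `e 1` is a multiple of a sum of
`Stab(e 1)`-translates of any given `e h`. -/
theorem sesquilinear_proportional_of_invariant {P V : Type*} [Group P] [AddCommGroup V]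
    [Module ℂ V] (e : P → V)
    (hstar : ∀ h : P, ∃ (ι : Type) (_ : Fintype ι) (c : ℂ) (k : ι → P),
      (∀ i, e (k i)⁻¹ = e 1) ∧ e 1 = c • ∑ i, e (k i * h))
    (B₁ B₂ : V →ₗ⋆[ℂ] V →ₗ[ℂ] ℂ)
    (h₁ : ∀ x g h, B₁ (e (x * g)) (e (x * h)) = B₁ (e g) (e h))
    (h₂ : ∀ x g h, B₂ (e (x * g)) (e (x * h)) = B₂ (e g) (e h))
    {x y : V} (hx : x ∈ Submodule.span ℂ (Set.range e)) (hy : y ∈ Submodule.span ℂ (Set.range e)) :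
    B₁ x y * B₂ (e 1) (e 1) = B₂ x y * B₁ (e 1) (e 1) := by
  -- Invariance under the stabilizer of `e 1` makes all terms of the sum equal, so `B (e 1) (e 1) =
  -- c N B (e 1) (e h)`, with `c N` the same for both forms. Every pair of orbit vectors is a
  -- translate of a pair `(e 1, e h)`.
  have key : ∀ h, B₁ (e 1) (e h) * B₂ (e 1) (e 1) = B₂ (e 1) (e h) * B₁ (e 1) (e 1) := by
    intro h
    obtain ⟨ι, _, c, k, hk, hs⟩ := hstar h
    have aux : ∀ B : V →ₗ⋆[ℂ] V →ₗ[ℂ] ℂ,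
        (∀ x g h, B (e (x * g)) (e (x * h)) = B (e g) (e h)) →
        B (e 1) (e 1) = c * Fintype.card ι * B (e 1) (e h) := by
      intro B hB
      have : ∀ i, B (e 1) (e (k i * h)) = B (e 1) (e h) := by
        intro i
        have := hB (k i)⁻¹ 1 (k i * h)
        rw [mul_one, hk, inv_mul_cancel_left] at this
        exact this.symm
      nth_rewrite 2 [hs]
      simp [this, mul_assoc]
    rw [aux B₁ h₁, aux B₂ h₂]
    ring
  induction hx, hy using Submodule.span_induction₂ with
  | mem_mem x y hx hy =>
    obtain ⟨g, rfl⟩ := hx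
    obtain ⟨h, rfl⟩ := hy
    have e₁ := h₁ g⁻¹ g h
    have e₂ := h₂ g⁻¹ g h
    rw [inv_mul_cancel] at e₁ e₂
    rw [← e₁, ← e₂, key]
  | zero_left y hy => simp
  | zero_right x hx => simp
  | add_left x y z _ _ _ h h' => simp only [map_add, LinearMap.add_apply, add_mul, h, h']
  | add_right x y z _ _ _ h h' => simp only [map_add, add_mul, h, h']
  | smul_left r x y _ _ h => simp only [LinearMap.map_smulₛₗ, LinearMap.smul_apply, smul_eq_mul, mul_assoc, h]
  | smul_right r x y _ _ h => simp only [map_smul, smul_eq_mul, mul_assoc, h]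

section L2

variable {P : Type*} [MeasurableSpace P] {μ : Measure P}

/-- The linear map to `L²` defined by a linear map to square-integrable functions. -/
def linearMapToLp {V : Type*} [AddCommGroup V] [Module ℂ V] (C : V →ₗ[ℂ] P → ℂ)
    (hC : ∀ u, MemLp (C u) 2 μ) : V →ₗ[ℂ] Lp ℂ 2 μ where
  toFun u := (hC u).toLp
  map_add' u v := by
    rw [← MemLp.toLp_add]
    congr 1
    exact map_add C u v
  map_smul' c u := by
    rw [RingHom.id_apply, ← MemLp.toLp_const_smul]
    congr 1
    exact map_smul C c u

theorem inner_toLp {f g : P → ℂ} (hf : MemLp f 2 μ) (hg : MemLp g 2 μ) :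
    inner ℂ (hf.toLp f) (hg.toLp g) = ∫ x, g x * starRingEnd ℂ (f x) ∂μ := by
  rw [L2.inner_def]
  refine integral_congr_ae ?_
  filter_upwards [hf.coeFn_toLp, hg.coeFn_toLp] with x h1 h2
  rw [h1, h2, RCLike.inner_apply]

/-- A pointwise continuous linear family of functions whose `L²`-norms are bounded on a dense
subspace consists of `L²`-functions. -/
theorem eLpNorm_le_of_dense {H : Type*} [NormedAddCommGroup H] [Module ℂ H]
    (C : H → P → ℂ) (hcont : ∀ g, Continuous fun u => C u g)
    (hmeas : ∀ u, AEStronglyMeasurable (C u) μ) {D : Set H} (hD : Dense D) (M : ENNReal)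
    (hM : M ≠ ⊤) (hb : ∀ u ∈ D, eLpNorm (C u) 2 μ ≤ M * ‖u‖ₑ) (u : H) :
    eLpNorm (C u) 2 μ ≤ M * ‖u‖ₑ := by
  obtain ⟨w, hw, hwu⟩ := mem_closure_iff_seq_limit.1 (hD u)
  -- Fatou's lemma along a sequence in `D` converging to `u`.
  refine (Lp.eLpNorm_lim_le_liminf_eLpNorm (f := fun n => C (w n)) (fun n => hmeas _) (C u)
    (Filter.Eventually.of_forall fun g => ((hcont g).tendsto u).comp hwu)).trans ?_
  have h1 : Filter.Tendsto (fun n => M * ‖w n‖ₑ) Filter.atTop (nhds (M * ‖u‖ₑ)) :=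
    ENNReal.Tendsto.const_mul (hwu.enorm) (Or.inr hM)
  rw [← h1.liminf_eq]
  exact Filter.liminf_le_liminf (Filter.Eventually.of_forall fun n => hb _ (hw n))

theorem memLp_of_eLpNorm_le {H : Type*} [NormedAddCommGroup H] {C : H → P → ℂ} (hmeas : ∀ u, AEStronglyMeasurable (C u) μ)
    (h : ∃ M : ENNReal, M ≠ ⊤ ∧ ∀ u, eLpNorm (C u) 2 μ ≤ M * ‖u‖ₑ) (u : H) :
    MemLp (C u) 2 μ := by
  obtain ⟨M, hM, h⟩ := h
  exact ⟨hmeas u, (h u).trans_lt (ENNReal.mul_lt_top hM.lt_top (by simp))⟩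

theorem continuous_linearMapToLp {H : Type*} [NormedAddCommGroup H] [NormedSpace ℂ H]
    {C : H →ₗ[ℂ] P → ℂ} (hC : ∀ u, MemLp (C u) 2 μ)
    (h : ∃ M : ENNReal, M ≠ ⊤ ∧ ∀ u, eLpNorm (C u) 2 μ ≤ M * ‖u‖ₑ) :
    Continuous (linearMapToLp C hC) := by
  obtain ⟨M, hM, h⟩ := h
  refine AddMonoidHomClass.continuous_of_bound _ M.toReal fun u => ?_
  change ‖(hC u).toLp‖ ≤ _
  rw [Lp.norm_toLp, ← toReal_enorm, ← ENNReal.toReal_mul]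
  exact ENNReal.toReal_mono (ENNReal.mul_ne_top hM (by simp)) (h u)

theorem MeasurePreserving.integral_comp_of_aesm {τ : P → P} (hτ : MeasurePreserving τ μ μ) {f : P → ℂ}
    (hf : AEStronglyMeasurable f μ) : ∫ x, f (τ x) ∂μ = ∫ x, f x ∂μ := by
  rw [← integral_map hτ.aemeasurable (hτ.map_eq.symm ▸ hf), hτ.map_eq]

/-- The pullback of the inner product along two linear maps. -/
def innerPullback {V W : Type*} [AddCommGroup V] [Module ℂ V] [NormedAddCommGroup W]
    [InnerProductSpace ℂ W] (A A' : V →ₗ[ℂ] W) : V →ₗ⋆[ℂ] V →ₗ[ℂ] ℂ :=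
  LinearMap.mk₂'ₛₗ _ _ (fun x y => inner ℂ (A x) (A' y))
    (fun _ _ _ => by rw [map_add, inner_add_left])
    (fun _ _ _ => by rw [map_smul, inner_smul_left, smul_eq_mul])
    (fun _ _ _ => by rw [map_add, inner_add_right])
    (fun _ _ _ => by rw [map_smul, inner_smul_right, smul_eq_mul, RingHom.id_apply])

theorem innerPullback_apply {V W : Type*} [AddCommGroup V] [Module ℂ V] [NormedAddCommGroup W]
    [InnerProductSpace ℂ W] (A A' : V →ₗ[ℂ] W) (x y : V) :
    innerPullback A A' x y = inner ℂ (A x) (A' y) := rfl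

variable {H : Type*} [NormedAddCommGroup H] [InnerProductSpace ℂ H] [Group P]

/-- On the span of the orbit, the pullback of the `L²` inner product is an invariant form, hence a
multiple of the inner product of `H`. So `C` is a scalar multiple of an isometry there, and the
bound passes to the closure. -/
theorem exists_eLpNorm_le_of_cyclic (e : P → H) (he : Dense (Submodule.span ℂ (Set.range e) : Set H))
    (he1 : e 1 ≠ 0) (hiso : ∀ x g h, inner ℂ (e (x * g)) (e (x * h)) = inner ℂ (e g) (e h))
    (hstar : ∀ h : P, ∃ (ι : Type) (_ : Fintype ι) (c : ℂ) (k : ι → P),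
      (∀ i, e (k i)⁻¹ = e 1) ∧ e 1 = c • ∑ i, e (k i * h))
    (τ : P → P → P) (hτ : ∀ h, MeasurePreserving (τ h) μ μ)
    (C : H →ₗ[ℂ] P → ℂ) (hcont : ∀ g, Continuous fun u => C u g)
    (hmeas : ∀ u, AEStronglyMeasurable (C u) μ)
    (hequi : ∀ x h g, C (e (x * h)) g = C (e h) (τ x g))
    (hL : MemLp (C (e 1)) 2 μ) :
    ∃ M : ENNReal, M ≠ ⊤ ∧ ∀ u, eLpNorm (C u) 2 μ ≤ M * ‖u‖ₑ := by
  let W : Submodule ℂ H :=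
    { carrier := {u | MemLp (C u) 2 μ}
      zero_mem' := by
        change MemLp (C 0) 2 μ
        rw [map_zero]
        exact MemLp.zero
      add_mem' := fun {a b} ha hb => by
        change MemLp (C (a + b)) 2 μ
        rw [map_add]
        exact ha.add hb
      smul_mem' := fun c a ha => by
        change MemLp (C (c • a)) 2 μ
        rw [map_smul]
        exact MemLp.const_smul ha c }
  have heW : ∀ h, e h ∈ W := by
    intro h
    have : C (e h) = C (e 1) ∘ τ h := by
      ext g
      rw [← mul_one h, hequi, mul_one]
      rfl
    change MemLp (C (e h)) 2 μ
    rw [this]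
    exact hL.comp_measurePreserving (hτ h)
  have hDW : Submodule.span ℂ (Set.range e) ≤ W :=
    Submodule.span_le.2 (by rintro _ ⟨h, rfl⟩; exact heW h)
  -- An arbitrary algebraic extension, used only so that the forms are defined on all of `H`; its
  -- values outside `W` play no role.
  obtain ⟨A, hA⟩ := LinearMap.exists_extend
    (linearMapToLp (C ∘ₗ W.subtype) (fun u : W => u.2) : W →ₗ[ℂ] Lp ℂ 2 μ)
  have hA' : ∀ u (hu : u ∈ W), A u = MemLp.toLp (C u) hu := fun u hu =>
    LinearMap.congr_fun hA ⟨u, hu⟩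
  have hsesq := fun {x y : H} => sesquilinear_proportional_of_invariant e hstar
    (innerPullback A A) (innerₛₗ ℂ) (by
      intro x g h
      simp only [innerPullback_apply]
      rw [hA' _ (heW _), hA' _ (heW _), hA' _ (heW _), hA' _ (heW _), inner_toLp, inner_toLp]
      simp only [hequi]
      exact MeasurePreserving.integral_comp_of_aesm (hτ x)
        ((hmeas (e h)).mul (Complex.continuous_conj.comp_aestronglyMeasurable (hmeas (e g)))))
    (by
      intro x g h
      exact hiso x g h) (x := x) (y := y)
  have hbd : ∀ u ∈ Submodule.span ℂ (Set.range e),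
      ‖A u‖ = ‖A (e 1)‖ / ‖e 1‖ * ‖u‖ := by
    intro u hu
    have := hsesq hu hu
    simp only [innerPullback_apply, innerₛₗ_apply_apply, inner_self_eq_norm_sq_to_K] at this
    have h2 : (‖A u‖ * ‖e 1‖) ^ 2 = (‖u‖ * ‖A (e 1)‖) ^ 2 := by
      rw [mul_pow, mul_pow]
      exact_mod_cast this
    have h3 := (pow_left_inj₀ (by positivity) (by positivity) two_ne_zero).1 h2
    have : ‖e 1‖ ≠ 0 := norm_ne_zero_iff.2 he1
    field_simp
    linarith
  refine ⟨_, ENNReal.ofReal_ne_top, eLpNorm_le_of_dense (fun u => C u) hcont hmeas he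
    (ENNReal.ofReal (‖A (e 1)‖ / ‖e 1‖)) ENNReal.ofReal_ne_top ?_⟩
  intro u hu
  have h := hbd u hu
  have h2 : eLpNorm (C u) 2 μ = ‖A u‖ₑ := by
    rw [hA' u (hDW hu), Lp.enorm_toLp]
  rw [h2, ← ofReal_norm, h, ENNReal.ofReal_mul (by positivity), ofReal_norm]

/-- The form `(u', u) ↦ ∫ C u * conj (C' u')` is proportional to the inner product on the span of
the orbit; `L²`-continuity of `C` and `C'` extends this to `H`, one variable at a time. -/
theorem integral_mul_conj_of_cyclic (e : P → H)
    (he : Dense (Submodule.span ℂ (Set.range e) : Set H))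
    (he1 : e 1 ≠ 0) (hiso : ∀ x g h, inner ℂ (e (x * g)) (e (x * h)) = inner ℂ (e g) (e h))
    (hstar : ∀ h : P, ∃ (ι : Type) (_ : Fintype ι) (c : ℂ) (k : ι → P),
      (∀ i, e (k i)⁻¹ = e 1) ∧ e 1 = c • ∑ i, e (k i * h))
    (τ : P → P → P) (hτ : ∀ h, MeasurePreserving (τ h) μ μ)
    (C C' : H →ₗ[ℂ] P → ℂ) (hcont : ∀ g, Continuous fun u => C u g)
    (hcont' : ∀ g, Continuous fun u => C' u g)
    (hmeas : ∀ u, AEStronglyMeasurable (C u) μ) (hmeas' : ∀ u, AEStronglyMeasurable (C' u) μ)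
    (hequi : ∀ x h g, C (e (x * h)) g = C (e h) (τ x g))
    (hequi' : ∀ x h g, C' (e (x * h)) g = C' (e h) (τ x g))
    (hL : MemLp (C (e 1)) 2 μ) (hL' : MemLp (C' (e 1)) 2 μ) (u u' : H) :
    (∫ g, C u g * starRingEnd ℂ (C' u' g) ∂μ) * inner ℂ (e 1) (e 1) =
      inner ℂ u' u * ∫ g, C (e 1) g * starRingEnd ℂ (C' (e 1) g) ∂μ := by
  have hB := exists_eLpNorm_le_of_cyclic e he he1 hiso hstar τ hτ C hcont hmeas hequi hL
  have hB' := exists_eLpNorm_le_of_cyclic e he he1 hiso hstar τ hτ C' hcont' hmeas' hequi' hL'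
  have hM := memLp_of_eLpNorm_le hmeas hB
  have hM' := memLp_of_eLpNorm_le hmeas' hB'
  have hc := continuous_linearMapToLp hM hB
  have hc' := continuous_linearMapToLp hM' hB'
  have hsesq := fun {x y : H} => sesquilinear_proportional_of_invariant e hstar
    (innerPullback (linearMapToLp C' hM') (linearMapToLp C hM)) (innerₛₗ ℂ) (by
      intro x g h
      simp only [innerPullback_apply]
      simp only [linearMapToLp, LinearMap.coe_mk, AddHom.coe_mk]
      rw [inner_toLp, inner_toLp]
      simp only [hequi, hequi']
      exact MeasurePreserving.integral_comp_of_aesm (hτ x)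
        ((hmeas (e h)).mul (Complex.continuous_conj.comp_aestronglyMeasurable (hmeas' (e g)))))
    (by
      intro x g h
      exact hiso x g h) (x := x) (y := y)
  have hval : ∀ u u', inner ℂ (linearMapToLp C' hM' u') (linearMapToLp C hM u) =
      ∫ g, C u g * starRingEnd ℂ (C' u' g) ∂μ := fun u u' =>
    inner_toLp (hM' u') (hM u)
  rw [← hval, ← hval]
  have step : ∀ y ∈ Submodule.span ℂ (Set.range e), ∀ x, inner ℂ (linearMapToLp C' hM' x)
      (linearMapToLp C hM y) * inner ℂ (e 1) (e 1) = inner ℂ x y *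
        inner ℂ (linearMapToLp C' hM' (e 1)) (linearMapToLp C hM (e 1)) := by
    intro y hy
    refine congrFun (Continuous.ext_on he ?_ ?_ fun x hx => hsesq hx hy)
    · exact (hc'.inner continuous_const).mul continuous_const
    · exact (continuous_id.inner continuous_const).mul continuous_const
  refine congrFun (Continuous.ext_on he (f := fun u => inner ℂ (linearMapToLp C' hM' u')
      (linearMapToLp C hM u) * inner ℂ (e 1) (e 1)) ?_ ?_ fun y hy => step y hy u') u
  · exact (continuous_const.inner hc).mul continuous_const
  · exact (continuous_const.inner continuous_id).mul continuous_const

end L2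

section Schur

variable {P : Type*} [Group P] [TopologicalSpace P] [IsTopologicalGroup P] [MeasurableSpace P]
  [BorelSpace P] {μ : Measure P} [μ.IsMulLeftInvariant] [μ.IsMulRightInvariant]
  {H : Type*} [NormedAddCommGroup H] [InnerProductSpace ℂ H]

/-- Matrix coefficients `inner v (ρ g u)`, as a linear function of `u`. -/
def coeffLinear (ρ : P →* (H →L[ℂ] H)) (v : H) : H →ₗ[ℂ] P → ℂ where
  toFun u g := inner ℂ v (ρ g u)
  map_add' x y := by ext g; simp
  map_smul' c x := by ext g; simp

/-- Conjugate matrix coefficients `inner (ρ g u) v`, as a linear function of `v`. -/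
def conjCoeffLinear (ρ : P →* (H →L[ℂ] H)) (u : H) : H →ₗ[ℂ] P → ℂ where
  toFun v g := inner ℂ (ρ g u) v
  map_add' x y := by ext g; simp
  map_smul' c x := by ext g; simp

/-- Schur orthogonality for a unitary representation of a unimodular group with a cyclic vector
`w` satisfying an averaging property and having a square-integrable matrix coefficient. -/
theorem schur_orthogonality (ρ : P →* (H →L[ℂ] H))
    (hiso : ∀ g x y, inner ℂ (ρ g x) (ρ g y) = inner ℂ x y)
    (hcont : ∀ u, Continuous fun g => ρ g u) {w : H} (hw : w ≠ 0)
    (hcyc : Dense (Submodule.span ℂ (Set.range fun h => ρ h w) : Set H))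
    (hstar : ∀ h : P, ∃ (ι : Type) (_ : Fintype ι) (c : ℂ) (k : ι → P),
      (∀ i, ρ (k i)⁻¹ w = w) ∧ w = c • ∑ i, ρ (k i * h) w)
    (hL : MemLp (fun g => inner ℂ w (ρ g w)) 2 μ) (u v u' v' : H) :
    MemLp (fun g => inner ℂ v (ρ g u)) 2 μ ∧
    (∫ g, inner ℂ v (ρ g u) * starRingEnd ℂ (inner ℂ v' (ρ g u')) ∂μ) *
        (inner ℂ w w * inner ℂ w w) =
      inner ℂ u' u * starRingEnd ℂ (inner ℂ v' v) *
        ∫ g, inner ℂ w (ρ g w) * starRingEnd ℂ (inner ℂ w (ρ g w)) ∂μ := by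
  have he1 : ρ 1 w = w := by rw [map_one]; rfl
  have hisoe : ∀ x g h, inner ℂ (ρ (x * g) w) (ρ (x * h) w) = inner ℂ (ρ g w) (ρ h w) := by
    intro x g h
    rw [map_mul, map_mul]
    exact hiso _ _ _
  have hinv : ∀ x g (a b : H), inner ℂ (ρ g a) (ρ x b) = inner ℂ (ρ (x⁻¹ * g) a) b := by
    intro x g a b
    rw [← hiso x⁻¹ (ρ g a) (ρ x b), ← mul_apply_eq_comp, ← map_mul,
      ← mul_apply_eq_comp, ← map_mul, inv_mul_cancel, map_one]
    rfl
  have hstar' : ∀ h : P, ∃ (ι : Type) (_ : Fintype ι) (c : ℂ) (k : ι → P),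
      (∀ i, ρ (k i)⁻¹ w = ρ 1 w) ∧ ρ 1 w = c • ∑ i, ρ (k i * h) w := by
    rw [he1]; exact hstar
  have hne : ρ 1 w ≠ 0 := by rwa [he1]
  have cC : ∀ v g, Continuous fun u => coeffLinear ρ v u g := fun v g =>
    continuous_const.inner (ρ g).continuous
  have cC' : ∀ u g, Continuous fun v => conjCoeffLinear ρ u v g := fun v g =>
    continuous_const.inner continuous_id
  have mC : ∀ v u, AEStronglyMeasurable (coeffLinear ρ v u) μ := fun v u =>
    (continuous_const.inner (hcont u)).aestronglyMeasurable
  have mC' : ∀ u v, AEStronglyMeasurable (conjCoeffLinear ρ u v) μ := fun u v =>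
    ((hcont u).inner continuous_const).aestronglyMeasurable
  have eC : ∀ v x h g, coeffLinear ρ v (ρ (x * h) w) g = coeffLinear ρ v (ρ h w) (g * x) := by
    intro v x h g
    simp [coeffLinear, map_mul]
  have eC' : ∀ u x h g,
      conjCoeffLinear ρ u (ρ (x * h) w) g = conjCoeffLinear ρ u (ρ h w) (x⁻¹ * g) := by
    intro u x h g
    simp only [conjCoeffLinear, LinearMap.coe_mk, AddHom.coe_mk]
    rw [← hinv, map_mul, mul_apply_eq_comp]
  have hL1 : MemLp (coeffLinear ρ w (ρ 1 w)) 2 μ := by rw [he1]; exact hL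
  -- The vector `u` varies while the second argument stays `w`; moving `u` along its orbit
  -- translates the coefficient on the right.
  have s1 := fun u => memLp_of_eLpNorm_le (mC w) (exists_eLpNorm_le_of_cyclic (fun h => ρ h w) hcyc
    hne hisoe hstar' (fun x g => g * x) (fun x => measurePreserving_mul_right μ x)
    (coeffLinear ρ w) (cC w) (mC w) (eC w) hL1) u
  have i1 := integral_mul_conj_of_cyclic (fun h => ρ h w) hcyc
    hne hisoe hstar' (fun x g => g * x) (fun x => measurePreserving_mul_right μ x)
    (coeffLinear ρ w) (coeffLinear ρ w) (cC w) (cC w) (mC w) (mC w) (eC w) (eC w) hL1 hL1 u u'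
  have hconj : ∀ u v, conjCoeffLinear ρ u v = star (coeffLinear ρ v u) := by
    intro u v
    ext g
    exact (inner_conj_symm _ _).symm
  have hL2 : ∀ u, MemLp (conjCoeffLinear ρ u (ρ 1 w)) 2 μ := by
    intro u
    rw [he1, hconj]
    exact (s1 u).star
  -- Now the second argument varies with `u` fixed: conjugating makes the coefficient linear in `v`,
  -- and moving `v` translates on the left. The starting vector is square-integrable by `s1`.
  have s2 := fun v => memLp_of_eLpNorm_le (mC' u) (exists_eLpNorm_le_of_cyclic (fun h => ρ h w) hcyc
    hne hisoe hstar' (fun x g => x⁻¹ * g) (fun x => measurePreserving_mul_left μ x⁻¹)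
    (conjCoeffLinear ρ u) (cC' u) (mC' u) (eC' u) (hL2 u)) v
  have i2 := integral_mul_conj_of_cyclic (fun h => ρ h w) hcyc
    hne hisoe hstar' (fun x g => x⁻¹ * g) (fun x => measurePreserving_mul_left μ x⁻¹)
    (conjCoeffLinear ρ u') (conjCoeffLinear ρ u) (cC' u') (cC' u) (mC' u') (mC' u) (eC' u')
    (eC' u) (hL2 u') (hL2 u) v' v
  refine ⟨?_, ?_⟩
  · have := (s2 v).star
    rwa [hconj, star_star] at this
  · simp only [he1, hconj, Pi.star_apply, Complex.star_def, Complex.conj_conj] at i1 i2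
    rw [← mul_assoc]
    simp only [coeffLinear, LinearMap.coe_mk, AddHom.coe_mk] at i1 i2
    have : ∀ a b c d : H, (∫ g, inner ℂ a (ρ g b) * starRingEnd ℂ (inner ℂ c (ρ g d)) ∂μ) =
      ∫ g, starRingEnd ℂ (inner ℂ c (ρ g d)) * inner ℂ a (ρ g b) ∂μ := by
        intro a b c d
        simp_rw [mul_comm]
    rw [this, i2, mul_assoc, ← this, i1, inner_conj_symm]
    ring

end Schur

/-! ### Uniformizers and representatives modulo powers of the prime ideal -/

/-- A uniformizer `ϖ` of `F`, with representatives `rep n` of `𝔭 / 𝔭 ^ (n + 1)`. -/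
structure UniformizerSystem (F : Type*) [Field F] [ValuativeRel F] where
  ϖ : F
  ne_zero : ϖ ≠ 0
  lt_one : valuation F ϖ < 1
  le_of_lt_one : ∀ x, valuation F x < 1 → valuation F x ≤ valuation F ϖ
  exists_pow : ∀ x, x ≠ 0 → valuation F x ≤ 1 → ∃ n : ℕ, valuation F x = valuation F ϖ ^ n
  rep : (n : ℕ) → Fin (residueCard F ^ n) → F
  rep_lt : ∀ n i, valuation F (rep n i) < 1
  existsUnique_rep : ∀ n a, valuation F a < 1 →
    ∃! i, valuation F (a - rep n i) < valuation F ϖ ^ n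

theorem one_lt_residueCard (F : Type*) [Field F] [ValuativeRel F] [TopologicalSpace F]
    [IsNonarchimedeanLocalField F] : 1 < residueCard F := by
  have : Finite (IsLocalRing.ResidueField (valuation F).integer) := inferInstance
  exact Finite.one_lt_card

theorem card_quotient_span_pow (F : Type*) [Field F] [ValuativeRel F] [TopologicalSpace F]
    [IsNonarchimedeanLocalField F] {p : (valuation F).integer} (hp : Irreducible p) (n : ℕ) :
    Nat.card ((valuation F).integer ⧸ Ideal.span {p ^ n}) = residueCard F ^ n := by
  have hm : IsLocalRing.maximalIdeal (valuation F).integer = Ideal.span {p} :=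
    hp.maximalIdeal_eq
  have : (Ideal.span {p}).IsPrime := hm ▸ inferInstance
  rw [← Ideal.span_singleton_pow]
  have := cardQuot_pow_of_prime (P := Ideal.span {p}) (i := n) (by simpa using hp.ne_zero)
  rw [Submodule.cardQuot_apply, Submodule.cardQuot_apply] at this
  rw [this, ← hm]
  rfl

theorem nonempty_uniformizerSystem (F : Type*) [Field F] [ValuativeRel F] [TopologicalSpace F]
    [IsNonarchimedeanLocalField F] : Nonempty (UniformizerSystem F) := by
  obtain ⟨p, hp⟩ := IsDiscreteValuationRing.exists_irreducible (valuation F).integer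
  have hint : (valuation F).Integers (valuation F).integer := Valuation.integer.integers _
  have hp0 : (p : F) ≠ 0 := fun h => hp.ne_zero (Subtype.ext h)
  have hp1 : valuation F p < 1 := by
    refine lt_of_le_of_ne p.2 fun h => hp.not_isUnit ?_
    exact hint.isUnit_iff_valuation_eq_one.2 h
  have hpv : 0 < valuation F p := by simpa [zero_lt_iff] using hp0
  have hdvd : ∀ x y : (valuation F).integer, x ∣ y ↔ valuation F y ≤ valuation F x := fun x y =>
    hint.dvd_iff_le
  have hlt : ∀ x : F, valuation F x < 1 → valuation F x ≤ valuation F p := by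
    intro x hx
    rw [← hdvd p ⟨x, hx.le⟩, ← Ideal.mem_span_singleton, ← hp.maximalIdeal_eq,
      IsLocalRing.mem_maximalIdeal, mem_nonunits_iff, hint.isUnit_iff_valuation_eq_one]
    exact hx.ne
  have hfin : ∀ n, Nonempty (Fin (residueCard F ^ n) ≃ ((valuation F).integer ⧸
      Ideal.span {p ^ n})) := by
    intro n
    have hc := card_quotient_span_pow F hp n
    have : Finite ((valuation F).integer ⧸ Ideal.span {p ^ n}) :=
      Nat.finite_of_card_ne_zero (by rw [hc]; exact pow_ne_zero _ (one_lt_residueCard F).ne_bot)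
    exact ⟨(Finite.equivFinOfCardEq hc).symm⟩
  have eq := fun n => (hfin n).some
  -- Lifts of `𝒪 / 𝔭 ^ n` multiplied by `p` represent `𝔭 / 𝔭 ^ (n + 1)`. By discreteness, the strict
  -- inequality `|x| < |p| ^ n` means `x ∈ 𝔭 ^ (n + 1)`.
  refine ⟨⟨p, hp0, hp1, hlt, ?_, fun n i => p * ((eq n i).out : (valuation F).integer), ?_, ?_⟩⟩
  · intro x hx hx1
    obtain ⟨n, u, hu⟩ := IsDiscreteValuationRing.eq_unit_mul_pow_irreducible
      (x := (⟨x, hx1⟩ : (valuation F).integer)) (fun h => hx (congrArg Subtype.val h)) hp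
    refine ⟨n, ?_⟩
    have h1 : x = (u : (valuation F).integer) * (p : F) ^ n := congrArg Subtype.val hu
    have hu1 : valuation F ((u : (valuation F).integer) : F) = 1 :=
      hint.isUnit_iff_valuation_eq_one.1 u.isUnit
    rw [h1, map_mul, map_pow, hu1, one_mul]
  · intro n i
    rw [map_mul]
    have h1 : valuation F (((eq n i).out : (valuation F).integer) : F) ≤ 1 := ((eq n i).out).2
    exact (mul_le_of_le_one_right' h1).trans_lt hp1
  · intro n a ha
    have key : ∀ (y : (valuation F).integer) , valuation F (p * y : F) < valuation F p ^ n ↔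
        p ^ n ∣ y := by
      intro y
      rw [hdvd, map_mul]
      have : ((p ^ n : (valuation F).integer) : F) = (p : F) ^ n := rfl
      rw [this, map_pow]
      constructor
      · intro h
        have h2 : valuation F (p * y / p ^ n : F) < 1 := by
          rw [map_div₀, map_mul, map_pow]
          exact (div_lt_one₀ (pow_pos hpv n)).2 h
        have h3 := hlt _ h2
        rw [map_div₀, map_mul, map_pow, div_le_iff₀ (pow_pos hpv n)] at h3
        exact (mul_le_mul_iff_right₀ hpv).1 h3
      · intro h
        calc valuation F p * valuation F y ≤ valuation F p * valuation F p ^ n := by gcongr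
          _ < 1 * valuation F p ^ n := by
            exact mul_lt_mul_of_pos_right hp1 (pow_pos hpv n)
          _ = _ := one_mul _
    have ha' : valuation F (a / p) ≤ 1 := by
      rw [map_div₀]
      exact div_le_one_of_le₀ (hlt a ha) zero_le
    let y : (valuation F).integer := ⟨a / p, ha'⟩
    have hay : ∀ z : (valuation F).integer, a - p * z = p * ((y - z : (valuation F).integer) : F) := by
      intro z
      change _ = (p : F) * (a / p - z)
      field_simp
    refine ⟨(eq n).symm (Ideal.Quotient.mk _ y), ?_, ?_⟩
    · beta_reduce
      rw [hay, key, Equiv.apply_symm_apply, ← Ideal.mem_span_singleton, ← Ideal.Quotient.eq]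
      exact (Quotient.out_eq' _).symm
    · intro j hj
      rw [hay, key, ← Ideal.mem_span_singleton, ← Ideal.Quotient.eq] at hj
      rw [Equiv.eq_symm_apply, hj]
      exact (Quotient.out_eq' _).symm

/-! ### Explicit 2 × 2 matrices -/

section GL2

variable {F : Type*} [Field F]

theorem gl2_mul_apply (g h : GL (Fin 2) F) (i j : Fin 2) :
    (g * h) i j = g i 0 * h 0 j + g i 1 * h 1 j := by
  simp [Matrix.mul_apply, Fin.sum_univ_two]

/-- The invertible matrix with given entries. -/
def gl2 (a b c d : F) (h : a * d - b * c ≠ 0) : GL (Fin 2) F :=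
  Matrix.GeneralLinearGroup.mkOfDetNeZero !![a, b; c, d] (by simpa [Matrix.det_fin_two] using h)

section
variable (a b c d : F) (h : a * d - b * c ≠ 0)
@[simp] theorem gl2_00 : gl2 a b c d h 0 0 = a := rfl
@[simp] theorem gl2_01 : gl2 a b c d h 0 1 = b := rfl
@[simp] theorem gl2_10 : gl2 a b c d h 1 0 = c := rfl
@[simp] theorem gl2_11 : gl2 a b c d h 1 1 = d := rfl
end

theorem gl2_ext {g h : GL (Fin 2) F} (h00 : g 0 0 = h 0 0) (h01 : g 0 1 = h 0 1)
    (h10 : g 1 0 = h 1 0) (h11 : g 1 1 = h 1 1) : g = h := by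
  ext i j
  fin_cases i <;> fin_cases j <;> assumption

/-- The determinant of `g`, in terms of entries. -/
def gl2det (g : GL (Fin 2) F) : F := g 0 0 * g 1 1 - g 0 1 * g 1 0

theorem gl2det_ne_zero (g : GL (Fin 2) F) : gl2det g ≠ 0 := by
  have := (Matrix.GeneralLinearGroup.det g).ne_zero
  simpa [Matrix.det_fin_two, gl2det] using this

theorem gl2det_mul (g h : GL (Fin 2) F) : gl2det (g * h) = gl2det g * gl2det h := by
  simp only [gl2det, gl2_mul_apply]
  ring

theorem gl2_inv (g : GL (Fin 2) F) :
    g⁻¹ = gl2 (g 1 1 / gl2det g) (-g 0 1 / gl2det g) (-g 1 0 / gl2det g) (g 0 0 / gl2det g)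
      (by
        have := gl2det_ne_zero g
        have h2 : g 1 1 / gl2det g * (g 0 0 / gl2det g) - -g 0 1 / gl2det g * (-g 1 0 / gl2det g)
          = (gl2det g)⁻¹ := by
          field_simp
          simp only [gl2det]; ring
        rw [h2]
        exact inv_ne_zero this) := by
  have := gl2det_ne_zero g
  rw [inv_eq_iff_mul_eq_one]
  apply gl2_ext <;> simp only [gl2_mul_apply, gl2_00, gl2_01, gl2_10, gl2_11] <;> field_simp <;>
    simp [gl2det] <;> ring

/-- Lower unipotent matrices. -/
def lowerUni (b : F) : GL (Fin 2) F := gl2 1 0 b 1 (by simp)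

/-- Upper unipotent matrices. -/
def upperUni (b : F) : GL (Fin 2) F := gl2 1 b 0 1 (by simp)

/-- The antidiagonal permutation matrix. -/
def weylElt : GL (Fin 2) F := gl2 0 1 1 0 (by simp)

/-- The scalar matrix. -/
def scalarGL2 (a : F) (h : a ≠ 0) : GL (Fin 2) F := gl2 a 0 0 a (by simpa using h)

theorem scalarGL2_mem_center (a : F) (h : a ≠ 0) :
    scalarGL2 a h ∈ Subgroup.center (GL (Fin 2) F) := by
  rw [Subgroup.mem_center_iff]
  intro g
  apply gl2_ext <;> simp [gl2_mul_apply, scalarGL2, mul_comm]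

theorem exists_eq_scalar_of_mem_center {z : GL (Fin 2) F}
    (hz : z ∈ Subgroup.center (GL (Fin 2) F)) : ∃ a h, z = scalarGL2 a h := by
  rw [Subgroup.mem_center_iff] at hz
  have h1 := hz (lowerUni 1)
  have h2 := hz (upperUni 1)
  have e1 := congrArg (fun g : GL (Fin 2) F => g 1 0) h1
  have e2 := congrArg (fun g : GL (Fin 2) F => g 0 0) h1
  have e3 := congrArg (fun g : GL (Fin 2) F => g 0 0) h2
  simp [gl2_mul_apply, lowerUni, upperUni] at e1 e2 e3
  have h0 : z 0 0 ≠ 0 := by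
    intro h
    have := gl2det_ne_zero z
    simp [gl2det, e2, h] at this
  exact ⟨z 0 0, h0, gl2_ext rfl (by simp [scalarGL2, e2]) (by simp [scalarGL2, e3])
    (by simp [scalarGL2]; linear_combination -e1)⟩

theorem lowerUni_mul (a b : F) : lowerUni a * lowerUni b = lowerUni (a + b) := by
  apply gl2_ext <;> simp [lowerUni, gl2_mul_apply]

theorem center_le_upperTriangular :
    Subgroup.center (GL (Fin 2) F) ≤ upperTriangularGL2 F := by
  intro z hz
  obtain ⟨a, h, rfl⟩ := exists_eq_scalar_of_mem_center hz
  change scalarGL2 a h 1 0 = 0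
  simp [scalarGL2]

theorem continuous_gl2_entry [TopologicalSpace F] (i j : Fin 2) : Continuous fun g : GL (Fin 2) F => g i j :=
  (Units.continuous_val (M := Matrix (Fin 2) (Fin 2) F)).matrix_elem i j

end GL2

/-! ### The Iwahori subgroup acting on a ball of the projective line -/

section Iwahori

variable {F : Type*} [Field F] [ValuativeRel F]

theorem mul_lt_mul_of_lt_of_le_of_pos {Γ : Type*} [LinearOrderedCommGroupWithZero Γ]
    {a b c d : Γ} (h : a < b) (h' : c ≤ d) (hd : 0 < d) : a * c < b * d :=
  calc a * c ≤ a * d := by gcongr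
    _ < b * d := mul_lt_mul_of_pos_right h hd

/-- The subgroup `Z * I`, where `I` is the Iwahori subgroup of matrices in `GL(2,𝒪)` that are
upper-triangular modulo `𝔭`. -/
def iwahoriMulCenter (F : Type*) [Field F] [ValuativeRel F] : Subgroup (GL (Fin 2) F) where
  carrier := {g | valuation F (g 1 0) < valuation F (g 1 1) ∧
    valuation F (g 0 1) ≤ valuation F (g 1 1) ∧ valuation F (g 0 0) = valuation F (g 1 1)}
  one_mem' := by simp
  mul_mem' := by
    rintro g h ⟨g1, g2, g3⟩ ⟨h1, h2, h3⟩
    have pg : 0 < valuation F (g 1 1) := zero_le.trans_lt g1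
    have ph : 0 < valuation F (h 1 1) := zero_le.trans_lt h1
    have a1 : valuation F ((g * h) 1 1) = valuation F (g 1 1) * valuation F (h 1 1) := by
      rw [gl2_mul_apply, Valuation.map_add_eq_of_lt_right, map_mul]
      rw [map_mul, map_mul]
      exact mul_lt_mul_of_lt_of_le_of_pos g1 h2 ph
    have a0 : valuation F ((g * h) 0 0) = valuation F (g 1 1) * valuation F (h 1 1) := by
      rw [gl2_mul_apply, Valuation.map_add_eq_of_lt_left, map_mul, g3, h3]
      rw [map_mul, map_mul, g3, h3]
      exact mul_lt_mul' g2 h1 zero_le pg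
    refine ⟨?_, ?_, ?_⟩
    · rw [a1, gl2_mul_apply]
      refine Valuation.map_add_lt _ ?_ ?_
      · rw [map_mul, h3]
        exact mul_lt_mul_of_pos_right g1 ph
      · rw [map_mul]
        exact mul_lt_mul_of_pos_left h1 pg
    · rw [a1, gl2_mul_apply]
      refine Valuation.map_add_le _ ?_ ?_
      · rw [map_mul, g3]
        gcongr
      · rw [map_mul]
        gcongr
    · rw [a0, a1]
  inv_mem' := by
    rintro g ⟨g1, g2, g3⟩
    have hd : 0 < valuation F (gl2det g) := by
      rw [zero_lt_iff]; simpa using gl2det_ne_zero g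
    rw [gl2_inv]
    simp only [Set.mem_ofPred_eq, gl2_00, gl2_01, gl2_10, gl2_11, map_div₀, Valuation.map_neg, g3]
    exact ⟨div_lt_div_of_pos_right g1 hd, div_le_div_of_nonneg_right g2 zero_le, trivial⟩

theorem mem_iwahoriMulCenter {g : GL (Fin 2) F} : g ∈ iwahoriMulCenter F ↔
    valuation F (g 1 0) < valuation F (g 1 1) ∧ valuation F (g 0 1) ≤ valuation F (g 1 1) ∧
      valuation F (g 0 0) = valuation F (g 1 1) := Iff.rfl

theorem center_le_iwahoriMulCenter :
    Subgroup.center (GL (Fin 2) F) ≤ iwahoriMulCenter F := by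
  intro z hz
  obtain ⟨a, h, rfl⟩ := exists_eq_scalar_of_mem_center hz
  simpa [mem_iwahoriMulCenter, scalarGL2, zero_lt_iff] using h

/-- The set of matrices whose bottom row `(c, d)` satisfies `|c| < |d|`. -/
def ballSet (F : Type*) [Field F] [ValuativeRel F] : Set (GL (Fin 2) F) :=
  {g | valuation F (g 1 0) < valuation F (g 1 1)}

theorem mul_mem_ballSet_iff_of_upper {b : GL (Fin 2) F} (hb : b ∈ upperTriangularGL2 F)
    (g : GL (Fin 2) F) : b * g ∈ ballSet F ↔ g ∈ ballSet F := by
  have hb' : b 1 0 = 0 := hb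
  have h0 : b 1 1 ≠ 0 := by
    intro h
    have := gl2det_ne_zero b
    simp [gl2det, hb', h] at this
  have : 0 < valuation F (b 1 1) := by simpa [zero_lt_iff] using h0
  simp only [ballSet, Set.mem_ofPred_eq, gl2_mul_apply, hb', zero_mul, zero_add, map_mul]
  exact mul_lt_mul_iff_right₀ this

theorem mul_mem_ballSet {j : GL (Fin 2) F} (hj : j ∈ iwahoriMulCenter F)
    {g : GL (Fin 2) F} (hg : g ∈ ballSet F) : g * j ∈ ballSet F := by
  obtain ⟨j1, j2, j3⟩ := hj
  simp only [ballSet, Set.mem_ofPred_eq] at hg ⊢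
  have pj : 0 < valuation F (j 1 1) := zero_le.trans_lt j1
  have pg : 0 < valuation F (g 1 1) := zero_le.trans_lt hg
  rw [gl2_mul_apply, gl2_mul_apply, Valuation.map_add_eq_of_lt_right (x := g 1 0 * j 0 1)]
  · refine Valuation.map_add_lt _ ?_ ?_
    · rw [map_mul, map_mul, j3]
      exact mul_lt_mul_of_pos_right hg pj
    · rw [map_mul, map_mul]
      exact mul_lt_mul_of_pos_left j1 pg
  · rw [map_mul, map_mul]
    exact mul_lt_mul_of_lt_of_le_of_pos hg j2 pj

theorem mul_mem_ballSet_iff {j : GL (Fin 2) F} (hj : j ∈ iwahoriMulCenter F)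
    {g : GL (Fin 2) F} : g * j ∈ ballSet F ↔ g ∈ ballSet F :=
  ⟨fun h => by simpa using mul_mem_ballSet (inv_mem hj) h, mul_mem_ballSet hj⟩

namespace UniformizerSystem

variable (S : UniformizerSystem F)

theorem pos : 0 < valuation F S.ϖ := by simpa [zero_lt_iff] using S.ne_zero

/-- The matrix `diag(1, ϖ ^ n)`. -/
def diag (n : ℕ) : GL (Fin 2) F := gl2 1 0 0 (S.ϖ ^ n) (by simpa using fun h => absurd h S.ne_zero)

/-- The antidiagonal matrix normalizing the Iwahori subgroup. -/
def flip : GL (Fin 2) F := gl2 0 1 S.ϖ 0 (by simpa using S.ne_zero)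

theorem flip_mul_flip : S.flip * S.flip = scalarGL2 S.ϖ S.ne_zero := by
  apply gl2_ext <;> simp [gl2_mul_apply, flip, scalarGL2]

/-- Discreteness of the valuation: a factor `ϖ` turns a weak inequality into a strict one. This
converts conditions on products with `flip` into conditions on the entries alone. -/
theorem le_iff {x y : F} : valuation F x ≤ valuation F (S.ϖ * y) ↔
    (y = 0 ∧ x = 0) ∨ valuation F x < valuation F y := by
  by_cases hy : y = 0
  · simp [hy]
  have py : 0 < valuation F y := by simpa [zero_lt_iff] using hy
  have := S.le_of_lt_one (x / y)
  rw [map_div₀, div_lt_one₀ py, div_le_iff₀ py, ← map_mul] at this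
  simp only [hy, false_and, false_or]
  refine ⟨fun h => h.trans_lt ?_, this⟩
  rw [map_mul]
  exact mul_lt_of_lt_one_left py S.lt_one

theorem lt_iff {x y : F} : valuation F (S.ϖ * y) < valuation F x ↔
    (x ≠ 0 ∨ y ≠ 0) ∧ valuation F y ≤ valuation F x := by
  rw [← not_iff_not, not_lt, S.le_iff]
  push Not
  by_cases hx : x = 0 <;> by_cases hy : y = 0 <;> simp [hx, hy]

/-- Right multiplication by `flip` sends the bottom row `(c, d)` to `(ϖ d, c)`, and `|ϖ d| < |c|` is
the same as `|d| ≤ |c|`. -/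
theorem mul_flip_mem_ballSet_iff {g : GL (Fin 2) F} :
    g * S.flip ∈ ballSet F ↔ g ∉ ballSet F := by
  simp only [ballSet, Set.mem_ofPred_eq, gl2_mul_apply, flip, gl2_00, gl2_01, gl2_10, gl2_11,
    mul_zero, zero_add, mul_one, add_zero, not_lt]
  rw [mul_comm, S.lt_iff, and_iff_right]
  by_contra! h
  have := gl2det_ne_zero g
  simp [gl2det, h] at this

/-- `flip` normalizes `ZI`; since its square is central, it serves as its own inverse in the
conjugation. -/
theorem flip_mul_mul_flip_mem {j : GL (Fin 2) F} (hj : j ∈ iwahoriMulCenter F) :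
    S.flip * j * S.flip ∈ iwahoriMulCenter F := by
  obtain ⟨j1, j2, j3⟩ := hj
  have p : 0 < valuation F (j 0 0) := j3 ▸ zero_le.trans_lt j1
  simp only [mem_iwahoriMulCenter, gl2_mul_apply, flip, gl2_00, gl2_01, gl2_10, gl2_11,
    mul_zero, zero_add, mul_one, add_zero, one_mul, zero_mul]
  refine ⟨?_, ?_, ?_⟩
  · rw [map_mul, map_mul, map_mul]
    calc _ ≤ valuation F S.ϖ * valuation F (j 0 0) * valuation F S.ϖ := by
          rw [j3]
          gcongr
      _ < _ := mul_lt_of_lt_one_right (mul_pos S.pos p) S.lt_one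
  · rw [S.le_iff, j3]
    exact Or.inr j1
  · rw [map_mul, map_mul, j3, mul_comm]

end UniformizerSystem
end Iwahori

/-! ### Iwahori double cosets and the subdivision of the ball -/

namespace UniformizerSystem

variable {F : Type*} [Field F] [ValuativeRel F] (S : UniformizerSystem F)

/-- Representatives of the left cosets of `Z * I` in the `n`-th level set. -/
def coset (n : ℕ) (i : Fin (residueCard F ^ n)) : GL (Fin 2) F :=
  lowerUni (S.rep n i) * S.diag n

theorem coset_eq (n : ℕ) (i : Fin (residueCard F ^ n)) :
    S.coset n i = gl2 1 0 (S.rep n i) (S.ϖ ^ n)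
      (by simpa using fun h => absurd h S.ne_zero) := by
  apply gl2_ext <;> simp [coset, gl2_mul_apply, lowerUni, diag]

theorem coset_inv (n : ℕ) (i : Fin (residueCard F ^ n)) :
    (S.coset n i)⁻¹ = gl2 1 0 (-S.rep n i / S.ϖ ^ n) (1 / S.ϖ ^ n)
      (by simpa using fun h => absurd h S.ne_zero) := by
  have := S.ne_zero
  rw [inv_eq_iff_mul_eq_one, coset_eq]
  apply gl2_ext <;> simp [gl2_mul_apply, this]
  field_simp
  ring

theorem gl2det_coset (n : ℕ) (i : Fin (residueCard F ^ n)) :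
    gl2det (S.coset n i) = S.ϖ ^ n := by
  simp [coset_eq, gl2det]

theorem mul_coset_mem_ballSet_iff {g : GL (Fin 2) F} (n : ℕ) (i : Fin (residueCard F ^ n)) :
    g * S.coset n i ∈ ballSet F ↔
      valuation F (g 1 0 + g 1 1 * S.rep n i) < valuation F (g 1 1) * valuation F S.ϖ ^ n := by
  simp [ballSet, coset, ← mul_assoc, gl2_mul_apply, lowerUni, diag]

/-- The coordinate `-c / d` identifies the ball with `𝔭`, and translation by `coset n i` cuts out
the residue class of `rep n i` modulo `𝔭 ^ (n + 1)`. -/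
theorem existsUnique_mul_coset_mem_ballSet {g : GL (Fin 2) F} (hg : g ∈ ballSet F) (n : ℕ) :
    ∃! i, g * S.coset n i ∈ ballSet F := by
  have hg' : valuation F (g 1 0) < valuation F (g 1 1) := hg
  have p : 0 < valuation F (g 1 1) := zero_le.trans_lt hg'
  have hne : g 1 1 ≠ 0 := by simpa [zero_lt_iff] using p
  have h := S.existsUnique_rep n (-(g 1 0 / g 1 1)) (by
    rw [Valuation.map_neg, map_div₀]
    exact (div_lt_one₀ p).2 hg')
  refine (existsUnique_congr fun i => ?_).2 h
  rw [mul_coset_mem_ballSet_iff, ← Valuation.map_neg,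
    show -(g 1 0 + g 1 1 * S.rep n i) = g 1 1 * (-(g 1 0 / g 1 1) - S.rep n i) by
      field_simp; ring, map_mul]
  exact mul_lt_mul_iff_right₀ p

theorem mem_ballSet_of_mul_coset {g : GL (Fin 2) F} {n : ℕ} {i : Fin (residueCard F ^ n)}
    (h : g * S.coset n i ∈ ballSet F) : g ∈ ballSet F := by
  rw [mul_coset_mem_ballSet_iff] at h
  have p : 0 < valuation F (g 1 1) := by
    by_contra! h0
    simp [le_zero_iff.1 h0] at h
  have h1 : valuation F (g 1 0 + g 1 1 * S.rep n i) < valuation F (g 1 1) :=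
    h.trans_le (mul_le_of_le_one_right' (pow_le_one₀ zero_le S.lt_one.le))
  have h2 : valuation F (g 1 1 * S.rep n i) < valuation F (g 1 1) := by
    rw [map_mul]
    exact mul_lt_of_lt_one_right p (S.rep_lt n i)
  have : g 1 0 = (g 1 0 + g 1 1 * S.rep n i) - g 1 1 * S.rep n i := by ring
  change valuation F (g 1 0) < _
  rw [this]
  exact Valuation.map_sub_lt _ h1 h2

/-- The set of matrices in `I t^n I Z`, where `t = diag(1, ϖ)`. -/
def level (n : ℕ) : Set (GL (Fin 2) F) :=
  {g | valuation F (g 0 1) ≤ valuation F (g 0 0) ∧ valuation F (g 1 0) < valuation F (g 0 0) ∧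
    valuation F (g 1 1) ≤ valuation F (g 0 0) ∧
    valuation F (gl2det g) = valuation F S.ϖ ^ n * valuation F (g 0 0) ^ 2}

theorem coset_mul_mem_level {j : GL (Fin 2) F} (hj : j ∈ iwahoriMulCenter F) (n : ℕ)
    (i : Fin (residueCard F ^ n)) : S.coset n i * j ∈ S.level n := by
  obtain ⟨j1, j2, j3⟩ := hj
  have hb := S.rep_lt n i
  have p : 0 < valuation F (j 1 1) := zero_le.trans_lt j1
  have hp : valuation F S.ϖ ^ n ≤ 1 := pow_le_one₀ zero_le S.lt_one.le
  have hd : valuation F (gl2det j) = valuation F (j 1 1) ^ 2 := by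
    rw [gl2det, sub_eq_add_neg, Valuation.map_add_eq_of_lt_left]
    · rw [map_mul, j3, sq]
    · rw [Valuation.map_neg, map_mul, map_mul, j3]
      exact mul_lt_mul' j2 j1 zero_le p
  have e10 : (S.coset n i * j) 1 0 = S.rep n i * j 0 0 + S.ϖ ^ n * j 1 0 := by
    simp [coset_eq, gl2_mul_apply]
  have e11 : (S.coset n i * j) 1 1 = S.rep n i * j 0 1 + S.ϖ ^ n * j 1 1 := by
    simp [coset_eq, gl2_mul_apply]
  have e00 : (S.coset n i * j) 0 0 = j 0 0 := by
    simp [coset_eq, gl2_mul_apply]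
  have e01 : (S.coset n i * j) 0 1 = j 0 1 := by
    simp [coset, gl2_mul_apply, lowerUni, diag]
  refine ⟨?_, ?_, ?_, ?_⟩
  · rw [e01, e00, j3]
    exact j2
  · rw [e10, e00, j3]
    refine Valuation.map_add_lt _ ?_ ?_
    · rw [map_mul, j3]
      exact mul_lt_of_lt_one_left p hb
    · rw [map_mul, map_pow]
      exact (mul_le_of_le_one_left' hp).trans_lt j1
  · rw [e11, e00, j3]
    refine Valuation.map_add_le _ ?_ ?_
    · rw [map_mul]
      exact (mul_le_of_le_one_left' hb.le).trans j2
    · rw [map_mul, map_pow]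
      exact mul_le_of_le_one_left' hp
  · rw [gl2det_mul, gl2det_coset, map_mul, hd, e00, j3, map_pow]

/-- The class of `g 1 0 / g 0 0` modulo `𝔭 ^ (n + 1)` selects the coset. With `coset_mul_mem_level`
and `coset_injective`, `level n` is the disjoint union of exactly `q ^ n` left cosets of `ZI`, which
later gives its volume. -/
theorem exists_coset_inv_mul_mem {n : ℕ} {g : GL (Fin 2) F} (hg : g ∈ S.level n) :
    ∃ i, (S.coset n i)⁻¹ * g ∈ iwahoriMulCenter F := by
  obtain ⟨g1, g2, g3, g4⟩ := hg
  have p : 0 < valuation F (g 0 0) := zero_le.trans_lt g2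
  have hne : g 0 0 ≠ 0 := by simpa [zero_lt_iff] using p
  have hϖ := S.ne_zero
  have hpn : 0 < valuation F S.ϖ ^ n := pow_pos S.pos n
  obtain ⟨i, hi, -⟩ := S.existsUnique_rep n (g 1 0 / g 0 0) (by
    rw [map_div₀]
    exact (div_lt_one₀ p).2 g2)
  refine ⟨i, ?_⟩
  set b := S.rep n i
  have e00 : ((S.coset n i)⁻¹ * g) 0 0 = g 0 0 := by
    rw [gl2_mul_apply, coset_inv]
    simp
  have e01 : ((S.coset n i)⁻¹ * g) 0 1 = g 0 1 := by
    rw [gl2_mul_apply, coset_inv]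
    simp
  have e10 : ((S.coset n i)⁻¹ * g) 1 0 = (g 1 0 / g 0 0 - b) / S.ϖ ^ n * g 0 0 := by
    rw [gl2_mul_apply, coset_inv]
    simp
    field_simp
    ring
  have e11 : ((S.coset n i)⁻¹ * g) 1 1 =
      gl2det g / (S.ϖ ^ n * g 0 0) + (g 1 0 / g 0 0 - b) / S.ϖ ^ n * g 0 1 := by
    rw [gl2_mul_apply, coset_inv]
    simp
    field_simp
    simp only [gl2det]
    ring
  have hlt : valuation F ((g 1 0 / g 0 0 - b) / S.ϖ ^ n) < 1 := by
    rw [map_div₀, map_pow]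
    exact (div_lt_one₀ hpn).2 hi
  have h1 : valuation F (gl2det g / (S.ϖ ^ n * g 0 0)) = valuation F (g 0 0) := by
    rw [map_div₀, g4, map_mul, map_pow, div_eq_iff (mul_pos hpn p).ne', sq]
    exact mul_left_comm _ _ _
  have h11 : valuation F (((S.coset n i)⁻¹ * g) 1 1) = valuation F (g 0 0) := by
    rw [e11, Valuation.map_add_eq_of_lt_left, h1]
    rw [h1, map_mul]
    exact (mul_comm _ _).trans_lt ((mul_lt_mul_of_lt_of_le_of_pos hlt g1 p).trans_eq' (mul_comm _ _)
      |>.trans_eq (one_mul _))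
  refine ⟨?_, ?_, ?_⟩
  · rw [e10, h11, map_mul]
    exact mul_lt_of_lt_one_left p hlt
  · rw [e01, h11]
    exact g1
  · rw [e00, h11]

theorem coset_injective {n : ℕ} {i i' : Fin (residueCard F ^ n)}
    (h : (S.coset n i)⁻¹ * S.coset n i' ∈ iwahoriMulCenter F) : i = i' := by
  obtain ⟨h1, -, -⟩ := h
  have hϖ := S.ne_zero
  have hpn : 0 < valuation F S.ϖ ^ n := pow_pos S.pos n
  have e11 : ((S.coset n i)⁻¹ * S.coset n i') 1 1 = 1 := by
    rw [gl2_mul_apply, coset_inv]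
    simp [coset_eq, hϖ]
  have e10 : ((S.coset n i)⁻¹ * S.coset n i') 1 0 = (S.rep n i' - S.rep n i) / S.ϖ ^ n := by
    rw [gl2_mul_apply, coset_inv]
    simp [coset_eq]
    field_simp
    ring
  rw [e10, e11, map_one, map_div₀, map_pow, div_lt_one₀ hpn] at h1
  exact (S.existsUnique_rep n (S.rep n i') (S.rep_lt n i')).unique h1 (by simpa using hpn)

theorem eq_of_mem_level {n m : ℕ} {g : GL (Fin 2) F} (hn : g ∈ S.level n) (hm : g ∈ S.level m) :
    n = m := by
  have p : 0 < valuation F (g 0 0) := zero_le.trans_lt hn.2.1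
  have h := hn.2.2.2.symm.trans hm.2.2.2
  have h2 := mul_right_cancel₀ (pow_ne_zero 2 p.ne') h
  exact pow_right_injective₀ S.pos S.lt_one.ne h2

/-- The union of all level sets. -/
def levels : Set (GL (Fin 2) F) :=
  {g | valuation F (g 0 1) ≤ valuation F (g 0 0) ∧ valuation F (g 1 0) < valuation F (g 0 0) ∧
    valuation F (g 1 1) ≤ valuation F (g 0 0)}

theorem mem_levels_iff (g : GL (Fin 2) F) : g ∈ levels ↔ ∃ n, g ∈ S.level n := by
  refine ⟨?_, fun ⟨n, h⟩ => ⟨h.1, h.2.1, h.2.2.1⟩⟩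
  rintro ⟨g1, g2, g3⟩
  have p : 0 < valuation F (g 0 0) := zero_le.trans_lt g2
  have hne : g 0 0 ≠ 0 := by simpa [zero_lt_iff] using p
  obtain ⟨n, hn⟩ := S.exists_pow (gl2det g / g 0 0 ^ 2)
    (div_ne_zero (gl2det_ne_zero g) (pow_ne_zero 2 hne)) (by
      rw [map_div₀, map_pow]
      refine div_le_one_of_le₀ ?_ zero_le
      rw [gl2det, sq]
      refine Valuation.map_sub_le (v := valuation F) ?_ ?_
      · rw [map_mul]
        gcongr
      · rw [map_mul]
        gcongr)
  refine ⟨n, g1, g2, g3, ?_⟩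
  rw [← hn, map_div₀, map_pow, div_mul_cancel₀ _ (pow_ne_zero 2 p.ne')]

/-- `levels` says that the `(0, 0)` entry dominates, with a rule for ties. Multiplying by `flip` on
the left exchanges the rows and on the right the columns, so any dominant entry can be brought to
that place; the factors `ϖ` settle the ties consistently. -/
theorem mem_levels_cases (g : GL (Fin 2) F) : g ∈ levels ∨ S.flip * g ∈ levels ∨
    g * S.flip ∈ levels ∨ S.flip * g * S.flip ∈ levels := by
  have hdet := gl2det_ne_zero g
  have h0 : ¬ (g 0 0 = 0 ∧ g 1 0 = 0) := fun h => hdet (by simp [gl2det, h])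
  have h0' : ¬ (g 0 1 = 0 ∧ g 1 1 = 0) := fun h => hdet (by simp [gl2det, h])
  have h0'' : ¬ (g 0 0 = 0 ∧ g 0 1 = 0) := fun h => hdet (by simp [gl2det, h])
  have k0 : ¬ (g 1 0 = 0 ∧ g 1 1 = 0) := fun h => hdet (by simp [gl2det, h])
  simp only [levels, Set.mem_ofPred_eq, gl2_mul_apply, flip, gl2_00, gl2_01, gl2_10, gl2_11,
    mul_zero, zero_add, mul_one, add_zero, zero_mul, one_mul, mul_comm _ S.ϖ, S.le_iff,
    S.lt_iff]
  have hϖ := S.ne_zero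
  -- After the rewriting, `ϖ * g 0 1` is the only product with `ϖ` left; this bound is all that
  -- relates it to the entries.
  have hle : valuation F (S.ϖ * g 0 1) ≤ valuation F (g 0 1) := by
    rw [map_mul]
    exact mul_le_of_le_one_left' S.lt_one.le
  simp only [ne_eq, mul_eq_zero, hϖ, false_or]
  generalize valuation F (g 0 0) = A at *
  generalize valuation F (g 0 1) = B at *
  generalize valuation F (g 1 0) = C at *
  generalize valuation F (g 1 1) = D at *
  generalize valuation F (S.ϖ * g 0 1) = E at *
  clear hdet hϖ
  grind

theorem flip_mul_notMem_levels {g : GL (Fin 2) F} (hg : g ∈ levels) : S.flip * g ∉ levels := by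
  intro h
  simp only [levels, Set.mem_ofPred_eq, gl2_mul_apply, flip, gl2_00, gl2_01, gl2_10, gl2_11,
    zero_add, add_zero, zero_mul, one_mul,
    S.lt_iff] at hg h
  exact absurd (hg.2.1.trans_le h.2.1.2) (lt_irrefl _)

theorem mul_flip_notMem_levels {g : GL (Fin 2) F} (hg : g ∈ levels) : g * S.flip ∉ levels := by
  intro h
  simp only [levels, Set.mem_ofPred_eq, gl2_mul_apply, flip, gl2_00, gl2_01, gl2_10, gl2_11,
    mul_zero, zero_add, mul_one, add_zero, mul_comm _ S.ϖ, S.le_iff] at hg h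
  rcases h.1 with h1 | h1
  · simp [h1] at hg
  · exact absurd (hg.1.trans_lt h1) (lt_irrefl _)

/-- Membership in `T` gives `|g 1 1| ≤ |g 0 0|`, membership in `sTs` the reverse; equality of the
two is the missing Iwahori condition. -/
theorem mem_iwahori_of_mem_levels {g : GL (Fin 2) F} (hg : g ∈ levels)
    (h : S.flip * g * S.flip ∈ levels) : g ∈ iwahoriMulCenter F := by
  simp only [levels, Set.mem_ofPred_eq, gl2_mul_apply, flip, gl2_00, gl2_01, gl2_10, gl2_11,
    mul_zero, zero_add, mul_one, add_zero, zero_mul, one_mul, mul_comm _ S.ϖ, S.le_iff] at hg h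
  have e : valuation F (g 0 0) = valuation F (g 1 1) := by
    refine le_antisymm ?_ hg.2.2
    rcases h.2.2 with h1 | h1
    · have : g 0 0 = 0 := by simpa [S.ne_zero] using h1.2
      simp [this] at hg
    · exact (S.lt_iff.1 h1).2
  exact ⟨e ▸ hg.2.1, e ▸ hg.1, e⟩

/-- The indicator function of `ballSet`. -/
def _root_.ballInd (F : Type*) [Field F] [ValuativeRel F] : GL (Fin 2) F → ℂ :=
  (ballSet F).indicator 1

open Classical in
theorem _root_.ballInd_apply (g : GL (Fin 2) F) :
    ballInd F g = if g ∈ ballSet F then 1 else 0 := by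
  simp [ballInd, Set.indicator_apply]

theorem ballInd_eq_sum (n : ℕ) (g : GL (Fin 2) F) :
    ballInd F g = ∑ i, ballInd F (g * S.coset n i) := by
  classical
  simp only [ballInd_apply]
  by_cases hg : g ∈ ballSet F
  · obtain ⟨i, hi, hu⟩ := S.existsUnique_mul_coset_mem_ballSet hg n
    rw [if_pos hg, Finset.sum_eq_single i, if_pos hi]
    · intro j _ hj
      exact if_neg fun h => hj (hu j h)
    · simp
  · rw [if_neg hg, Finset.sum_eq_zero]
    intro i _
    exact if_neg fun h => hg (S.mem_ballSet_of_mul_coset h)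

theorem ballInd_mul_flip (g : GL (Fin 2) F) : ballInd F (g * S.flip) = 1 - ballInd F g := by
  classical
  simp only [ballInd_apply, S.mul_flip_mem_ballSet_iff]
  split_ifs <;> simp

theorem exists_pow_lt (γ : (ValueGroupWithZero F)ˣ) : ∃ n, valuation F S.ϖ ^ n < γ := by
  obtain ⟨x, hx⟩ := ValuativeRel.valuation_surjective (γ : ValueGroupWithZero F)
  have hx0 : x ≠ 0 := by
    rintro rfl
    exact γ.ne_zero (by simpa using hx.symm)
  rw [← hx]
  rcases le_or_gt (valuation F x) 1 with h | h
  · obtain ⟨n, hn⟩ := S.exists_pow x hx0 h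
    exact ⟨n + 1, by rw [hn]; exact pow_lt_pow_right_of_lt_one₀ S.pos S.lt_one n.lt_succ_self⟩
  · exact ⟨0, by simpa using h⟩

/-- The quotient is lower unipotent with entry in `𝔭`. So all cosets of one level are obtained from
any one of them by left multiplication by `I`. -/
theorem coset_mul_inv_mem {n : ℕ} (i i' : Fin (residueCard F ^ n)) :
    S.coset n i * (S.coset n i')⁻¹ ∈ iwahoriMulCenter F := by
  have : S.coset n i * (S.coset n i')⁻¹ = lowerUni (S.rep n i - S.rep n i') := by
    rw [coset_inv, coset_eq]
    have := S.ne_zero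
    apply gl2_ext <;> simp [gl2_mul_apply, lowerUni, this]
    field_simp
    ring
  rw [this]
  refine ⟨?_, ?_, ?_⟩
  · simpa [lowerUni] using Valuation.map_sub_lt _ (S.rep_lt n i) (S.rep_lt n i')
  · simp [lowerUni]
  · simp [lowerUni]

/-- The set of `h` which lie in a double coset of the Iwahori subgroup for which the
corresponding matrix coefficient has absolute value `q ^ (-n)`. -/
def flipLevel (n : ℕ) : Set (GL (Fin 2) F) :=
  {h | h ∈ S.level n ∨ S.flip * h ∈ S.level n ∨ h * S.flip ∈ S.level n ∨
    S.flip * h * S.flip ∈ S.level n}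

theorem exists_mem_flipLevel (h : GL (Fin 2) F) : ∃ n, h ∈ S.flipLevel n := by
  rcases S.mem_levels_cases h with h | h | h | h <;> obtain ⟨n, hn⟩ := (S.mem_levels_iff _).1 h
  exacts [⟨n, Or.inl hn⟩, ⟨n, Or.inr (Or.inl hn)⟩, ⟨n, Or.inr (Or.inr (Or.inl hn))⟩,
    ⟨n, Or.inr (Or.inr (Or.inr hn))⟩]

end UniformizerSystem

/-- On each of the `q ^ n` small balls `f` is constant for `n` large, with the value at the centre
`(-rep n i : 1)`. -/
theorem UniformizerSystem.apply_mul_ballInd {F : Type*} [Field F] [ValuativeRel F]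
    [TopologicalSpace F] (S : UniformizerSystem F)
    (f : smoothInd (GL (Fin 2) F) (upperTriangularGL2 F)) {n : ℕ}
    (hn : ∀ y x, valuation F y < valuation F S.ϖ ^ n →
      (f : GL (Fin 2) F → ℂ) (x * lowerUni y) = (f : GL (Fin 2) F → ℂ) x) (x : GL (Fin 2) F) :
    (f : GL (Fin 2) F → ℂ) x * ballInd F x =
      ∑ i, (f : GL (Fin 2) F → ℂ) (lowerUni (-S.rep n i)) * ballInd F (x * S.coset n i) := by
  classical
  rw [S.ballInd_eq_sum n x, Finset.mul_sum]
  refine Finset.sum_congr rfl fun i _ => ?_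
  rw [ballInd_apply]
  split_ifs with h
  · congr 1
    have hx : valuation F (x 1 0) < valuation F (x 1 1) := S.mem_ballSet_of_mul_coset h
    rw [S.mul_coset_mem_ballSet_iff] at h
    have p : 0 < valuation F (x 1 1) := zero_le.trans_lt hx
    have hne : x 1 1 ≠ 0 := by simpa [zero_lt_iff] using p
    have h1 : (f : GL (Fin 2) F → ℂ) x = (f : GL (Fin 2) F → ℂ) (lowerUni (x 1 0 / x 1 1)) := by
      have : x = (x * lowerUni (-(x 1 0 / x 1 1))) * lowerUni (x 1 0 / x 1 1) := by
        rw [mul_assoc, lowerUni_mul]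
        apply gl2_ext <;> simp [lowerUni, gl2_mul_apply]
      conv_lhs => rw [this]
      refine f.2.1 _ ?_ _
      change (x * lowerUni (-(x 1 0 / x 1 1))) 1 0 = 0
      rw [gl2_mul_apply]
      simp only [lowerUni, gl2_00, gl2_10]
      field_simp
      ring
    have h2 : lowerUni (x 1 0 / x 1 1) =
        lowerUni (-S.rep n i) * lowerUni (x 1 0 / x 1 1 + S.rep n i) := by
      rw [lowerUni_mul]
      congr 1
      ring
    rw [h1, h2, hn]
    rw [show x 1 0 + x 1 1 * S.rep n i = x 1 1 * (x 1 0 / x 1 1 + S.rep n i) by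
      field_simp, map_mul] at h
    exact (mul_lt_mul_iff_right₀ p).1 h
  · simp

/-! ### The Iwahori-fixed vector of the smooth Steinberg representation -/

section Topology

variable {F : Type*} [Field F] [ValuativeRel F] [TopologicalSpace F] [IsNonarchimedeanLocalField F]

theorem isOpen_iwahoriMulCenter : IsOpen (iwahoriMulCenter F : Set (GL (Fin 2) F)) := by
  refine Subgroup.isOpen_of_mem_nhds _ (g := 1) ?_
  have hball : ∀ x : F, {y : F | valuation F (y - x) < 1} ∈ nhds x := fun x =>
    IsValuativeTopology.mem_nhds_iff'.2 ⟨1, by simp⟩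
  have h := fun i j => (continuous_gl2_entry (F := F) i j).continuousAt (x := 1) (hball _)
  filter_upwards [h 0 0, h 0 1, h 1 0, h 1 1] with g h00 h01 h10 h11
  simp at h00 h01 h10 h11
  have e0 : valuation F (g 0 0) = 1 := by
    rw [show g 0 0 = 1 + (g 0 0 - 1) by ring, Valuation.map_one_add_of_lt _ h00]
  have e1 : valuation F (g 1 1) = 1 := by
    rw [show g 1 1 = 1 + (g 1 1 - 1) by ring, Valuation.map_one_add_of_lt _ h11]
  exact ⟨by rwa [e1], by rw [e1]; exact h01.le, by rw [e0, e1]⟩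

theorem continuous_lowerUni : Continuous (lowerUni : F → GL (Fin 2) F) := by
  have h : ∀ b : F, (lowerUni b)⁻¹ = lowerUni (-b) := by
    intro b
    rw [inv_eq_iff_mul_eq_one, lowerUni_mul]
    apply gl2_ext <;> simp [lowerUni]
  have hc : Continuous fun b : F => (lowerUni b : GL (Fin 2) F).val := by
    refine continuous_matrix fun i j => ?_
    fin_cases i <;> fin_cases j
    exacts [continuous_const, continuous_const, continuous_id, continuous_const]
  refine Units.continuous_iff.2 ⟨hc, ?_⟩
  simp_rw [h]
  exact hc.comp continuous_neg

namespace UniformizerSystem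

variable (S : UniformizerSystem F)

theorem exists_lowerUni_mem {U : Subgroup (GL (Fin 2) F)} (hU : IsOpen (U : Set (GL (Fin 2) F))) :
    ∃ N, ∀ y, valuation F y < valuation F S.ϖ ^ N → lowerUni y ∈ U := by
  have h1 : (lowerUni 0 : GL (Fin 2) F) = 1 := by apply gl2_ext <;> simp [lowerUni]
  have h : lowerUni ⁻¹' (U : Set (GL (Fin 2) F)) ∈ nhds (0 : F) :=
    continuous_lowerUni.continuousAt (hU.mem_nhds (by rw [h1]; exact one_mem U))
  obtain ⟨γ, hγ⟩ := (IsValuativeTopology.mem_nhds_zero_iff _).1 h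
  obtain ⟨N, hN⟩ := S.exists_pow_lt γ
  exact ⟨N, fun y hy => hγ (hy.trans hN)⟩

end UniformizerSystem

/-- The indicator function of the ball, as an element of the smooth induction. -/
def ballSmooth (F : Type*) [Field F] [ValuativeRel F] [TopologicalSpace F]
    [IsNonarchimedeanLocalField F] : smoothInd (GL (Fin 2) F) (upperTriangularGL2 F) :=
  ⟨ballInd F, fun b hb x => by classical simp only [ballInd_apply, mul_mem_ballSet_iff_of_upper hb],
    iwahoriMulCenter F, isOpen_iwahoriMulCenter, fun u hu x => by
      classical simp only [ballInd_apply, mul_mem_ballSet_iff hu]⟩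

/-- The vector of the Steinberg representation fixed by the Iwahori subgroup. -/
def iwahoriVector (F : Type*) [Field F] [ValuativeRel F] [TopologicalSpace F]
    [IsNonarchimedeanLocalField F] : smoothInd (GL (Fin 2) F) (upperTriangularGL2 F) ⧸
      constFunctions (GL (Fin 2) F) (upperTriangularGL2 F) :=
  Submodule.Quotient.mk (ballSmooth F)

theorem smoothIndRep_apply {G : Type*} [Group G] [TopologicalSpace G] [ContinuousMul G]
    {B : Subgroup G} (g : G) (f : smoothInd G B) (x : G) :
    (smoothIndRep G B g f : G → ℂ) x = (f : G → ℂ) (x * g) := rfl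

theorem smoothSteinberg_mk (g : GL (Fin 2) F)
    (f : smoothInd (GL (Fin 2) F) (upperTriangularGL2 F)) :
    smoothSteinberg F g (Submodule.Quotient.mk f) =
      Submodule.Quotient.mk (smoothIndRep _ _ g f) := rfl

theorem mem_constFunctions_iff {G : Type*} [Group G] [TopologicalSpace G] {B : Subgroup G}
    (f : smoothInd G B) : f ∈ constFunctions G B ↔ ∃ c : ℂ, ∀ x, (f : G → ℂ) x = c := by
  change (f : G → ℂ) ∈ Submodule.span ℂ _ ↔ _
  rw [Submodule.mem_span_singleton]
  refine exists_congr fun c => ⟨fun h x => by rw [← h]; simp, fun h => ?_⟩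
  ext x
  simp [h]

theorem iwahoriVector_ne_zero : iwahoriVector F ≠ 0 := by
  classical
  intro h
  obtain ⟨c, hc⟩ := (mem_constFunctions_iff _).1 ((Submodule.Quotient.mk_eq_zero _).1 h)
  have h1 : ballInd F 1 = c := hc 1
  have h2 : ballInd F weylElt = c := hc weylElt
  rw [ballInd_apply, if_pos (by simp [ballSet])] at h1
  rw [ballInd_apply, if_neg (by simp [ballSet, weylElt]), ← h1] at h2
  exact zero_ne_one h2

theorem smoothSteinberg_center {z : GL (Fin 2) F} (hz : z ∈ Subgroup.center (GL (Fin 2) F)) :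
    smoothSteinberg F z = 1 := by
  refine LinearMap.ext fun v => ?_
  obtain ⟨f, rfl⟩ := Submodule.Quotient.mk_surjective _ v
  rw [smoothSteinberg_mk]
  congr 1
  ext x
  rw [smoothIndRep_apply, Subgroup.mem_center_iff.1 hz x,
    f.2.1 z (center_le_upperTriangular hz)]

theorem smoothSteinberg_iwahori {j : GL (Fin 2) F} (hj : j ∈ iwahoriMulCenter F) :
    smoothSteinberg F j (iwahoriVector F) = iwahoriVector F := by
  classical
  rw [iwahoriVector, smoothSteinberg_mk]
  congr 1
  ext x
  rw [smoothIndRep_apply]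
  simp only [ballSmooth, ballInd_apply, mul_mem_ballSet_iff hj]

namespace UniformizerSystem

variable (S : UniformizerSystem F)

/-- The translate is the indicator of the complementary ball, and the two indicators add up to the
constant `1`. -/
theorem smoothSteinberg_flip :
    smoothSteinberg F S.flip (iwahoriVector F) = -iwahoriVector F := by
  rw [iwahoriVector, smoothSteinberg_mk, ← Submodule.Quotient.mk_neg, Submodule.Quotient.eq,
    mem_constFunctions_iff]
  refine ⟨1, fun x => ?_⟩
  change ballInd F (x * S.flip) - -ballInd F x = 1
  rw [S.ballInd_mul_flip]
  ring

theorem iwahoriVector_eq_sum (n : ℕ) :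
    iwahoriVector F = ∑ i, smoothSteinberg F (S.coset n i) (iwahoriVector F) := by
  have h : ballSmooth F = ∑ i, smoothIndRep _ _ (S.coset n i) (ballSmooth F) := by
    ext x
    simp only [AddSubmonoidClass.coe_finsetSum, Finset.sum_apply, smoothIndRep_apply]
    exact S.ballInd_eq_sum n x
  have h' := congrArg (constFunctions (GL (Fin 2) F) (upperTriangularGL2 F)).mkQ h
  rw [map_sum] at h'
  exact h'

/-- Writing `h = coset n i₀ * j` with `j ∈ ZI` gives `h w = coset n i₀ w`, so each `coset n i w`
equals `(coset n i * (coset n i₀)⁻¹) h w`. -/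
theorem iwahoriVector_eq_sum_of_mem_level {n : ℕ} {h : GL (Fin 2) F} (hh : h ∈ S.level n) :
    ∃ k : Fin (residueCard F ^ n) → GL (Fin 2) F, (∀ i, k i ∈ iwahoriMulCenter F) ∧
      iwahoriVector F = ∑ i, smoothSteinberg F (k i * h) (iwahoriVector F) := by
  obtain ⟨i₀, hi₀⟩ := S.exists_coset_inv_mul_mem hh
  refine ⟨fun i => S.coset n i * (S.coset n i₀)⁻¹, fun i => S.coset_mul_inv_mem i i₀, ?_⟩
  conv_lhs => rw [S.iwahoriVector_eq_sum n]
  refine Finset.sum_congr rfl fun i _ => ?_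
  rw [mul_assoc, map_mul, Module.End.mul_apply, smoothSteinberg_iwahori hi₀]

theorem iwahoriVector_eq_sum_of_mem_flipLevel {n : ℕ} {h : GL (Fin 2) F} (hh : h ∈ S.flipLevel n) :
    ∃ k : Fin (residueCard F ^ n) → GL (Fin 2) F, (∀ i, k i ∈ iwahoriMulCenter F) ∧
      ∃ ε : ℂ, (ε = 1 ∨ ε = -1) ∧
        iwahoriVector F = ε • ∑ i, smoothSteinberg F (k i * h) (iwahoriVector F) := by
  -- A factor `flip` on the left is removed by applying `flip` to the identity and conjugating each
  -- `k i` by it; a factor on the right (in `right`) acts on `w` by `-1`. Each costs a sign.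
  have left : ∀ h : GL (Fin 2) F, (∃ k : Fin (residueCard F ^ n) → GL (Fin 2) F,
      (∀ i, k i ∈ iwahoriMulCenter F) ∧ ∃ ε : ℂ, (ε = 1 ∨ ε = -1) ∧
        iwahoriVector F = ε • ∑ i, smoothSteinberg F (k i * (S.flip * h)) (iwahoriVector F)) →
      (∃ k : Fin (residueCard F ^ n) → GL (Fin 2) F,
      (∀ i, k i ∈ iwahoriMulCenter F) ∧ ∃ ε : ℂ, (ε = 1 ∨ ε = -1) ∧
        iwahoriVector F = ε • ∑ i, smoothSteinberg F (k i * h) (iwahoriVector F)) := by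
    rintro h ⟨k, hk, ε, hε, he⟩
    refine ⟨fun i => S.flip * k i * S.flip, fun i => S.flip_mul_mul_flip_mem (hk i), -ε, ?_, ?_⟩
    · rcases hε with rfl | rfl <;> simp
    · have := congrArg (smoothSteinberg F S.flip) he
      rw [S.smoothSteinberg_flip, map_smul, map_sum] at this
      rw [neg_smul, ← neg_eq_iff_eq_neg, this]
      simp only [← Module.End.mul_apply, ← map_mul, mul_assoc]
  have right : ∀ h : GL (Fin 2) F, (∃ k : Fin (residueCard F ^ n) → GL (Fin 2) F,
      (∀ i, k i ∈ iwahoriMulCenter F) ∧ ∃ ε : ℂ, (ε = 1 ∨ ε = -1) ∧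
        iwahoriVector F = ε • ∑ i, smoothSteinberg F (k i * (h * S.flip)) (iwahoriVector F)) →
      (∃ k : Fin (residueCard F ^ n) → GL (Fin 2) F,
      (∀ i, k i ∈ iwahoriMulCenter F) ∧ ∃ ε : ℂ, (ε = 1 ∨ ε = -1) ∧
        iwahoriVector F = ε • ∑ i, smoothSteinberg F (k i * h) (iwahoriVector F)) := by
    rintro h ⟨k, hk, ε, hε, he⟩
    refine ⟨k, hk, -ε, ?_, ?_⟩
    · rcases hε with rfl | rfl <;> simp
    · simp only [← mul_assoc] at he
      simp only [map_mul _ _ S.flip, Module.End.mul_apply, S.smoothSteinberg_flip, map_neg,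
        Finset.sum_neg_distrib, smul_neg] at he
      rw [neg_smul]
      exact he
  have base : ∀ h ∈ S.level n, (∃ k : Fin (residueCard F ^ n) → GL (Fin 2) F,
      (∀ i, k i ∈ iwahoriMulCenter F) ∧ ∃ ε : ℂ, (ε = 1 ∨ ε = -1) ∧
        iwahoriVector F = ε • ∑ i, smoothSteinberg F (k i * h) (iwahoriVector F)) := by
    intro h hh
    obtain ⟨k, hk, he⟩ := S.iwahoriVector_eq_sum_of_mem_level hh
    exact ⟨k, hk, 1, Or.inl rfl, by rwa [one_smul]⟩
  rcases hh with h | h | h | h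
  · exact base _ h
  · exact left _ (base _ h)
  · exact right _ (base _ h)
  · refine left _ (right _ (base _ h))

end UniformizerSystem

/-- A locally constant `f` splits as its restrictions to the ball and to the complement. The first
is a combination of indicators of small balls; the second is the `flip`-translate of such a
combination. -/
theorem span_iwahoriVector :
    Submodule.span ℂ (Set.range fun h => smoothSteinberg F h (iwahoriVector F)) = ⊤ := by
  obtain ⟨S⟩ := nonempty_uniformizerSystem F
  rw [eq_top_iff]
  rintro v -
  obtain ⟨f, rfl⟩ := Submodule.Quotient.mk_surjective _ v
  have key : ∀ f : smoothInd (GL (Fin 2) F) (upperTriangularGL2 F), ∃ N, ∀ n ≥ N,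
      ∀ y x, valuation F y < valuation F S.ϖ ^ n →
      (f : GL (Fin 2) F → ℂ) (x * lowerUni y) = (f : GL (Fin 2) F → ℂ) x := by
    intro f
    obtain ⟨U, hU, hf⟩ := f.2.2
    obtain ⟨N, hN⟩ := S.exists_lowerUni_mem hU
    exact ⟨N, fun n hn y x hy => hf _ (hN y (hy.trans_le
      (pow_le_pow_of_le_one zero_le S.lt_one.le hn))) x⟩
  obtain ⟨N₁, h₁⟩ := key f
  obtain ⟨N₂, h₂⟩ := key (smoothIndRep _ _ S.flip⁻¹ f)
  set n := max N₁ N₂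
  have hf : f = ∑ i, (f : GL (Fin 2) F → ℂ) (lowerUni (-S.rep n i)) •
        smoothIndRep _ _ (S.coset n i) (ballSmooth F) +
      ∑ i, (f : GL (Fin 2) F → ℂ) (lowerUni (-S.rep n i) * S.flip⁻¹) •
        smoothIndRep _ _ (S.flip * S.coset n i) (ballSmooth F) := by
    ext x
    have e₁ := S.apply_mul_ballInd f (h₁ n (le_max_left _ _)) x
    have e₂ := S.apply_mul_ballInd _ (h₂ n (le_max_right _ _)) (x * S.flip)
    simp only [smoothIndRep_apply, mul_inv_cancel_right, S.ballInd_mul_flip] at e₂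
    simp only [Submodule.coe_add, AddSubmonoidClass.coe_finsetSum, Submodule.coe_smul,
      Pi.add_apply, Finset.sum_apply, Pi.smul_apply, smul_eq_mul, smoothIndRep_apply, ← mul_assoc]
    change _ = ∑ i, _ * ballInd F _ + ∑ i, _ * ballInd F _
    rw [← e₁, ← e₂]
    ring
  rw [hf, ← Submodule.mkQ_apply, map_add, map_sum, map_sum]
  refine add_mem (sum_mem fun i _ => ?_) (sum_mem fun i _ => ?_) <;>
  · rw [map_smul]
    exact Submodule.smul_mem _ _ (Submodule.subset_span ⟨_, rfl⟩)

end Topology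

/-! ### Modular character and measures of cosets -/

section Unimodular

open Measure

variable {G : Type*} [Group G] [TopologicalSpace G] [IsTopologicalGroup G]

/-- Right translation by `g ∈ U` maps `U` to itself, and `0 < μ U < ∞`, so the scaling factor is
`1`. -/
theorem modularCharacterFun_eq_one_of_mem_openSubgroup [LocallyCompactSpace G] [MeasurableSpace G] [BorelSpace G]
    (μ : Measure G) [μ.IsHaarMeasure] {U : Subgroup G} (hU : IsOpen (U : Set G))
    (hfin : μ U ≠ ⊤) {g : G} (hg : g ∈ U) : modularCharacterFun g = 1 := by
  rw [modularCharacterFun_eq_haarScalarFactor μ g]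
  have h := measure_isHaarMeasure_eq_smul_of_isOpen (map (· * g) μ) μ hU
  rw [map_apply (measurable_mul_const g) hU.measurableSet] at h
  have h2 : (fun x => x * g) ⁻¹' (U : Set G) = U := by
    ext x
    exact Subgroup.mul_mem_cancel_right U hg
  rw [h2] at h
  have hpos : μ U ≠ 0 := (hU.measure_pos μ ⟨1, one_mem U⟩).ne'
  have h3 : (haarScalarFactor (map (· * g) μ) μ : ENNReal) * μ U = 1 * μ U := by
    rw [one_mul]
    exact h.symm
  exact_mod_cast (ENNReal.mul_left_inj hpos hfin).1 h3

theorem measure_preimage_mul_right_of_isOpen [LocallyCompactSpace G] [MeasurableSpace G] [BorelSpace G]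
    (μ : Measure G) [μ.IsHaarMeasure] {g : G} (hg : modularCharacterFun g = 1) {V : Set G}
    (hV : IsOpen V) : μ ((fun x => x * g) ⁻¹' V) = μ V := by
  rw [← map_apply (measurable_mul_const g) hV.measurableSet,
    measure_isHaarMeasure_eq_smul_of_isOpen (map (· * g) μ) μ hV,
    ← modularCharacterFun_eq_haarScalarFactor, hg, one_smul]

/-- `μ` is not assumed regular, so uniqueness of Haar measure is used on open sets only. They form a
π-system generating the Borel sets; a countable open cover of finite measure then gives equality on
all Borel sets. -/
theorem isMulRightInvariant_of_modularCharacterFun [LocallyCompactSpace G] [MeasurableSpace G] [BorelSpace G]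
    (μ : Measure G) [μ.IsHaarMeasure] (h : ∀ g : G, modularCharacterFun g = 1)
    (B : ℕ → Set G) (hB : ∀ n, IsOpen (B n)) (hfin : ∀ n, μ (B n) ≠ ⊤) (hun : ⋃ n, B n = Set.univ) :
    μ.IsMulRightInvariant := by
  refine ⟨fun g => ?_⟩
  refine ext_of_generateFrom_of_iUnion {s | IsOpen s} B BorelSpace.measurable_eq
    isPiSystem_isOpen hun hB (fun n => ?_) fun s hs => ?_
  · rw [map_apply (measurable_mul_const g) (hB n).measurableSet,
      measure_preimage_mul_right_of_isOpen μ (h g) (hB n)]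
    exact hfin n
  · rw [map_apply (measurable_mul_const g) (IsOpen.measurableSet hs),
      measure_preimage_mul_right_of_isOpen μ (h g) hs]

/-- The measure of a disjoint union of left cosets. -/
theorem measure_iUnion_leftCosets [MeasurableSpace G] [BorelSpace G] (μ : Measure G)
    [μ.IsMulLeftInvariant] {J : Subgroup G} (hJ : IsOpen (J : Set G)) {ι : Type*} [Fintype ι]
    (y : ι → G) (hy : ∀ i j, (y i)⁻¹ * y j ∈ J → i = j) :
    μ (⋃ i, (fun x => (y i)⁻¹ * x) ⁻¹' (J : Set G)) = Fintype.card ι * μ J := by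
  rw [measure_iUnion]
  · simp only [measure_preimage_mul]
    simp [tsum_fintype]
  · intro i j hij
    refine Set.disjoint_left.2 fun x hx hx' => hij (hy i j ?_)
    have := J.mul_mem (show (y i)⁻¹ * x ∈ J from hx) (J.inv_mem (show (y j)⁻¹ * x ∈ J from hx'))
    simpa [mul_assoc] using this
  · intro i
    exact (hJ.preimage (continuous_const_mul _)).measurableSet

end Unimodular

/-! ### Passage to `PGL2` and the cosets of the Iwahori subgroup in `K` -/

/-- The group `GL(2,F) / Z`. -/
abbrev PGL2 (F : Type*) [Field F] := GL (Fin 2) F ⧸ Subgroup.center (GL (Fin 2) F)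

section PGL2

variable {F : Type*} [Field F] [ValuativeRel F]

/-- The image of the Iwahori subgroup in `PGL2`. -/
def iwahori (F : Type*) [Field F] [ValuativeRel F] : Subgroup (PGL2 F) :=
  (iwahoriMulCenter F).map (QuotientGroup.mk' _)

theorem mk_mem_iwahori {g : GL (Fin 2) F} :
    (g : PGL2 F) ∈ iwahori F ↔ g ∈ iwahoriMulCenter F := by
  refine ⟨?_, fun h => ⟨g, h, rfl⟩⟩
  rintro ⟨h, hh, he⟩
  have : h⁻¹ * g ∈ Subgroup.center _ := QuotientGroup.eq.1 he
  have h2 := mul_mem hh (center_le_iwahoriMulCenter this)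
  rwa [mul_inv_cancel_left] at h2

theorem gl2_valuation_det_le {g : GL (Fin 2) F} (h : ∀ i j, valuation F (g i j) ≤ 1) :
    valuation F (gl2det g) ≤ 1 := by
  refine Valuation.map_sub_le (v := valuation F) ?_ ?_
  · rw [map_mul]; exact mul_le_one' (h _ _) (h _ _)
  · rw [map_mul]; exact mul_le_one' (h _ _) (h _ _)

theorem mem_integralGL2_iff {g : GL (Fin 2) F} : g ∈ integralGL2 F ↔
    (∀ i j, valuation F (g i j) ≤ 1) ∧ valuation F (gl2det g) = 1 := by
  constructor
  · rintro ⟨h, rfl⟩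
    have key : ∀ h : GL (Fin 2) (valuation F).integer, ∀ i j, valuation F
      ((Matrix.GeneralLinearGroup.map (n := Fin 2) (algebraMap (valuation F).integer F) h) i j) ≤ 1 :=
      fun h i j => (h i j).2
    refine ⟨key h, le_antisymm (gl2_valuation_det_le (key h)) ?_⟩
    -- The inverse is integral too, so both determinants have valuation at most `1` while their
    -- product is `1`.
    have h1 := gl2_valuation_det_le (key h⁻¹)
    have h2 := gl2det_mul (Matrix.GeneralLinearGroup.map (n := Fin 2)
      (algebraMap (valuation F).integer F) h) (Matrix.GeneralLinearGroup.map (n := Fin 2)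
      (algebraMap (valuation F).integer F) h⁻¹)
    rw [← map_mul, mul_inv_cancel, map_one] at h2
    have h3 := congrArg (valuation F) h2
    rw [map_mul, show gl2det (1 : GL (Fin 2) F) = 1 by simp [gl2det], map_one] at h3
    by_contra! hlt
    exact absurd h3.symm (mul_lt_one_of_lt_of_le hlt h1).ne
  · rintro ⟨h1, h2⟩
    let A : Matrix (Fin 2) (Fin 2) (valuation F).integer := fun i j => ⟨g i j, h1 i j⟩
    have hint : (valuation F).Integers (valuation F).integer := Valuation.integer.integers _
    have hA : IsUnit A.det := by
      rw [hint.isUnit_iff_valuation_eq_one, Matrix.det_fin_two]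
      exact h2
    refine ⟨Matrix.GeneralLinearGroup.mk'' A hA, ?_⟩
    apply gl2_ext <;> rfl

theorem mem_iwahoriMulCenter_of_integral {g : GL (Fin 2) F} (h : ∀ i j, valuation F (g i j) ≤ 1)
    (hd : valuation F (gl2det g) = 1) (h10 : valuation F (g 1 0) < 1) :
    g ∈ iwahoriMulCenter F := by
  have h2 : valuation F (g 0 1 * g 1 0) < 1 := by
    rw [map_mul]
    exact (mul_le_of_le_one_left' (h _ _)).trans_lt h10
  have h3 : valuation F (g 0 0 * g 1 1) = 1 := by
    rw [show g 0 0 * g 1 1 = gl2det g + g 0 1 * g 1 0 by simp only [gl2det]; ring,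
      Valuation.map_add_eq_of_lt_left _ (by rwa [hd]), hd]
  rw [map_mul] at h3
  have h0 : valuation F (g 0 0) = 1 := by
    refine le_antisymm (h _ _) ?_
    by_contra! hlt
    exact absurd h3 (mul_lt_one_of_lt_of_le hlt (h _ _)).ne
  have h1 : valuation F (g 1 1) = 1 := by rwa [h0, one_mul] at h3
  exact ⟨by rwa [h1], by rw [h1]; exact h _ _, by rw [h0, h1]⟩

theorem weylElt_mem_integralGL2 : weylElt ∈ integralGL2 F := by
  rw [mem_integralGL2_iff]
  refine ⟨fun i j => ?_, by simp [gl2det, weylElt]⟩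
  fin_cases i <;> fin_cases j <;> simp [weylElt]

theorem upperUni_mem_integralGL2 {x : F} (hx : valuation F x ≤ 1) :
    upperUni x ∈ integralGL2 F := by
  rw [mem_integralGL2_iff]
  refine ⟨fun i j => ?_, by simp [gl2det, upperUni]⟩
  fin_cases i <;> fin_cases j <;> simp [upperUni, hx]

theorem iwahori_le_integralGL2ModCenter : iwahori F ≤ integralGL2ModCenter F := by
  rintro _ ⟨g, ⟨h1, h2, h3⟩, rfl⟩
  have p : 0 < valuation F (g 1 1) := zero_le.trans_lt h1
  have hne : g 1 1 ≠ 0 := by simpa [zero_lt_iff] using p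
  refine ⟨scalarGL2 (g 1 1)⁻¹ (inv_ne_zero hne) * g, ?_, ?_⟩
  · have e : ∀ i j, valuation F ((scalarGL2 (g 1 1)⁻¹ (inv_ne_zero hne) * g) i j) ≤ 1 := by
      have e' : ∀ i j, valuation F (g i j) ≤ valuation F (g 1 1) := by
        intro i j
        fin_cases i <;> fin_cases j
        exacts [h3.le, h2, h1.le, le_rfl]
      intro i j
      have : (scalarGL2 (g 1 1)⁻¹ (inv_ne_zero hne) * g) i j = g i j / g 1 1 := by
        rw [gl2_mul_apply]
        fin_cases i <;> simp [scalarGL2, div_eq_inv_mul]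
      rw [this, map_div₀]
      exact div_le_one_of_le₀ (e' i j) zero_le
    refine mem_integralGL2_iff.2 ⟨e, ?_⟩
    have hd : gl2det (scalarGL2 (g 1 1)⁻¹ (inv_ne_zero hne)) = (g 1 1 ^ 2)⁻¹ := by
      simp [gl2det, scalarGL2]
      field_simp
    have hdg : valuation F (gl2det g) = valuation F (g 1 1) ^ 2 := by
      rw [gl2det, sub_eq_add_neg, Valuation.map_add_eq_of_lt_left]
      · rw [map_mul, h3, sq]
      · rw [Valuation.map_neg, map_mul, map_mul, h3]
        exact mul_lt_mul' h2 h1 zero_le p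
    rw [gl2det_mul, hd, map_mul, map_inv₀, map_pow, hdg]
    exact inv_mul_cancel₀ (pow_ne_zero 2 p.ne')
  · rw [map_mul]
    have : (QuotientGroup.mk' (Subgroup.center (GL (Fin 2) F)))
        (scalarGL2 (g 1 1)⁻¹ (inv_ne_zero hne)) = 1 :=
      (QuotientGroup.eq_one_iff _).2 (scalarGL2_mem_center _ _)
    rw [this, one_mul]

namespace UniformizerSystem

variable (S : UniformizerSystem F)

/-- Representatives of the residue field. -/
def residueRep (i : Fin (residueCard F ^ 1)) : F := S.rep 1 i / S.ϖ

theorem residueRep_le (i : Fin (residueCard F ^ 1)) : valuation F (S.residueRep i) ≤ 1 := by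
  rw [residueRep, map_div₀]
  exact div_le_one_of_le₀ (S.le_of_lt_one _ (S.rep_lt 1 i)) zero_le

/-- Dividing representatives of `𝔭 / 𝔭 ^ 2` by `ϖ` yields representatives of the residue field,
whence the index set with exponent `1`. -/
theorem sub_residueRep_lt_iff (a : F) (i : Fin (residueCard F ^ 1)) :
    valuation F (a - S.residueRep i) < 1 ↔
      valuation F (a * S.ϖ - S.rep 1 i) < valuation F S.ϖ ^ 1 := by
  have := S.ne_zero
  rw [show a * S.ϖ - S.rep 1 i = (a - S.residueRep i) * S.ϖ by rw [residueRep]; field_simp,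
    map_mul, pow_one]
  exact (mul_lt_iff_lt_one_left S.pos).symm

theorem existsUnique_residueRep {a : F} (ha : valuation F a ≤ 1) :
    ∃! i, valuation F (a - S.residueRep i) < 1 := by
  simp_rw [sub_residueRep_lt_iff]
  refine S.existsUnique_rep 1 _ ?_
  rw [map_mul]
  exact (mul_le_of_le_one_left' ha).trans_lt S.lt_one

/-- Representatives of the left cosets of the Iwahori subgroup in the maximal compact subgroup
other than the identity coset. -/
def bigCell (i : Fin (residueCard F ^ 1)) : GL (Fin 2) F := upperUni (S.residueRep i) * weylElt

theorem bigCell_eq (i : Fin (residueCard F ^ 1)) :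
    S.bigCell i = gl2 (S.residueRep i) 1 1 0 (by simp) := by
  apply gl2_ext <;> simp [bigCell, upperUni, weylElt, gl2_mul_apply]

theorem bigCell_inv (i : Fin (residueCard F ^ 1)) :
    (S.bigCell i)⁻¹ = gl2 0 1 1 (-S.residueRep i) (by simp) := by
  rw [inv_eq_iff_mul_eq_one, bigCell_eq]
  apply gl2_ext <;> simp [gl2_mul_apply]

/-- Representatives of the left cosets of the Iwahori subgroup in the maximal compact subgroup. -/
def integralCoset : Option (Fin (residueCard F ^ 1)) → GL (Fin 2) F
  | none => 1
  | some i => S.bigCell i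

theorem integralCoset_injective (i j : Option (Fin (residueCard F ^ 1)))
    (h : (S.integralCoset i)⁻¹ * S.integralCoset j ∈ iwahoriMulCenter F) : i = j := by
  rcases i with _ | i <;> rcases j with _ | j
  · rfl
  · have h1 := h.1
    simp [integralCoset, bigCell_eq] at h1
  · have h1 := (inv_mem h).1
    simp [integralCoset, bigCell_eq] at h1
  · rw [show S.integralCoset (some i) = S.bigCell i from rfl,
      show S.integralCoset (some j) = S.bigCell j from rfl, bigCell_inv, bigCell_eq] at h
    have h1 := h.1
    simp only [gl2_mul_apply, gl2_00, gl2_10, gl2_01, gl2_11] at h1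
    have h2 : valuation F (S.residueRep j - S.residueRep i) < 1 := by
      simpa [← sub_eq_add_neg] using h1
    rw [(S.existsUnique_residueRep (S.residueRep_le j)).unique (y₁ := j) (y₂ := i)
      (by rw [sub_self, map_zero]; exact zero_lt_one) h2]

/-- Bruhat decomposition over the residue field: if `|g 1 0| < 1` then `g` lies in `I`, otherwise
the residue of `g 0 0 / g 1 0` selects one of `q` cosets in the big cell. -/
theorem integralGL2ModCenter_eq : (integralGL2ModCenter F : Set (PGL2 F)) =
    ⋃ i, (fun x => (S.integralCoset i : PGL2 F)⁻¹ * x) ⁻¹' (iwahori F : Set (PGL2 F)) := by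
  have hc : ∀ i, S.integralCoset i ∈ integralGL2 F := by
    rintro (_ | i)
    · exact one_mem _
    · exact mul_mem (upperUni_mem_integralGL2 (S.residueRep_le i)) weylElt_mem_integralGL2
  ext x
  simp only [Set.mem_iUnion, Set.mem_preimage, SetLike.mem_coe]
  constructor
  · rintro ⟨g, hg, rfl⟩
    have hg' : ∀ i, (S.integralCoset i)⁻¹ * g ∈ integralGL2 F := fun i =>
      mul_mem (inv_mem (hc i)) hg
    obtain ⟨h1, h2⟩ := mem_integralGL2_iff.1 hg
    rcases lt_or_eq_of_le (h1 1 0) with h10 | h10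
    · exact ⟨none, mk_mem_iwahori.2 (mem_iwahoriMulCenter_of_integral
        (mem_integralGL2_iff.1 (hg' none)).1 (mem_integralGL2_iff.1 (hg' none)).2
        (by simpa [integralCoset] using h10))⟩
    · have hne : g 1 0 ≠ 0 := by
        intro h
        simp [h] at h10
      obtain ⟨i, hi, -⟩ := S.existsUnique_residueRep (a := g 0 0 / g 1 0)
        (by rw [map_div₀, h10, div_one]; exact h1 0 0)
      refine ⟨some i, mk_mem_iwahori.2 (mem_iwahoriMulCenter_of_integral
        (mem_integralGL2_iff.1 (hg' _)).1 (mem_integralGL2_iff.1 (hg' _)).2 ?_)⟩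
      rw [integralCoset, bigCell_inv, gl2_mul_apply]
      simp only [gl2_10, gl2_11, one_mul]
      rw [show g 0 0 + -S.residueRep i * g 1 0 = (g 0 0 / g 1 0 - S.residueRep i) * g 1 0 by
        field_simp; ring, map_mul, h10, mul_one]
      exact hi
  · rintro ⟨i, hi⟩
    have h1 := mul_mem (show (S.integralCoset i : PGL2 F) ∈ integralGL2ModCenter F from
      ⟨_, hc i, rfl⟩) (iwahori_le_integralGL2ModCenter hi)
    rwa [mul_inv_cancel_left] at h1

end UniformizerSystem

end PGL2

section Topology

variable {F : Type*} [Field F] [ValuativeRel F] [TopologicalSpace F] [IsNonarchimedeanLocalField F]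

theorem t2Space_of_isNonarchimedeanLocalField (F : Type*) [Field F] [ValuativeRel F]
    [TopologicalSpace F] [IsNonarchimedeanLocalField F] : T2Space F := by
  have : T1Space F := by
    refine IsTopologicalAddGroup.t1Space F ⟨?_⟩
    rw [isOpen_iff_mem_nhds]
    intro x hx
    have hx' : valuation F x ≠ 0 := by simpa using hx
    filter_upwards [Valuation.locally_const (valuation F) hx'] with y hy h0
    rw [Set.mem_singleton_iff] at h0
    rw [h0, map_zero] at hy
    exact hx' hy.symm
  infer_instance

instance locallyCompactSpace_gl2 : LocallyCompactSpace (GL (Fin 2) F) := by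
  have := t2Space_of_isNonarchimedeanLocalField F
  have : LocallyCompactSpace (Matrix (Fin 2) (Fin 2) F) :=
    inferInstanceAs (LocallyCompactSpace (Fin 2 → Fin 2 → F))
  have : T2Space (Matrix (Fin 2) (Fin 2) F) :=
    inferInstanceAs (T2Space (Fin 2 → Fin 2 → F))
  exact inferInstanceAs (LocallyCompactSpace (Matrix (Fin 2) (Fin 2) F)ˣ)

theorem isOpen_iwahori : IsOpen (iwahori F : Set (PGL2 F)) :=
  QuotientGroup.isOpenMap_coe _ isOpen_iwahoriMulCenter

theorem isOpen_integralGL2ModCenter : IsOpen (integralGL2ModCenter F : Set (PGL2 F)) :=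
  Subgroup.isOpen_mono iwahori_le_integralGL2ModCenter isOpen_iwahori

end Topology

/-! ### The decomposition of `PGL2` and the integral of the squared coefficient -/

namespace UniformizerSystem

section Levels

variable {F : Type*} [Field F] [ValuativeRel F] (S : UniformizerSystem F)

/-- The image of `flip` in `PGL2`. -/
def flipP : PGL2 F := (S.flip : PGL2 F)

theorem flipP_mul_self : S.flipP * S.flipP = 1 := by
  rw [flipP, ← QuotientGroup.mk_mul, flip_mul_flip]
  exact (QuotientGroup.eq_one_iff _).2 (scalarGL2_mem_center _ _)

theorem flipP_mul_cancel (x : PGL2 F) : S.flipP * (S.flipP * x) = x := by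
  rw [← mul_assoc, flipP_mul_self, one_mul]

theorem mul_flipP_cancel (x : PGL2 F) : x * S.flipP * S.flipP = x := by
  rw [mul_assoc, flipP_mul_self, mul_one]

/-- The image of `level n` in `PGL2`. -/
def levelP (n : ℕ) : Set (PGL2 F) :=
  ⋃ i, (fun x => (S.coset n i : PGL2 F)⁻¹ * x) ⁻¹' (iwahori F : Set (PGL2 F))

theorem mk_mem_levelP {n : ℕ} {g : GL (Fin 2) F} : (g : PGL2 F) ∈ S.levelP n ↔ g ∈ S.level n := by
  have key : ∀ i, (S.coset n i : PGL2 F)⁻¹ * g ∈ iwahori F ↔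
      (S.coset n i)⁻¹ * g ∈ iwahoriMulCenter F := fun i => by
    rw [← mk_mem_iwahori]; rfl
  simp only [levelP, Set.mem_iUnion, Set.mem_preimage, SetLike.mem_coe, key]
  refine ⟨fun ⟨i, hi⟩ => ?_, fun h => S.exists_coset_inv_mul_mem h⟩
  simpa using S.coset_mul_mem_level hi n i

/-- The image of `levels` in `PGL2`. -/
def levelsP : Set (PGL2 F) := ⋃ n, S.levelP n

theorem mk_mem_levelsP {g : GL (Fin 2) F} : (g : PGL2 F) ∈ S.levelsP ↔ g ∈ levels := by
  simp only [levelsP, Set.mem_iUnion, mk_mem_levelP, ← mem_levels_iff]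

/-- The image of `flipLevel n` in `PGL2`. -/
def flipLevelP (n : ℕ) : Set (PGL2 F) :=
  {x | x ∈ S.levelP n ∨ S.flipP * x ∈ S.levelP n ∨ x * S.flipP ∈ S.levelP n ∨
    S.flipP * x * S.flipP ∈ S.levelP n}

theorem mk_mem_flipLevelP {n : ℕ} {g : GL (Fin 2) F} :
    (g : PGL2 F) ∈ S.flipLevelP n ↔ g ∈ S.flipLevel n := by
  simp only [flipLevelP, flipLevel, Set.mem_ofPred_eq, ← mk_mem_levelP]
  rfl

theorem exists_mem_flipLevelP (x : PGL2 F) : ∃ n, x ∈ S.flipLevelP n := by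
  obtain ⟨g, rfl⟩ := QuotientGroup.mk_surjective x
  simpa only [mk_mem_flipLevelP] using S.exists_mem_flipLevel g

theorem flipP_mul_mem_flipLevelP {n : ℕ} {x : PGL2 F} (h : x ∈ S.flipLevelP n) :
    S.flipP * x ∈ S.flipLevelP n := by
  simp only [flipLevelP, Set.mem_ofPred_eq, flipP_mul_cancel] at h ⊢
  tauto

theorem mul_flipP_mem_flipLevelP {n : ℕ} {x : PGL2 F} (h : x ∈ S.flipLevelP n) :
    x * S.flipP ∈ S.flipLevelP n := by
  simp only [flipLevelP, Set.mem_ofPred_eq, mul_flipP_cancel, ← mul_assoc] at h ⊢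
  tauto

theorem levelP_subset_flipLevelP (n : ℕ) : S.levelP n ⊆ S.flipLevelP n := fun _ h => Or.inl h

theorem iwahori_subset_levelP_zero : (iwahori F : Set (PGL2 F)) ⊆ S.levelP 0 := by
  intro x hx
  obtain ⟨g, rfl⟩ := QuotientGroup.mk_surjective x
  rw [mk_mem_levelP]
  have h1 := (mk_mem_iwahori.1 hx)
  refine ⟨?_, ?_, ?_, ?_⟩
  · rw [h1.2.2]; exact h1.2.1
  · rw [h1.2.2]; exact h1.1
  · rw [h1.2.2]
  · have p : 0 < valuation F (g 1 1) := zero_le.trans_lt h1.1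
    rw [pow_zero, one_mul, gl2det, Valuation.map_sub_eq_of_lt_left, map_mul, h1.2.2, sq]
    rw [map_mul, map_mul, h1.2.2]
    exact mul_lt_mul' h1.2.1 h1.1 zero_le p

theorem pairwise_disjoint_levelP : Pairwise (Function.onFun Disjoint S.levelP) := by
  intro n m hnm
  refine Set.disjoint_left.2 fun x hx hx' => hnm ?_
  obtain ⟨g, rfl⟩ := QuotientGroup.mk_surjective x
  exact S.eq_of_mem_level (S.mk_mem_levelP.1 hx) (S.mk_mem_levelP.1 hx')

theorem flipP_mul_notMem_levelsP {x : PGL2 F} (hx : x ∈ S.levelsP) : S.flipP * x ∉ S.levelsP := by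
  obtain ⟨g, rfl⟩ := QuotientGroup.mk_surjective x
  exact fun h => S.flip_mul_notMem_levels (S.mk_mem_levelsP.1 hx) (S.mk_mem_levelsP.1 h)

theorem mul_flipP_notMem_levelsP {x : PGL2 F} (hx : x ∈ S.levelsP) : x * S.flipP ∉ S.levelsP := by
  obtain ⟨g, rfl⟩ := QuotientGroup.mk_surjective x
  exact fun h => S.mul_flip_notMem_levels (S.mk_mem_levelsP.1 hx) (S.mk_mem_levelsP.1 h)

theorem mem_levelsP_cases (x : PGL2 F) : x ∈ S.levelsP ∨ S.flipP * x ∈ S.levelsP ∨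
    x * S.flipP ∈ S.levelsP ∨ S.flipP * x * S.flipP ∈ S.levelsP := by
  obtain ⟨g, rfl⟩ := QuotientGroup.mk_surjective x
  have h := S.mem_levels_cases g
  simp only [← S.mk_mem_levelsP] at h
  exact h

theorem mem_iwahori_of_mem_levelsP {x : PGL2 F} (hx : x ∈ S.levelsP)
    (h : S.flipP * x * S.flipP ∈ S.levelsP) : x ∈ iwahori F := by
  obtain ⟨g, rfl⟩ := QuotientGroup.mk_surjective x
  exact mk_mem_iwahori.2 (S.mem_iwahori_of_mem_levels (S.mk_mem_levelsP.1 hx)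
    (S.mk_mem_levelsP.1 h))

theorem flipP_mul_mul_flipP_mem_iwahori {x : PGL2 F} (hx : x ∈ iwahori F) :
    S.flipP * x * S.flipP ∈ iwahori F := by
  obtain ⟨g, rfl⟩ := QuotientGroup.mk_surjective x
  exact mk_mem_iwahori.2 (S.flip_mul_mul_flip_mem (mk_mem_iwahori.1 hx))

theorem diag_succ (n : ℕ) : S.diag (n + 1) = S.diag n * (S.flip * weylElt) := by
  apply gl2_ext <;> simp [gl2_mul_apply, diag, flip, weylElt, pow_succ]

theorem lowerUni_rep_mem (n : ℕ) (i : Fin (residueCard F ^ n)) :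
    lowerUni (S.rep n i) ∈ iwahoriMulCenter F := by
  refine ⟨?_, ?_, ?_⟩ <;> simp [lowerUni, S.rep_lt n i]

/-- A subgroup of `PGL2` which contains the maximal compact subgroup and `flip` is everything. -/
theorem eq_top_of_integral_le_of_flipP_mem {H : Subgroup (PGL2 F)}
    (hK : integralGL2ModCenter F ≤ H) (hs : S.flipP ∈ H) : H = ⊤ := by
  have hw : ((weylElt : GL (Fin 2) F) : PGL2 F) ∈ H := hK ⟨_, weylElt_mem_integralGL2, rfl⟩
  have hJ : iwahori F ≤ H := iwahori_le_integralGL2ModCenter.trans hK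
  -- `diag(1, ϖ)` is the product of `flip` with the Weyl element of `K`.
  have hdiag : ∀ n, ((S.diag n : GL (Fin 2) F) : PGL2 F) ∈ H := by
    intro n
    induction n with
    | zero =>
      have : S.diag 0 = 1 := by apply gl2_ext <;> simp [diag]
      rw [this]
      exact one_mem H
    | succ n ih =>
      rw [diag_succ]
      exact mul_mem ih (mul_mem hs hw)
  have hT : ∀ x ∈ S.levelsP, x ∈ H := by
    intro x hx
    obtain ⟨n, hx⟩ := Set.mem_iUnion.1 hx
    obtain ⟨i, hi⟩ := Set.mem_iUnion.1 hx
    have hc : ((S.coset n i : GL (Fin 2) F) : PGL2 F) ∈ H :=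
      mul_mem (hJ (mk_mem_iwahori.2 (S.lowerUni_rep_mem n i))) (hdiag n)
    simpa using mul_mem hc (hJ hi)
  refine eq_top_iff.2 fun x _ => ?_
  rcases S.mem_levelsP_cases x with h | h | h | h
  · exact hT _ h
  · exact (Subgroup.mul_mem_cancel_left H hs).1 (hT _ h)
  · exact (Subgroup.mul_mem_cancel_right H hs).1 (hT _ h)
  · exact (Subgroup.mul_mem_cancel_left H hs).1 ((Subgroup.mul_mem_cancel_right H hs).1 (hT _ h))

end Levels

section Measure

theorem isOpen_levelP {F : Type*} [Field F] [ValuativeRel F] [TopologicalSpace F]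
    [IsNonarchimedeanLocalField F] (S : UniformizerSystem F) (n : ℕ) : IsOpen (S.levelP n) :=
  isOpen_iUnion fun _ => isOpen_iwahori.preimage (continuous_const_mul _)

open Measure

variable {F : Type*} [Field F] [ValuativeRel F] [TopologicalSpace F] [IsNonarchimedeanLocalField F]
  [MeasurableSpace (PGL2 F)] [BorelSpace (PGL2 F)] (μ : Measure (PGL2 F))

theorem measure_levelP (S : UniformizerSystem F) [μ.IsMulLeftInvariant] (n : ℕ) :
    μ (S.levelP n) = (residueCard F : ENNReal) ^ n * μ (iwahori F) := by
  rw [levelP, measure_iUnion_leftCosets μ isOpen_iwahori (fun i => (S.coset n i : PGL2 F)),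
    Fintype.card_fin, Nat.cast_pow]
  exact fun i j h => S.coset_injective (mk_mem_iwahori.1 h)

theorem measure_integralGL2ModCenter (S : UniformizerSystem F) [μ.IsMulLeftInvariant] :
    μ (integralGL2ModCenter F) = (residueCard F + 1 : ENNReal) * μ (iwahori F) := by
  rw [S.integralGL2ModCenter_eq, measure_iUnion_leftCosets μ isOpen_iwahori
    (fun i => (S.integralCoset i : PGL2 F))]
  · simp
  · exact fun i j h => S.integralCoset_injective i j (mk_mem_iwahori.1 h)

/-- The kernel contains `K`, which is open of finite measure, and also `flipP`: its value is
nonnegative with square `1`. Together they generate. -/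
theorem modularCharacterFun_eq_one (S : UniformizerSystem F) [μ.IsHaarMeasure]
    (hK : μ (integralGL2ModCenter F) ≠ ⊤) (x : PGL2 F) : modularCharacterFun x = 1 := by
  have h := S.eq_top_of_integral_le_of_flipP_mem (H := (modularCharacter (G := PGL2 F)).ker)
    (fun y hy => modularCharacterFun_eq_one_of_mem_openSubgroup μ isOpen_integralGL2ModCenter hK hy)
    (by
      have h1 : modularCharacter S.flipP * modularCharacter S.flipP = 1 := by
        rw [← map_mul, flipP_mul_self, map_one]
      rw [MonoidHom.mem_ker]
      exact (pow_eq_one_iff_of_nonneg zero_le two_ne_zero).1 (by rwa [sq]))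
  exact (h ▸ Subgroup.mem_top x : x ∈ (modularCharacter (G := PGL2 F)).ker)

theorem isMulRightInvariant (S : UniformizerSystem F) [μ.IsHaarMeasure]
    (hK : μ (integralGL2ModCenter F) ≠ ⊤) : μ.IsMulRightInvariant := by
  have hJ : μ (iwahori F) ≠ ⊤ := ne_top_of_le_ne_top hK
    (measure_mono iwahori_le_integralGL2ModCenter)
  have hΔ := S.modularCharacterFun_eq_one μ hK
  have ho := S.isOpen_levelP
  have hfin : ∀ n, μ (S.levelP n) ≠ ⊤ := fun n => by
    rw [measure_levelP]
    exact ENNReal.mul_ne_top (by simp) hJ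
  have ho' : ∀ n, IsOpen ((fun x => x * S.flipP) ⁻¹' S.levelP n) := fun n =>
    (ho n).preimage (continuous_mul_const _)
  have hfin' : ∀ n, μ ((fun x => x * S.flipP) ⁻¹' S.levelP n) ≠ ⊤ := fun n => by
    rw [measure_preimage_mul_right_of_isOpen μ (hΔ _) (ho n)]
    exact hfin n
  have hB : ∀ n, S.flipLevelP n = S.levelP n ∪ ((fun x => S.flipP * x) ⁻¹' S.levelP n ∪
      ((fun x => x * S.flipP) ⁻¹' S.levelP n ∪
        (fun x => S.flipP * x) ⁻¹' ((fun x => x * S.flipP) ⁻¹' S.levelP n))) := fun n => rfl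
  refine isMulRightInvariant_of_modularCharacterFun μ hΔ S.flipLevelP ?_ ?_ ?_
  · intro n
    rw [hB]
    exact (ho n).union (((ho n).preimage (continuous_const_mul _)).union
      ((ho' n).union ((ho' n).preimage (continuous_const_mul _))))
  · intro n
    rw [hB]
    refine measure_union_ne_top (hfin n) (measure_union_ne_top ?_ (measure_union_ne_top (hfin' n) ?_))
    · rw [measure_preimage_mul]
      exact hfin n
    · rw [measure_preimage_mul]
      exact hfin' n
  · exact Set.eq_univ_of_forall fun x => Set.mem_iUnion.2 (S.exists_mem_flipLevelP x)

/-- The value `q ^ (-2n)` on a set of measure `q ^ n μ(I)` contributes `q ^ (-n) μ(I)`: a geometric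
series. -/
theorem lintegral_levelsP (S : UniformizerSystem F) [μ.IsMulLeftInvariant] {Φ : PGL2 F → ENNReal}
    (h : ∀ n, ∀ x ∈ S.flipLevelP n, Φ x = ((residueCard F : ENNReal) ^ n)⁻¹ ^ 2) :
    ∫⁻ x in S.levelsP, Φ x ∂μ = (1 - (residueCard F : ENNReal)⁻¹)⁻¹ * μ (iwahori F) := by
  have hm : ∀ n, MeasurableSet (S.levelP n) := fun n => (S.isOpen_levelP n).measurableSet
  have hq : (residueCard F : ENNReal) ≠ 0 := by
    have := one_lt_residueCard F
    simp; lia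
  rw [levelsP, lintegral_iUnion hm S.pairwise_disjoint_levelP, ← ENNReal.tsum_geometric,
    ← ENNReal.tsum_mul_right]
  refine tsum_congr fun n => ?_
  rw [setLIntegral_congr_fun (hm n) (fun x hx => h n x (S.levelP_subset_flipLevelP n hx)),
    setLIntegral_const, measure_levelP, ← mul_assoc]
  congr 1
  rw [sq, mul_assoc, ENNReal.inv_mul_cancel (pow_ne_zero n hq) (by simp), mul_one, ENNReal.inv_pow]

/-- The integral of a function on `PGL2` which is constant on the sets `flipLevelP n`. -/
theorem lintegral_add_eq_of_flipLevelP (S : UniformizerSystem F) [μ.IsMulLeftInvariant] [μ.IsMulRightInvariant]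
    {Φ : PGL2 F → ENNReal} (hΦ : Measurable Φ)
    (h : ∀ n, ∀ x ∈ S.flipLevelP n, Φ x = ((residueCard F : ENNReal) ^ n)⁻¹ ^ 2) :
    ∫⁻ x, Φ x ∂μ + 2 * μ (iwahori F) =
      4 * ((1 - (residueCard F : ENNReal)⁻¹)⁻¹ * μ (iwahori F)) := by
  set τ := (1 - (residueCard F : ENNReal)⁻¹)⁻¹ * μ (iwahori F)
  have hl : ∀ x, Φ (S.flipP * x) = Φ x := fun x => by
    obtain ⟨n, hn⟩ := S.exists_mem_flipLevelP x
    rw [h n x hn, h n _ (S.flipP_mul_mem_flipLevelP hn)]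
  have hr : ∀ x, Φ (x * S.flipP) = Φ x := fun x => by
    obtain ⟨n, hn⟩ := S.exists_mem_flipLevelP x
    rw [h n x hn, h n _ (S.mul_flipP_mem_flipLevelP hn)]
  -- `Φ` is unchanged by `flipP` on either side, so the measure `Φ μ` is too, and the four
  -- translates of `levelsP` have the same `ν`-measure `τ`.
  set ν := μ.withDensity Φ
  have hνl : ∀ A, MeasurableSet A → ν ((fun x => S.flipP * x) ⁻¹' A) = ν A := fun A hA => by
    rw [withDensity_apply _ hA, withDensity_apply _ (measurable_const_mul _ hA),
      ← (measurePreserving_mul_left μ S.flipP).setLIntegral_comp_preimage hA hΦ]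
    simp only [hl]
  have hνr : ∀ A, MeasurableSet A → ν ((fun x => x * S.flipP) ⁻¹' A) = ν A := fun A hA => by
    rw [withDensity_apply _ hA, withDensity_apply _ (measurable_mul_const _ hA),
      ← (measurePreserving_mul_right μ S.flipP).setLIntegral_comp_preimage hA hΦ]
    simp only [hr]
  have hT : MeasurableSet S.levelsP := MeasurableSet.iUnion fun n => (S.isOpen_levelP n).measurableSet
  have hTr : MeasurableSet ((fun x => x * S.flipP) ⁻¹' S.levelsP) := measurable_mul_const _ hT
  set T' : Set (PGL2 F) := (fun x => S.flipP * x) ⁻¹' ((fun x => x * S.flipP) ⁻¹' S.levelsP)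
  have hT' : MeasurableSet T' := measurable_const_mul _ hTr
  have hτ : ν S.levelsP = τ := by
    rw [withDensity_apply _ hT, S.lintegral_levelsP μ h]
  have hτ' : ν T' = τ := by rw [hνl _ hTr, hνr _ hT, hτ]
  have hJT : ∀ x ∈ iwahori F, x ∈ S.levelsP := fun x hx =>
    Set.mem_iUnion.2 ⟨0, S.iwahori_subset_levelP_zero hx⟩
  have hinter : S.levelsP ∩ T' = (iwahori F : Set (PGL2 F)) := by
    ext x
    exact ⟨fun hx => S.mem_iwahori_of_mem_levelsP hx.1 hx.2,
      fun hx => ⟨hJT x hx, hJT _ (S.flipP_mul_mul_flipP_mem_iwahori hx)⟩⟩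
  have hνJ : ν (iwahori F) = μ (iwahori F) := by
    rw [withDensity_apply _ isOpen_iwahori.measurableSet,
      setLIntegral_congr_fun (g := fun _ => 1) isOpen_iwahori.measurableSet, setLIntegral_one]
    intro x hx
    rw [h 0 x (Or.inl (S.iwahori_subset_levelP_zero hx))]
    simp
  have h1 := measure_union_add_inter (μ := ν) S.levelsP hT'
  rw [hinter, hνJ, hτ, hτ'] at h1
  -- With `T = levelsP` and `s = flipP`, `E = T ∪ sTs` and its left translate by `s` partition the
  -- group, and `ν(E) + μ(I) = 2 τ` by inclusion-exclusion.
  set E := S.levelsP ∪ T'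
  have hE : MeasurableSet E := hT.union hT'
  have hdisj : Disjoint E ((fun x => S.flipP * x) ⁻¹' E) := by
    refine Set.disjoint_left.2 ?_
    rintro x (hx | hx) (hx' | hx')
    · exact S.flipP_mul_notMem_levelsP hx hx'
    · refine S.mul_flipP_notMem_levelsP hx ?_
      simpa [T', flipP_mul_cancel] using hx'
    · exact S.mul_flipP_notMem_levelsP hx' hx
    · have h3 : x * S.flipP ∈ S.levelsP := by simpa [T', flipP_mul_cancel] using hx'
      refine S.flipP_mul_notMem_levelsP h3 ?_
      rw [← mul_assoc]
      exact hx
  have hcov : E ∪ ((fun x => S.flipP * x) ⁻¹' E) = Set.univ := by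
    refine Set.eq_univ_of_forall fun x => ?_
    rcases S.mem_levelsP_cases x with h | h | h | h
    · exact Or.inl (Or.inl h)
    · exact Or.inr (Or.inl h)
    · refine Or.inr (Or.inr ?_)
      simpa [T', flipP_mul_cancel] using h
    · exact Or.inl (Or.inr h)
  have h2 : ν Set.univ = ν E + ν E := by
    rw [← hcov, measure_union hdisj (measurable_const_mul _ hE), hνl E hE]
  rw [← setLIntegral_univ, ← withDensity_apply _ MeasurableSet.univ, h2]
  calc ν E + ν E + 2 * μ (iwahori F) = 2 * (ν E + μ (iwahori F)) := by ring
    _ = 4 * τ := by rw [h1]; ring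

theorem lintegral_eq_one_of_flipLevelP (S : UniformizerSystem F) [μ.IsMulLeftInvariant] [μ.IsMulRightInvariant]
    (hμ : μ (integralGL2ModCenter F) = ENNReal.ofReal (((residueCard F : ℝ) - 1) / 2))
    {Φ : PGL2 F → ENNReal} (hΦ : Measurable Φ)
    (h : ∀ n, ∀ x ∈ S.flipLevelP n, Φ x = ((residueCard F : ENNReal) ^ n)⁻¹ ^ 2) :
    ∫⁻ x, Φ x ∂μ = 1 := by
  have h1 := S.lintegral_add_eq_of_flipLevelP μ hΦ h
  have hK := S.measure_integralGL2ModCenter μ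
  rw [hμ] at hK
  have hq : (1 : ℝ) < residueCard F := by exact_mod_cast one_lt_residueCard F
  set q : ℝ := (residueCard F : ℝ)
  have hqe : (residueCard F : ENNReal) = ENNReal.ofReal q := by simp [q]
  -- `K` modulo the centre consists of `q + 1` cosets of `I`.
  have hJ : μ (iwahori F) = ENNReal.ofReal ((q - 1) / 2 / (q + 1)) := by
    rw [ENNReal.ofReal_div_of_pos (by linarith), hK, hqe, ENNReal.ofReal_add (by linarith) one_pos.le,
      ENNReal.ofReal_one]
    exact (ENNReal.eq_div_iff (by simp) (by simp)).2 rfl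
  have hτ : (1 - (residueCard F : ENNReal)⁻¹)⁻¹ = ENNReal.ofReal (q / (q - 1)) := by
    rw [hqe, ← ENNReal.ofReal_inv_of_pos (by linarith), ← ENNReal.ofReal_one,
      ← ENNReal.ofReal_sub _ (by positivity), ← ENNReal.ofReal_inv_of_pos]
    · congr 1
      have : q - 1 ≠ 0 := by linarith
      field_simp
    · rw [sub_pos]
      exact inv_lt_one_of_one_lt₀ hq
  -- The normalization of the measure enters here: `4 τ = 1 + 2 μ(I)` holds for this value of
  -- `μ(I)`.
  rw [hJ, hτ, ← ENNReal.ofReal_mul (by apply div_nonneg <;> linarith),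
    show (2 : ENNReal) = ENNReal.ofReal 2 by simp, show (4 : ENNReal) = ENNReal.ofReal 4 by simp,
    ← ENNReal.ofReal_mul (by norm_num), ← ENNReal.ofReal_mul (by norm_num),
    show 4 * (q / (q - 1) * ((q - 1) / 2 / (q + 1))) = 1 + 2 * ((q - 1) / 2 / (q + 1)) by
      have : q - 1 ≠ 0 := by linarith
      field_simp
      ring, ENNReal.ofReal_add one_pos.le (by
        have : 0 < q - 1 := by linarith
        positivity), ENNReal.ofReal_one] at h1
  exact (ENNReal.add_left_inj ENNReal.ofReal_ne_top).1 h1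

end Measure

end UniformizerSystem

/-! ### Formal dimension of a completion -/

section FormalDimension

variable {F : Type*} [Field F] [ValuativeRel F] [TopologicalSpace F] [IsNonarchimedeanLocalField F]

/-- The values of an Iwahori-invariant functional on the translates of the Iwahori-fixed vector. -/
theorem UniformizerSystem.norm_apply_smoothSteinberg (S : UniformizerSystem F)
    (l : (smoothInd (GL (Fin 2) F) (upperTriangularGL2 F) ⧸
        constFunctions (GL (Fin 2) F) (upperTriangularGL2 F)) →ₗ[ℂ] ℂ)
    (hl : ∀ j ∈ iwahoriMulCenter F, ∀ v, l (smoothSteinberg F j v) = l v) {n : ℕ}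
    {h : GL (Fin 2) F} (hh : h ∈ S.flipLevel n) :
    ‖l (smoothSteinberg F h (iwahoriVector F))‖ =
      ((residueCard F : ℝ) ^ n)⁻¹ * ‖l (iwahoriVector F)‖ := by
  obtain ⟨k, hk, ε, hε, he⟩ := S.iwahoriVector_eq_sum_of_mem_flipLevel hh
  have hq : (residueCard F : ℝ) ≠ 0 := by
    have := one_lt_residueCard F
    exact_mod_cast (by lia : residueCard F ≠ 0)
  -- Invariance of `l` makes the `q ^ n` terms of the sum formula equal.
  have h1 : l (iwahoriVector F) =
      ε * ((residueCard F : ℂ) ^ n * l (smoothSteinberg F h (iwahoriVector F))) := by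
    conv_lhs => rw [he]
    simp only [map_smul, map_sum, map_mul, Module.End.mul_apply, hl _ (hk _), Finset.sum_const,
      Finset.card_univ, Fintype.card_fin, nsmul_eq_mul, Nat.cast_pow, smul_eq_mul]
  have hε' : ‖ε‖ = 1 := by rcases hε with rfl | rfl <;> simp
  rw [h1, norm_mul, norm_mul, hε', one_mul, norm_pow, Complex.norm_natCast,
    inv_mul_cancel_left₀ (pow_ne_zero n hq)]

namespace UnitaryRep

variable {H : Type*} [NormedAddCommGroup H] [InnerProductSpace ℂ H] [CompleteSpace H]
  {π : UnitaryRep (GL (Fin 2) F) H}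

theorem inner_op_op {G : Type*} [Group G] [TopologicalSpace G] (π : UnitaryRep G H) (g : G) (x y : H) :
    inner ℂ (π.op g x) (π.op g y) = inner ℂ x y := by
  have h : (star (π.toHom g : H →L[ℂ] H)) * (π.toHom g : H →L[ℂ] H) = 1 :=
    Unitary.star_mul_self_of_mem (π.toHom g).2
  rw [op, ← ContinuousLinearMap.adjoint_inner_right, ← ContinuousLinearMap.star_eq_adjoint,
    ← mul_apply_eq_comp, h, one_apply_eq_self]

/-- The operators of a unitary representation, as a homomorphism. -/
def opHom {G : Type*} [Group G] [TopologicalSpace G] (π : UnitaryRep G H) : G →* (H →L[ℂ] H) :=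
  (unitary (H →L[ℂ] H)).subtype.comp π.toHom

theorem op_center_of_isCompletionOf (hπ : π.IsCompletionOf (smoothSteinberg F))
    {z : GL (Fin 2) F} (hz : z ∈ Subgroup.center (GL (Fin 2) F)) : π.opHom z = 1 := by
  obtain ⟨ι, -, hd, he⟩ := hπ
  refine DFunLike.coe_injective (hd.equalizer (π.opHom z).continuous continuous_id ?_)
  ext v
  exact (he z v).symm.trans (by rw [smoothSteinberg_center hz]; rfl)

/-- The representation of `PGL2` defined by a completion of the Steinberg representation. -/
def steinbergLift (hπ : π.IsCompletionOf (smoothSteinberg F)) : PGL2 F →* (H →L[ℂ] H) :=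
  QuotientGroup.lift _ π.opHom fun _ hz => op_center_of_isCompletionOf hπ hz

end UnitaryRep

variable [MeasurableSpace (PGL2 F)] [BorelSpace (PGL2 F)]

/-- Stated for any function with this decay because it serves twice: for the matrix coefficient of
`w`, and for the image of `w` in functions on `PGL2` in the existence proof. -/
theorem UniformizerSystem.lintegral_enorm_sq (S : UniformizerSystem F) (μ : Measure (PGL2 F))
    [μ.IsMulLeftInvariant] [μ.IsMulRightInvariant]
    (hμ : μ (integralGL2ModCenter F) = ENNReal.ofReal (((residueCard F : ℝ) - 1) / 2))
    {φ : PGL2 F → ℂ} (hφ : Continuous φ) {c : ℝ} (hc : c ≠ 0)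
    (h : ∀ n, ∀ g ∈ S.flipLevel n, ‖φ (g : PGL2 F)‖ = ((residueCard F : ℝ) ^ n)⁻¹ * c) :
    ∫⁻ x, ‖φ x‖ₑ ^ 2 ∂μ = ENNReal.ofReal (c ^ 2) := by
  have hq : (0 : ℝ) < residueCard F := by
    have := one_lt_residueCard F
    exact_mod_cast (by lia : 0 < residueCard F)
  have hc0 : 0 ≤ c := by
    obtain ⟨n, hn⟩ := S.exists_mem_flipLevel 1
    have h1 := h n 1 hn
    by_contra! hneg
    have : ((residueCard F : ℝ) ^ n)⁻¹ * c < 0 := mul_neg_of_pos_of_neg (by positivity) hneg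
    exact absurd (norm_nonneg (φ ((1 : GL (Fin 2) F) : PGL2 F))) (by rw [h1]; exact this.not_ge)
  have hm : Measurable fun x => ‖φ x‖ₑ ^ 2 := hφ.measurable.enorm.pow_const 2
  have hcc : ENNReal.ofReal (c ^ 2) ≠ 0 := by simpa using by positivity
  have h1 := S.lintegral_eq_one_of_flipLevelP μ hμ
    (Φ := fun x => (ENNReal.ofReal (c ^ 2))⁻¹ * ‖φ x‖ₑ ^ 2) (hm.const_mul _) ?_
  · rw [lintegral_const_mul _ hm] at h1
    rw [← one_mul (lintegral _ _), ← ENNReal.mul_inv_cancel hcc ENNReal.ofReal_ne_top, mul_assoc, h1,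
      mul_one]
  · intro n x hx
    obtain ⟨g, rfl⟩ := QuotientGroup.mk_surjective x
    rw [S.mk_mem_flipLevelP] at hx
    rw [← ofReal_norm, h n g hx, ENNReal.ofReal_mul (by positivity), mul_pow, ENNReal.ofReal_pow hc0,
      mul_left_comm, ENNReal.inv_mul_cancel, mul_one, ENNReal.ofReal_inv_of_pos (by positivity),
      ENNReal.ofReal_pow hq.le, ENNReal.ofReal_natCast]
    · rwa [← ENNReal.ofReal_pow hc0]
    · simp

theorem UnitaryRep.hasFormalDimension_one {H : Type*} [NormedAddCommGroup H]
    [InnerProductSpace ℂ H] [CompleteSpace H] {π : UnitaryRep (GL (Fin 2) F) H} (μ : Measure (PGL2 F)) [μ.IsHaarMeasure]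
    (hμ : μ (integralGL2ModCenter F) = ENNReal.ofReal (((residueCard F : ℝ) - 1) / 2))
    (hπ : π.IsCompletionOf (smoothSteinberg F)) :
    π.HasFormalDimension μ 1 := by
  obtain ⟨S⟩ := nonempty_uniformizerSystem F
  have : μ.IsMulRightInvariant := S.isMulRightInvariant μ (by rw [hμ]; exact ENNReal.ofReal_ne_top)
  set ρ := steinbergLift hπ
  have hρ : ∀ g : GL (Fin 2) F, ρ (g : PGL2 F) = π.op g := fun g => rfl
  obtain ⟨ι, hinj, hd, he⟩ := hπ
  set w := ι (iwahoriVector F)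
  have hw : w ≠ 0 := fun h => iwahoriVector_ne_zero (hinj (h.trans (map_zero ι).symm))
  have hw' : (inner ℂ w w : ℂ) ≠ 0 := by simpa using hw
  have hiso : ∀ x u v, inner ℂ (ρ x u) (ρ x v) = inner ℂ u v := by
    intro x u v
    obtain ⟨g, rfl⟩ := QuotientGroup.mk_surjective x
    exact π.inner_op_op g u v
  have hcont : ∀ u, Continuous fun x => ρ x u := fun u =>
    (QuotientGroup.isQuotientMap_mk _).continuous_iff.2 (π.continuous_apply u)
  have hcyc : Dense (Submodule.span ℂ (Set.range fun x => ρ x w) : Set H) := by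
    refine hd.mono ?_
    rintro _ ⟨v, rfl⟩
    have hv : ι v ∈ (Submodule.span ℂ
        (Set.range fun h => smoothSteinberg F h (iwahoriVector F))).map ι :=
      ⟨v, by rw [span_iwahoriVector]; trivial, rfl⟩
    rw [Submodule.map_span] at hv
    refine Submodule.span_mono ?_ hv
    rintro _ ⟨_, ⟨g, rfl⟩, rfl⟩
    exact ⟨g, (he g _).symm⟩
  have hfix : ∀ j ∈ iwahoriMulCenter F, π.op j w = w := fun j hj => by
    rw [← he, smoothSteinberg_iwahori hj]
  have hstar : ∀ h : PGL2 F, ∃ (ι : Type) (_ : Fintype ι) (c : ℂ) (k : ι → PGL2 F),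
      (∀ i, ρ (k i)⁻¹ w = w) ∧ w = c • ∑ i, ρ (k i * h) w := by
    intro x
    obtain ⟨h, rfl⟩ := QuotientGroup.mk_surjective x
    obtain ⟨n, hn⟩ := S.exists_mem_flipLevel h
    obtain ⟨k, hk, ε, -, hs⟩ := S.iwahoriVector_eq_sum_of_mem_flipLevel hn
    refine ⟨Fin (residueCard F ^ n), inferInstance, ε, fun i => (k i : PGL2 F),
      fun i => hfix _ (inv_mem (hk i)), ?_⟩
    have h2 := congrArg ι hs
    rw [map_smul, map_sum] at h2
    refine h2.trans ?_
    congr 1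
    exact Finset.sum_congr rfl fun i _ => he _ _
  have hφc : Continuous fun x => (inner ℂ w (ρ x w) : ℂ) := continuous_const.inner (hcont w)
  have hval : ∀ n, ∀ g ∈ S.flipLevel n, ‖(inner ℂ w (ρ (g : PGL2 F) w) : ℂ)‖ =
      ((residueCard F : ℝ) ^ n)⁻¹ * ‖(inner ℂ w w : ℂ)‖ := by
    intro n g hg
    -- The functional `inner w` is Iwahori-invariant, since the operators are unitary and `w` is
    -- fixed.
    have h := S.norm_apply_smoothSteinberg ((innerSL ℂ w).toLinearMap ∘ₗ ι) (fun j hj v => by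
      change inner ℂ w (ι _) = inner ℂ w (ι v)
      rw [he, ← π.inner_op_op j w (ι v), hfix j hj]) hg
    simp only [LinearMap.comp_apply, he] at h
    exact h
  have hint := S.lintegral_enorm_sq μ hμ hφc (norm_ne_zero_iff.2 hw') hval
  have hL : MemLp (fun x => (inner ℂ w (ρ x w) : ℂ)) 2 μ := by
    refine ⟨hφc.aestronglyMeasurable, ?_⟩
    rw [eLpNorm_lt_top_iff_lintegral_rpow_enorm_lt_top (by simp) (by simp)]
    simp only [ENNReal.toReal_ofNat, ENNReal.rpow_ofNat, hint]
    exact ENNReal.ofReal_lt_top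
  have hnorm : ∫ x, inner ℂ w (ρ x w) * starRingEnd ℂ (inner ℂ w (ρ x w)) ∂μ =
      inner ℂ w w * inner ℂ w w := by
    have h1 : ∀ x, (inner ℂ w (ρ x w) : ℂ) * starRingEnd ℂ (inner ℂ w (ρ x w)) =
        ((‖(inner ℂ w (ρ x w) : ℂ)‖ ^ 2 : ℝ) : ℂ) := fun x => by
      rw [Complex.mul_conj, Complex.normSq_eq_norm_sq]
    simp_rw [h1]
    rw [integral_complex_ofReal, integral_eq_lintegral_of_nonneg_ae
      (f := fun x => ‖(inner ℂ w (ρ x w) : ℂ)‖ ^ 2)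
      (Filter.Eventually.of_forall fun x => sq_nonneg _) (hφc.norm.pow 2).aestronglyMeasurable]
    simp_rw [ENNReal.ofReal_pow (norm_nonneg _), ofReal_norm, hint]
    rw [ENNReal.toReal_ofReal (by positivity), ← sq, inner_self_eq_norm_sq_to_K]
    simp
  have schur := schur_orthogonality (μ := μ) ρ hiso hcont hw hcyc hstar hL
  have hmem : ∀ u v, MemLp (fun x => (inner ℂ v (ρ x u) : ℂ)) 2 μ := fun u v => (schur u v u v).1
  have orth : ∀ u v u' v', ∫ x, inner ℂ v (ρ x u) * starRingEnd ℂ (inner ℂ v' (ρ x u')) ∂μ =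
      inner ℂ u' u * starRingEnd ℂ (inner ℂ v' v) := by
    intro u v u' v'
    have h := (schur u v u' v').2
    rw [hnorm] at h
    exact mul_right_cancel₀ (mul_ne_zero hw' hw') h
  refine ⟨⟨⟨⟨w, 0, hw⟩, ?_⟩, ?_⟩, one_pos, ?_⟩
  -- If `W` were proper and nonzero, nonzero `a ∈ W` and `b ∈ Wᗮ` would have vanishing matrix
  -- coefficient, against `∫ |(π(g) a, b)|² = ‖a‖² ‖b‖²`.
  · intro W hW hinv
    by_contra! hne
    obtain ⟨a, ha, ha0⟩ := W.ne_bot_iff.1 hne.1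
    have : CompleteSpace W := hW.completeSpace_coe
    obtain ⟨b, hb, hb0⟩ := Wᗮ.ne_bot_iff.1 fun h => hne.2 (W.orthogonal_eq_bot_iff.1 h)
    have h := orth a b a b
    have hz : ∀ x, (inner ℂ b (ρ x a) : ℂ) = 0 := by
      intro x
      obtain ⟨g, rfl⟩ := QuotientGroup.mk_surjective x
      exact Submodule.inner_left_of_mem_orthogonal (hinv g a ha) hb
    simp [hz, ha0, hb0] at h
  · exact fun u v => ⟨fun x => ‖(inner ℂ v (ρ x u) : ℂ)‖, fun g => rfl, (hmem u v).norm⟩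
  · intro u v u' v'
    refine ⟨fun x => inner ℂ v (ρ x u) * starRingEnd ℂ (inner ℂ v' (ρ x u')), fun g => rfl, ?_, ?_⟩
    · exact (hmem u v).integrable_mul (hmem u' v').star
    · rw [orth]
      simp

end FormalDimension

/-! ### Unitary completions from intertwiners into a Hilbert space -/

section Completion

variable {G : Type*} [Group G] [TopologicalSpace G] {V : Type*} [AddCommGroup V] [Module ℂ V]
  {E : Type u} [NormedAddCommGroup E] [InnerProductSpace ℂ E] [CompleteSpace E]

/-- An injective intertwiner into a Hilbert space on which `G` acts by isometries provides a
unitary completion. -/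
theorem exists_unitaryRep_isCompletionOf (σ : Representation ℂ G V) (R : G → E →ₗᵢ[ℂ] E)
    (A : V →ₗ[ℂ] E) (hA : Function.Injective A) (hR : ∀ g v, R g (A v) = A (σ g v))
    (hc : ∀ v, Continuous fun g => A (σ g v)) :
    ∃ (H : Type u) (_ : NormedAddCommGroup H) (_ : InnerProductSpace ℂ H) (_ : CompleteSpace H)
      (π : UnitaryRep G H), π.IsCompletionOf σ := by
  -- `R` is not assumed multiplicative. The group law and unitarity hold on the closure because they
  -- can be checked on the dense image of `A`, where `R g` is given by `σ g`.
  let H := (LinearMap.range A).topologicalClosure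
  have hmaps : ∀ g, ∀ x ∈ H, R g x ∈ H := fun g x hx =>
    map_mem_closure (R g).continuous hx fun y ⟨v, hv⟩ => ⟨σ g v, by rw [← hv, hR]⟩
  let T : G → (H →L[ℂ] H) := fun g =>
    ((R g).toContinuousLinearMap.comp H.subtypeL).codRestrict H fun x => hmaps g x x.2
  have hT : ∀ g (x : H), ((T g x : H) : E) = R g x := fun g x => rfl
  let ι : V →ₗ[ℂ] H := A.codRestrict H fun v => Submodule.le_topologicalClosure _ ⟨v, rfl⟩
  have hι : ∀ v, (ι v : E) = A v := fun v => rfl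
  have hd : DenseRange ι := by
    intro x
    rw [closure_subtype]
    refine closure_mono ?_ x.2
    rintro _ ⟨v, rfl⟩
    exact ⟨ι v, ⟨v, rfl⟩, rfl⟩
  have hTι : ∀ g v, T g (ι v) = ι (σ g v) := fun g v => Subtype.ext (hR g v)
  have hmul : ∀ g h, T (g * h) = T g * T h := fun g h => by
    refine DFunLike.coe_injective (hd.equalizer (T _).continuous (T g * T h).continuous ?_)
    ext v : 1
    simp only [Function.comp_apply, mul_apply_eq_comp, hTι, map_mul, Module.End.mul_apply]
  have hone : T 1 = 1 := by
    refine DFunLike.coe_injective (hd.equalizer (T _).continuous continuous_id ?_)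
    ext v : 1
    simp [hTι]
  have hinner : ∀ g (x y : H), inner ℂ (T g x) (T g y) = inner ℂ x y := fun g x y =>
    (R g).inner_map_map x y
  have hadj : ∀ g, star (T g) = T g⁻¹ := fun g => by
    refine ContinuousLinearMap.ext fun x => ext_inner_right ℂ fun y => ?_
    rw [ContinuousLinearMap.star_eq_adjoint, ContinuousLinearMap.adjoint_inner_left,
      ← hinner g (T g⁻¹ x) y, ← mul_apply_eq_comp, ← hmul, mul_inv_cancel, hone, one_apply_eq_self]
  have hmem : ∀ g, T g ∈ unitary (H →L[ℂ] H) := fun g => by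
    rw [Unitary.mem_iff, hadj, ← hmul, ← hmul, inv_mul_cancel, mul_inv_cancel, hone]
    exact ⟨rfl, rfl⟩
  refine ⟨H, inferInstance, inferInstance, inferInstance,
    { toHom :=
        { toFun := fun g => ⟨T g, hmem g⟩
          map_one' := Subtype.ext hone
          map_mul' := fun g h => Subtype.ext (hmul g h) }
      continuous_apply := fun x => ?_ }, ι, fun v v' h => hA (congrArg Subtype.val h), hd,
    fun g v => (hTι g v).symm⟩
  -- Since the operators are isometries, every orbit map is a uniform limit of orbit maps of vectors
  -- in the image of `A`.
  refine continuous_of_uniform_approx_of_continuous fun s hs => ?_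
  obtain ⟨ε, hε, hs⟩ := Metric.mem_uniformity_dist.1 hs
  obtain ⟨v, hv⟩ := hd.exists_dist_lt x hε
  refine ⟨fun g => T g (ι v), ?_, fun g => hs ?_⟩
  · simp only [hTι]
    exact Continuous.subtype_mk (hc v) _
  · change dist (T g x) (T g (ι v)) < ε
    rw [Subtype.dist_eq, hT, hT, (R g).dist_map]
    exact hv

end Completion

/-! ### Functions on the projective line viewed on `PGL2` -/

section Descent

theorem continuous_of_forall_mul_right {G X : Type*} [Group G] [TopologicalSpace G] [ContinuousMul G]
    [TopologicalSpace X] {f : G → X} {U : Subgroup G} (hU : IsOpen (U : Set G))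
    (hf : ∀ u ∈ U, ∀ x, f (x * u) = f x) : Continuous f := by
  refine continuous_iff_continuousAt.2 fun x => ?_
  have hx : (fun y => x⁻¹ * y) ⁻¹' (U : Set G) ∈ nhds x :=
    (hU.preimage (continuous_const_mul _)).mem_nhds (by simp)
  refine (continuousAt_const (y := f x)).congr ?_
  filter_upwards [hx] with y hy
  simpa using (hf _ hy x).symm

/-- Left `B`-invariant functions hence do not distinguish the `q` big-cell representatives from
`flip`. -/
theorem UniformizerSystem.bigCell_eq_mul_flip {F : Type*} [Field F]
    [ValuativeRel F] (S : UniformizerSystem F)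
    (i : Fin (residueCard F ^ 1)) : ∃ b ∈ upperTriangularGL2 F, S.bigCell i = b * S.flip := by
  have := S.ne_zero
  refine ⟨gl2 1 (S.residueRep i / S.ϖ) 0 (1 / S.ϖ) (by simpa using this), rfl, ?_⟩
  rw [S.bigCell_eq]
  apply gl2_ext <;> simp [gl2_mul_apply, UniformizerSystem.flip, this]

section

variable {F : Type*} [Field F] [TopologicalSpace F]

/-- The function on `PGL2` defined by a function invariant under the upper-triangular subgroup. -/
def descend (f : smoothInd (GL (Fin 2) F) (upperTriangularGL2 F)) (x : PGL2 F) : ℂ :=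
  Quotient.liftOn' x f.1 fun a b h => by
    have hz : a⁻¹ * b ∈ Subgroup.center (GL (Fin 2) F) := QuotientGroup.leftRel_apply.1 h
    have e : b = (a⁻¹ * b) * a := by
      rw [← (Subgroup.mem_center_iff.1 hz a), mul_inv_cancel_left]
    rw [e]
    exact (f.2.1 _ (center_le_upperTriangular hz) a).symm

theorem descend_smoothIndRep [IsTopologicalRing F]
    (f : smoothInd (GL (Fin 2) F) (upperTriangularGL2 F)) (g : GL (Fin 2) F) (x : PGL2 F) :
    descend (smoothIndRep _ _ g f) x = descend f (x * g) := by
  obtain ⟨y, rfl⟩ := QuotientGroup.mk_surjective x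
  rfl

theorem descend_upper_mul (f : smoothInd (GL (Fin 2) F) (upperTriangularGL2 F))
    {b : GL (Fin 2) F} (hb : b ∈ upperTriangularGL2 F) (x : PGL2 F) :
    descend f (b * x) = descend f x := by
  obtain ⟨y, rfl⟩ := QuotientGroup.mk_surjective x
  exact f.2.1 b hb y

end

variable {F : Type*} [Field F] [ValuativeRel F] [TopologicalSpace F] [IsNonarchimedeanLocalField F]

theorem continuous_descend (f : smoothInd (GL (Fin 2) F) (upperTriangularGL2 F)) :
    Continuous (descend f) := by
  refine (QuotientGroup.isQuotientMap_mk _).continuous_iff.2 ?_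
  change Continuous (f : GL (Fin 2) F → ℂ)
  obtain ⟨f, hB, U, hU, hf⟩ := f
  exact continuous_of_forall_mul_right hU hf

/-- Boundedness follows from the spanning result: translates of the indicator are bounded, and
passing to the quotient changes a function only by a constant. -/
theorem exists_norm_le_of_smoothInd (f : smoothInd (GL (Fin 2) F) (upperTriangularGL2 F)) :
    ∃ C : ℝ, ∀ x, ‖(f : GL (Fin 2) F → ℂ) x‖ ≤ C := by
  have key : ∀ v ∈ Submodule.span ℂ
      (Set.range fun h => smoothSteinberg F h (iwahoriVector F)),
      ∃ f : smoothInd (GL (Fin 2) F) (upperTriangularGL2 F), Submodule.Quotient.mk f = v ∧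
        ∃ C : ℝ, ∀ x, ‖(f : GL (Fin 2) F → ℂ) x‖ ≤ C := by
    intro v hv
    induction hv using Submodule.span_induction with
    | mem v hv =>
      obtain ⟨h, rfl⟩ := hv
      refine ⟨smoothIndRep _ _ h (ballSmooth F), rfl, 1, fun x => ?_⟩
      classical
      change ‖ballInd F (x * h)‖ ≤ 1
      rw [ballInd_apply]
      split_ifs <;> simp
    | zero => exact ⟨0, rfl, 0, fun x => by simp⟩
    | add v w _ _ hv hw =>
      obtain ⟨f, rfl, C, hC⟩ := hv
      obtain ⟨g, rfl, D, hD⟩ := hw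
      exact ⟨f + g, rfl, C + D, fun x => (norm_add_le _ _).trans (add_le_add (hC x) (hD x))⟩
    | smul a v _ hv =>
      obtain ⟨f, rfl, C, hC⟩ := hv
      exact ⟨a • f, rfl, ‖a‖ * C, fun x => (norm_smul_le a _).trans (by gcongr; exact hC x)⟩
  obtain ⟨g, hg, C, hC⟩ := key (Submodule.Quotient.mk f) (by rw [span_iwahoriVector]; trivial)
  obtain ⟨c, hc⟩ := (mem_constFunctions_iff _).1 ((Submodule.Quotient.eq _).1 hg)
  refine ⟨C + ‖c‖, fun x => ?_⟩
  have h : (f : GL (Fin 2) F → ℂ) x = (g : GL (Fin 2) F → ℂ) x - c := by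
    rw [← hc x]
    simp
  rw [h]
  exact (norm_sub_le _ _).trans (by gcongr; exact hC x)

/-- With `y = diag(1, ϖ ^ N)⁻¹ g`, an Iwahori element is upper-triangular times `lowerUni c` with
`|c| < 1`; moving past the diagonal matrix contracts `c` to `c ϖ ^ N`, which for large `N` lies in
the group fixing `f` near `g`. So point values of `f` are recovered from Iwahori averages. -/
theorem UniformizerSystem.exists_descend_eq (S : UniformizerSystem F)
    (f : smoothInd (GL (Fin 2) F) (upperTriangularGL2 F)) (g : GL (Fin 2) F) :
    ∃ y : PGL2 F, ∀ x ∈ iwahori F, descend f (x * y) = (f : GL (Fin 2) F → ℂ) g := by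
  obtain ⟨f, hB, U, hU, hf⟩ := f
  have hU' : IsOpen (U.comap (MulAut.conj g⁻¹).toMonoidHom : Set (GL (Fin 2) F)) := by
    refine hU.preimage (?_ : Continuous fun x : GL (Fin 2) F => g⁻¹ * x * (g⁻¹)⁻¹)
    fun_prop
  obtain ⟨N, hN⟩ := S.exists_lowerUni_mem hU'
  refine ⟨((S.diag N)⁻¹ * g : GL (Fin 2) F), fun x hx => ?_⟩
  obtain ⟨j, rfl⟩ := QuotientGroup.mk_surjective x
  obtain ⟨h1, -, -⟩ := mk_mem_iwahori.1 hx
  have p : 0 < valuation F (j 1 1) := zero_le.trans_lt h1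
  have hne : j 1 1 ≠ 0 := by simpa [zero_lt_iff] using p
  set c := j 1 0 / j 1 1
  have hb : j * lowerUni (-c) ∈ upperTriangularGL2 F := by
    change (j * lowerUni (-c)) 1 0 = 0
    simp [gl2_mul_apply, lowerUni, c, mul_div_cancel₀ _ hne]
  have hd : S.diag N ∈ upperTriangularGL2 F := by
    change S.diag N 1 0 = 0
    simp [UniformizerSystem.diag]
  have hcomm : S.diag N * lowerUni c = lowerUni (c * S.ϖ ^ N) * S.diag N := by
    apply gl2_ext <;> simp [gl2_mul_apply, lowerUni, UniformizerSystem.diag, mul_comm]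
  have hl : g⁻¹ * lowerUni (c * S.ϖ ^ N) * g ∈ U := by
    have h := hN (c * S.ϖ ^ N) (by
      rw [map_mul, map_pow, map_div₀]
      exact mul_lt_of_lt_one_left (pow_pos S.pos N) ((div_lt_one₀ p).2 h1))
    simpa using h
  have e : j * ((S.diag N)⁻¹ * g) = (j * lowerUni (-c)) * (S.diag N)⁻¹ *
      (g * (g⁻¹ * lowerUni (c * S.ϖ ^ N) * g)) := by
    have h3 : lowerUni (-c) = (lowerUni c)⁻¹ := by
      rw [eq_inv_iff_mul_eq_one, lowerUni_mul]
      apply gl2_ext <;> simp [lowerUni]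
    rw [h3, eq_mul_inv_of_mul_eq hcomm.symm]
    group
  change f (j * ((S.diag N)⁻¹ * g)) = f g
  rw [e, hB _ (mul_mem hb (inv_mem hd)), hf _ hl]

end Descent

/-! ### Iwahori averages and the detection of constants -/

section Functional

variable {F : Type*} [Field F] [ValuativeRel F] [TopologicalSpace F] [IsNonarchimedeanLocalField F]
  [MeasurableSpace (PGL2 F)] (μ : Measure (PGL2 F))

/-- The integral over the Iwahori subgroup of a translate. -/
def iwahoriIntegral (f : smoothInd (GL (Fin 2) F) (upperTriangularGL2 F)) (y : PGL2 F) : ℂ :=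
  ∫ x in (iwahori F : Set (PGL2 F)), descend f (x * y) ∂μ

theorem iwahoriIntegral_smoothIndRep (f : smoothInd (GL (Fin 2) F) (upperTriangularGL2 F))
    (g : GL (Fin 2) F) (y : PGL2 F) :
    iwahoriIntegral μ (smoothIndRep _ _ g f) y = iwahoriIntegral μ f (y * g) := by
  simp only [iwahoriIntegral, descend_smoothIndRep, mul_assoc]

variable [BorelSpace (PGL2 F)]

theorem integrableOn_descend (f : smoothInd (GL (Fin 2) F) (upperTriangularGL2 F))
    {s : Set (PGL2 F)} (hs : μ s ≠ ⊤) (y : PGL2 F) :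
    IntegrableOn (fun x => descend f (x * y)) s μ := by
  obtain ⟨C, hC⟩ := exists_norm_le_of_smoothInd f
  have hc : Continuous fun x => descend f (x * y) :=
    (continuous_descend f).comp (continuous_mul_const y)
  refine ⟨hc.aestronglyMeasurable, ?_⟩
  have : IsFiniteMeasure (μ.restrict s) := ⟨by simpa using hs.lt_top⟩
  refine HasFiniteIntegral.of_bounded (C := C) (Filter.Eventually.of_forall fun x => ?_)
  obtain ⟨g, hg⟩ := QuotientGroup.mk_surjective (x * y)
  rw [← hg]
  exact hC g

theorem setIntegral_subgroup_mul_right {G : Type*} [Group G] [TopologicalSpace G]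
    [IsTopologicalGroup G] [MeasurableSpace G] [BorelSpace G] (ν : Measure G)
    [ν.IsMulRightInvariant] (J : Subgroup G) {j : G} (hj : j ∈ J) (f : G → ℂ) :
    ∫ x in (J : Set G), f (x * j) ∂ν = ∫ x in (J : Set G), f x ∂ν := by
  have h := (measurePreserving_mul_right ν j).setIntegral_preimage_emb
    (measurableEmbedding_mulRight j) f (J : Set G)
  rwa [show (fun x => x * j) ⁻¹' (J : Set G) = J from
    Set.ext fun x => Subgroup.mul_mem_cancel_right J hj] at h

theorem iwahoriIntegral_mul [μ.IsMulRightInvariant]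
    (f : smoothInd (GL (Fin 2) F) (upperTriangularGL2 F)) {j : PGL2 F} (hj : j ∈ iwahori F)
    (y : PGL2 F) : iwahoriIntegral μ f (j * y) = iwahoriIntegral μ f y := by
  have h := setIntegral_subgroup_mul_right μ (iwahori F) hj fun x => descend f (x * y)
  simpa only [mul_assoc, iwahoriIntegral] using h

theorem UniformizerSystem.setIntegral_iwahori_conj (S : UniformizerSystem F) [μ.IsMulLeftInvariant]
    [μ.IsMulRightInvariant] (f : PGL2 F → ℂ) :
    ∫ x in (iwahori F : Set (PGL2 F)), f (S.flipP * x * S.flipP) ∂μ =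
      ∫ x in (iwahori F : Set (PGL2 F)), f x ∂μ := by
  have h := ((measurePreserving_mul_right μ S.flipP).comp
    (measurePreserving_mul_left μ S.flipP)).setIntegral_preimage_emb
    ((measurableEmbedding_mulRight S.flipP).comp (measurableEmbedding_mulLeft S.flipP)) f
    (iwahori F : Set (PGL2 F))
  have e : ((fun x => x * S.flipP) ∘ fun x => S.flipP * x) ⁻¹' (iwahori F : Set (PGL2 F)) =
      iwahori F := by
    ext x
    refine ⟨fun hx => ?_, fun hx => S.flipP_mul_mul_flipP_mem_iwahori hx⟩
    have := S.flipP_mul_mul_flipP_mem_iwahori hx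
    simp only [Function.comp_apply, ← mul_assoc, S.flipP_mul_self, one_mul,
      S.mul_flipP_cancel] at this
    exact this
  rwa [e] at h

/-- The integral over the maximal compact subgroup in terms of integrals over the Iwahori
subgroup. -/
theorem UniformizerSystem.setIntegral_integralGL2ModCenter (S : UniformizerSystem F)
    [μ.IsMulLeftInvariant] [μ.IsMulRightInvariant] (hK : μ (integralGL2ModCenter F) ≠ ⊤)
    (f : smoothInd (GL (Fin 2) F) (upperTriangularGL2 F)) (y : PGL2 F) :
    ∫ x in (integralGL2ModCenter F : Set (PGL2 F)), descend f (x * y) ∂μ =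
      iwahoriIntegral μ f y + residueCard F * iwahoriIntegral μ f (S.flipP * y) := by
  have hm : ∀ i, MeasurableSet
      ((fun x => (S.integralCoset i : PGL2 F)⁻¹ * x) ⁻¹' (iwahori F : Set (PGL2 F))) := fun i =>
    (isOpen_iwahori.preimage (continuous_const_mul _)).measurableSet
  have hJ : μ (iwahori F) ≠ ⊤ := ne_top_of_le_ne_top hK
    (measure_mono iwahori_le_integralGL2ModCenter)
  have hi : ∀ i, ∫ x in ((fun x => (S.integralCoset i : PGL2 F)⁻¹ * x) ⁻¹'
      (iwahori F : Set (PGL2 F))), descend f (x * y) ∂μ =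
      ∫ x in (iwahori F : Set (PGL2 F)), descend f (S.integralCoset i * x * y) ∂μ := fun i => by
    have h := (measurePreserving_mul_left μ (S.integralCoset i : PGL2 F)⁻¹).setIntegral_preimage_emb
      (measurableEmbedding_mulLeft _) (fun x => descend f (S.integralCoset i * x * y))
      (iwahori F : Set (PGL2 F))
    simpa only [mul_inv_cancel_left] using h
  rw [S.integralGL2ModCenter_eq, integral_iUnion_fintype hm, Fintype.sum_option]
  · congr 1
    · rw [hi]
      simp [iwahoriIntegral, UniformizerSystem.integralCoset]
    · have h2 : ∀ i, ∫ x in ((fun x => (S.integralCoset (some i) : PGL2 F)⁻¹ * x) ⁻¹'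
          (iwahori F : Set (PGL2 F))), descend f (x * y) ∂μ =
          iwahoriIntegral μ f (S.flipP * y) := fun i => by
        -- Each big-cell coset contributes the same integral: replace its representative by `flip`,
        -- then substitute `x ↦ flip x flip`, which preserves `I` and the measure.
        obtain ⟨b, hb, he⟩ := S.bigCell_eq_mul_flip i
        have h3 : ∀ x : PGL2 F, descend f (S.integralCoset (some i) * x * y) =
            descend f (S.flipP * x * S.flipP * (S.flipP * y)) := fun x => by
          rw [← mul_assoc _ S.flipP, S.mul_flipP_cancel,
            ← descend_upper_mul f hb (S.flipP * x * y)]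
          simp only [UniformizerSystem.integralCoset, he, QuotientGroup.mk_mul, mul_assoc]
          rfl
        rw [hi, iwahoriIntegral]
        simp only [h3]
        exact S.setIntegral_iwahori_conj μ fun x => descend f (x * (S.flipP * y))
      simp [h2]
  · intro i j hij
    refine Set.disjoint_left.2 fun x hx hx' => hij (S.integralCoset_injective i j ?_)
    have := mul_mem (show (S.integralCoset i : PGL2 F)⁻¹ * x ∈ iwahori F from hx)
      (inv_mem (show (S.integralCoset j : PGL2 F)⁻¹ * x ∈ iwahori F from hx'))
    rw [mul_inv_rev, inv_inv, mul_assoc, mul_inv_cancel_left] at this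
    exact mk_mem_iwahori.1 this
  · intro i
    refine integrableOn_descend μ f ?_ y
    rwa [measure_preimage_mul]

/-- A function whose integrals over all translates of the Iwahori subgroup are invariant under
`flip` is constant. -/
theorem UniformizerSystem.mem_constFunctions_of_iwahoriIntegral (S : UniformizerSystem F)
    [μ.IsHaarMeasure] [μ.IsMulRightInvariant] (hK : μ (integralGL2ModCenter F) ≠ ⊤)
    (f : smoothInd (GL (Fin 2) F) (upperTriangularGL2 F))
    (hf : ∀ y, iwahoriIntegral μ f (S.flipP * y) = iwahoriIntegral μ f y) :
    f ∈ constFunctions (GL (Fin 2) F) (upperTriangularGL2 F) := by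
  have hJ : μ (iwahori F) ≠ ⊤ := ne_top_of_le_ne_top hK
    (measure_mono iwahori_le_integralGL2ModCenter)
  have hJ0 : μ (iwahori F) ≠ 0 := (isOpen_iwahori.measure_pos μ ⟨1, one_mem _⟩).ne'
  have hJr : (μ.real (iwahori F) : ℂ) ≠ 0 := by
    exact_mod_cast (ENNReal.toReal_pos hJ0 hJ).ne'
  -- The group leaving the Iwahori average invariant on the left. It contains `flip` by hypothesis;
  -- under that hypothesis the average over `K` is `1 + q` times the one over `I`, so it also
  -- contains `K`, hence is everything.
  let H : Subgroup (PGL2 F) :=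
    { carrier := {k | ∀ y, iwahoriIntegral μ f (k * y) = iwahoriIntegral μ f y}
      one_mem' := fun y => by rw [one_mul]
      mul_mem' := fun {a b} ha hb y => by rw [mul_assoc, ha, hb]
      inv_mem' := fun {a} ha y => by rw [← ha (a⁻¹ * y), mul_inv_cancel_left] }
  have hH : H = ⊤ := by
    refine S.eq_top_of_integral_le_of_flipP_mem (fun k hk y => ?_) hf
    have h1 : ∀ y, ∫ x in (integralGL2ModCenter F : Set (PGL2 F)), descend f (x * y) ∂μ =
        (1 + residueCard F) * iwahoriIntegral μ f y := fun y => by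
      rw [S.setIntegral_integralGL2ModCenter μ hK, hf, add_mul, one_mul]
    have h2 := setIntegral_subgroup_mul_right μ (integralGL2ModCenter F) hk
      fun x => descend f (x * y)
    simp only [mul_assoc] at h2
    rw [h1, h1] at h2
    refine mul_left_cancel₀ ?_ h2
    exact_mod_cast (by lia : 1 + residueCard F ≠ 0)
  refine (mem_constFunctions_iff f).2 ⟨iwahoriIntegral μ f 1 / μ.real (iwahori F), fun g => ?_⟩
  obtain ⟨y, hy⟩ := S.exists_descend_eq f g
  have h1 : iwahoriIntegral μ f y = iwahoriIntegral μ f 1 := by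
    have : y ∈ H := hH ▸ Subgroup.mem_top y
    simpa using this 1
  rw [← h1, iwahoriIntegral, setIntegral_congr_fun isOpen_iwahori.measurableSet hy,
    setIntegral_const, Complex.real_smul, mul_div_cancel_left₀ _ hJr]

end Functional

/-! ### Existence of a unitary completion -/

section Existence

variable {F : Type*} [Field F] [ValuativeRel F] [TopologicalSpace F] [IsNonarchimedeanLocalField F]

theorem exists_isOpen_smoothIndRep_eq (f : smoothInd (GL (Fin 2) F) (upperTriangularGL2 F)) :
    ∃ U : Subgroup (GL (Fin 2) F), IsOpen (U : Set (GL (Fin 2) F)) ∧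
      ∀ u ∈ U, smoothIndRep _ _ u f = f := by
  obtain ⟨f, hB, U, hU, hf⟩ := f
  exact ⟨U, hU, fun u hu => Subtype.ext (funext fun x => hf u hu x)⟩

variable [MeasurableSpace (PGL2 F)] (μ : Measure (PGL2 F))

theorem continuous_iwahoriIntegral (f : smoothInd (GL (Fin 2) F) (upperTriangularGL2 F)) :
    Continuous (iwahoriIntegral μ f) := by
  obtain ⟨U, hU, hf⟩ := exists_isOpen_smoothIndRep_eq f
  refine (QuotientGroup.isQuotientMap_mk _).continuous_iff.2
    (continuous_of_forall_mul_right hU fun u hu x => ?_)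
  simp only [Function.comp_apply]
  rw [QuotientGroup.mk_mul, ← iwahoriIntegral_smoothIndRep, hf u hu]

namespace UniformizerSystem

variable [BorelSpace (PGL2 F)] (S : UniformizerSystem F)

/-- The intertwiner from the smooth Steinberg representation to functions on `PGL2`. -/
def toFunctions (hJ : μ (iwahori F) ≠ ⊤) : (smoothInd (GL (Fin 2) F) (upperTriangularGL2 F) ⧸
    constFunctions (GL (Fin 2) F) (upperTriangularGL2 F)) →ₗ[ℂ] PGL2 F → ℂ :=
  (constFunctions (GL (Fin 2) F) (upperTriangularGL2 F)).liftQ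
    -- The difference kills constants, and its vanishing for all `y` is exactly the
    -- `flip`-invariance that forces `f` to be constant.
    { toFun := fun f y => iwahoriIntegral μ f y - iwahoriIntegral μ f (S.flipP * y)
      map_add' := fun f g => by
        have h : ∀ y, iwahoriIntegral μ (f + g) y =
            iwahoriIntegral μ f y + iwahoriIntegral μ g y := fun y => by
          rw [iwahoriIntegral, iwahoriIntegral, iwahoriIntegral,
            ← integral_add (integrableOn_descend μ f hJ y) (integrableOn_descend μ g hJ y)]
          congr 1
          ext x
          obtain ⟨a, ha⟩ := QuotientGroup.mk_surjective (x * y)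
          rw [← ha]
          rfl
        ext y
        simp only [h, Pi.add_apply]
        ring
      map_smul' := fun c f => by
        have h : ∀ y, iwahoriIntegral μ (c • f) y = c * iwahoriIntegral μ f y := fun y => by
          rw [iwahoriIntegral, iwahoriIntegral, ← integral_const_mul]
          congr 1
          ext x
          obtain ⟨a, ha⟩ := QuotientGroup.mk_surjective (x * y)
          rw [← ha]
          rfl
        ext y
        simp only [h, Pi.smul_apply, smul_eq_mul, RingHom.id_apply]
        ring }
    (by
      intro f hf
      obtain ⟨c, hc⟩ := (mem_constFunctions_iff f).1 hf
      have h : ∀ x, descend f x = c := fun x => by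
        obtain ⟨a, rfl⟩ := QuotientGroup.mk_surjective x
        exact hc a
      rw [LinearMap.mem_ker]
      ext y
      simp [iwahoriIntegral, h])

variable {μ} (hJ : μ (iwahori F) ≠ ⊤)

theorem toFunctions_mk (f : smoothInd (GL (Fin 2) F) (upperTriangularGL2 F)) (y : PGL2 F) :
    S.toFunctions μ hJ (Submodule.Quotient.mk f) y =
      iwahoriIntegral μ f y - iwahoriIntegral μ f (S.flipP * y) := rfl

theorem toFunctions_smoothSteinberg (g : GL (Fin 2) F)
    (v : smoothInd (GL (Fin 2) F) (upperTriangularGL2 F) ⧸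
      constFunctions (GL (Fin 2) F) (upperTriangularGL2 F)) (y : PGL2 F) :
    S.toFunctions μ hJ (smoothSteinberg F g v) y = S.toFunctions μ hJ v (y * g) := by
  obtain ⟨f, rfl⟩ := Submodule.Quotient.mk_surjective _ v
  rw [smoothSteinberg_mk, toFunctions_mk, toFunctions_mk, iwahoriIntegral_smoothIndRep,
    iwahoriIntegral_smoothIndRep, mul_assoc]

theorem continuous_toFunctions (v : smoothInd (GL (Fin 2) F) (upperTriangularGL2 F) ⧸
      constFunctions (GL (Fin 2) F) (upperTriangularGL2 F)) :
    Continuous (S.toFunctions μ hJ v) := by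
  obtain ⟨f, rfl⟩ := Submodule.Quotient.mk_surjective _ v
  exact (continuous_iwahoriIntegral μ f).sub
    ((continuous_iwahoriIntegral μ f).comp (continuous_const_mul _))

/-- Makes evaluation at `1` an Iwahori-invariant functional on the Steinberg representation, so the
decay estimate applies to it. -/
theorem toFunctions_mul [μ.IsMulRightInvariant] {j : PGL2 F} (hj : j ∈ iwahori F)
    (v : smoothInd (GL (Fin 2) F) (upperTriangularGL2 F) ⧸
      constFunctions (GL (Fin 2) F) (upperTriangularGL2 F)) (y : PGL2 F) :
    S.toFunctions μ hJ v (j * y) = S.toFunctions μ hJ v y := by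
  obtain ⟨f, rfl⟩ := Submodule.Quotient.mk_surjective _ v
  have e : S.flipP * (j * y) = (S.flipP * j * S.flipP) * (S.flipP * y) := by
    rw [← mul_assoc _ S.flipP, S.mul_flipP_cancel, mul_assoc]
  rw [toFunctions_mk, toFunctions_mk, iwahoriIntegral_mul μ f hj, e,
    iwahoriIntegral_mul μ f (S.flipP_mul_mul_flipP_mem_iwahori hj)]

theorem toFunctions_iwahoriVector_one :
    S.toFunctions μ hJ (iwahoriVector F) 1 = μ.real (iwahori F) := by
  have h1 : ∀ x ∈ iwahori F, descend (ballSmooth F) (x * 1) = 1 := fun x hx => by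
    classical
    obtain ⟨j, rfl⟩ := QuotientGroup.mk_surjective x
    rw [mul_one]
    change ballInd F j = 1
    rw [ballInd_apply, if_pos (show j ∈ ballSet F from (mk_mem_iwahori.1 hx).1)]
  have h2 : ∀ x ∈ iwahori F, descend (ballSmooth F) (x * (S.flipP * 1)) = 0 := fun x hx => by
    classical
    obtain ⟨j, rfl⟩ := QuotientGroup.mk_surjective x
    rw [mul_one]
    change ballInd F (j * S.flip) = 0
    rw [S.ballInd_mul_flip, ballInd_apply, if_pos (show j ∈ ballSet F from (mk_mem_iwahori.1 hx).1), sub_self]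
  rw [iwahoriVector, toFunctions_mk, iwahoriIntegral, iwahoriIntegral,
    setIntegral_congr_fun isOpen_iwahori.measurableSet h1,
    setIntegral_congr_fun isOpen_iwahori.measurableSet h2]
  simp

/-- The image of `w` has the decay of the matrix coefficient of `w`; every other vector is a
combination of translates of `w`, and right translation preserves the measure. -/
theorem memLp_toFunctions [μ.IsHaarMeasure] [μ.IsMulRightInvariant]
    (hμ : μ (integralGL2ModCenter F) = ENNReal.ofReal (((residueCard F : ℝ) - 1) / 2))
    (v : smoothInd (GL (Fin 2) F) (upperTriangularGL2 F) ⧸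
      constFunctions (GL (Fin 2) F) (upperTriangularGL2 F)) :
    MemLp (S.toFunctions μ hJ v) 2 μ := by
  have h0 : MemLp (S.toFunctions μ hJ (iwahoriVector F)) 2 μ := by
    have hJ0 : μ (iwahori F) ≠ 0 := (isOpen_iwahori.measure_pos μ ⟨1, one_mem _⟩).ne'
    have hJr : ‖S.toFunctions μ hJ (iwahoriVector F) 1‖ ≠ 0 := by
      rw [toFunctions_iwahoriVector_one, norm_ne_zero_iff]
      exact_mod_cast (ENNReal.toReal_pos hJ0 hJ).ne'
    refine ⟨(S.continuous_toFunctions hJ _).aestronglyMeasurable, ?_⟩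
    rw [eLpNorm_lt_top_iff_lintegral_rpow_enorm_lt_top (by simp) (by simp)]
    simp only [ENNReal.toReal_ofNat, ENNReal.rpow_ofNat]
    rw [S.lintegral_enorm_sq μ hμ (S.continuous_toFunctions hJ _) hJr fun n g hg => ?_]
    · exact ENNReal.ofReal_lt_top
    · have h := S.norm_apply_smoothSteinberg (LinearMap.proj 1 ∘ₗ S.toFunctions μ hJ)
        (fun j hj v => by
          simp only [LinearMap.comp_apply, LinearMap.proj_apply, toFunctions_smoothSteinberg, one_mul]
          rw [← mul_one (j : PGL2 F), toFunctions_mul S hJ (mk_mem_iwahori.2 hj)]) hg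
      simpa only [LinearMap.comp_apply, LinearMap.proj_apply, toFunctions_smoothSteinberg,
        one_mul] using h
  have hv : v ∈ Submodule.span ℂ (Set.range fun h => smoothSteinberg F h (iwahoriVector F)) := by
    rw [span_iwahoriVector]
    trivial
  induction hv using Submodule.span_induction with
  | mem v hv =>
    obtain ⟨h, rfl⟩ := hv
    have e : S.toFunctions μ hJ (smoothSteinberg F h (iwahoriVector F)) =
        S.toFunctions μ hJ (iwahoriVector F) ∘ fun x => x * (h : PGL2 F) :=
      funext fun x => S.toFunctions_smoothSteinberg hJ h _ x
    rw [e]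
    exact h0.comp_measurePreserving (measurePreserving_mul_right μ _)
  | zero => rw [map_zero]; exact MemLp.zero
  | add v w _ _ hv hw => rw [map_add]; exact hv.add hw
  | smul a v _ hv => rw [map_smul]; exact hv.const_smul a

theorem toFunctions_injective [μ.IsHaarMeasure] [μ.IsMulRightInvariant]
    (hK : μ (integralGL2ModCenter F) ≠ ⊤) : Function.Injective (S.toFunctions μ hJ) := by
  refine (injective_iff_map_eq_zero _).2 fun v hv => ?_
  obtain ⟨f, rfl⟩ := Submodule.Quotient.mk_surjective _ v
  refine (Submodule.Quotient.mk_eq_zero _).2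
    (S.mem_constFunctions_of_iwahoriIntegral μ hK f fun y => ?_)
  exact (sub_eq_zero.1 (congrFun hv y)).symm

end UniformizerSystem

theorem exists_isCompletionOf_smoothSteinberg {F : Type u} [Field F] [ValuativeRel F]
    [TopologicalSpace F] [IsNonarchimedeanLocalField F] [MeasurableSpace (PGL2 F)]
    [BorelSpace (PGL2 F)] (μ : Measure (PGL2 F)) [μ.IsHaarMeasure]
    (hμ : μ (integralGL2ModCenter F) = ENNReal.ofReal (((residueCard F : ℝ) - 1) / 2)) :
    ∃ (H : Type u) (_ : NormedAddCommGroup H) (_ : InnerProductSpace ℂ H) (_ : CompleteSpace H)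
      (π : UnitaryRep (GL (Fin 2) F) H), π.IsCompletionOf (smoothSteinberg F) := by
  obtain ⟨S⟩ := nonempty_uniformizerSystem F
  have hK : μ (integralGL2ModCenter F) ≠ ⊤ := by
    rw [hμ]
    exact ENNReal.ofReal_ne_top
  have hJ : μ (iwahori F) ≠ ⊤ := ne_top_of_le_ne_top hK
    (measure_mono iwahori_le_integralGL2ModCenter)
  have : μ.IsMulRightInvariant := S.isMulRightInvariant μ hK
  refine exists_unitaryRep_isCompletionOf (E := Lp ℂ 2 μ) (smoothSteinberg F)
    (fun g => Lp.compMeasurePreservingₗᵢ ℂ (fun x => x * (g : PGL2 F))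
      (measurePreserving_mul_right μ _))
    (linearMapToLp (S.toFunctions μ hJ) (S.memLp_toFunctions hJ hμ)) ?_ ?_ ?_
  · intro v w h
    have h1 := (MemLp.toLp_eq_toLp_iff (S.memLp_toFunctions hJ hμ v) (S.memLp_toFunctions hJ hμ w)).1 h
    -- Almost everywhere equality of continuous functions is equality, because Haar measure is
    -- positive on nonempty open sets.
    exact S.toFunctions_injective hJ hK
      (((S.continuous_toFunctions hJ v).ae_eq_iff_eq μ (S.continuous_toFunctions hJ w)).1 h1)
  · intro g v
    refine (Lp.toLp_compMeasurePreserving (S.memLp_toFunctions hJ hμ v)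
      (measurePreserving_mul_right μ (g : PGL2 F))).trans ?_
    refine (MemLp.toLp_eq_toLp_iff _ (S.memLp_toFunctions hJ hμ _)).2 (Filter.Eventually.of_forall fun x => ?_)
    exact (S.toFunctions_smoothSteinberg hJ g v x).symm
  · intro v
    obtain ⟨f, rfl⟩ := Submodule.Quotient.mk_surjective _ v
    obtain ⟨U, hU, hf⟩ := exists_isOpen_smoothIndRep_eq f
    refine continuous_of_forall_mul_right hU fun u hu g => ?_
    rw [map_mul, Module.End.mul_apply, smoothSteinberg_mk u, hf u hu]

end Existence
end

theorem mainTheorem4 (F : Type u) [Field F] [ValuativeRel F] [TopologicalSpace F]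
    [IsNonarchimedeanLocalField F]
    [MeasurableSpace (GL (Fin 2) F ⧸ Subgroup.center (GL (Fin 2) F))]
    [BorelSpace (GL (Fin 2) F ⧸ Subgroup.center (GL (Fin 2) F))]
    (μ : Measure (GL (Fin 2) F ⧸ Subgroup.center (GL (Fin 2) F))) [μ.IsHaarMeasure]
    (hμ : μ (integralGL2ModCenter F : Set (GL (Fin 2) F ⧸ Subgroup.center (GL (Fin 2) F))) =
      ENNReal.ofReal (((residueCard F : ℝ) - 1) / 2)) :
    (∃ (H : Type u) (_ : NormedAddCommGroup H) (_ : InnerProductSpace ℂ H) (_ : CompleteSpace H)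
      (π : UnitaryRep (GL (Fin 2) F) H), π.IsCompletionOf (smoothSteinberg F)) ∧
    ∀ (H : Type v) [NormedAddCommGroup H] [InnerProductSpace ℂ H] [CompleteSpace H]
      (π : UnitaryRep (GL (Fin 2) F) H), π.IsCompletionOf (smoothSteinberg F) →
        π.HasFormalDimension μ 1 :=
  ⟨exists_isCompletionOf_smoothSteinberg μ hμ, fun _ _ _ _ _ hπ =>
    UnitaryRep.hasFormalDimension_one μ hμ hπ⟩
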